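/- **Conventions.** Let $\mathbb R^{3,2}=\langle o,p,q\rangle\oplus_\perp\mathbb R^2$ with $(o,o)=(q,q)=(o,p)=(p,q)=0$, $(o,q)=-1$, $(p,p)=-1$. A point $x\in\mathbb R^2$ has the lift $\xi=o+x+\frac12(x,x)q$, and a curve $x$ with unit normal field $n$ has the Legendre lift $\lambda=\langle \xi,\ p+n+(n,x)q\rangle$, whose projective points are the oriented circles (lines and the point $x(u)$ included) that touch $x$ at $x(u)$ with normal $n(u)$. A Legendre curve on an interval $I$ is a smooth curve $\Lambda$ of null $2$-planes in $\mathbb R^{3,2}$ with $\sigma'\perp\Lambda$ for all smooth sections $\sigma$ of $\Lambda$; two Legendre curves are Ribaucour transforms of each other if they intersect in a line at each $u\in I$ (i.e. share exactly one oriented circle). Two immersed planar curves $x,\hat x$ form a Ribaucour pair at $u$ if $x(u)\ne\hat x(u)$ and they share a common tangent circle (or line) there, i.e. $\dim\langle\xi,\xi',\hat\xi,\hat\xi'\rangle(u)=3$. Two discrete curves $x,\hat x$ on an interval $I\subset\mathbb Z$ (adjacent points of a discrete curve being distinct) form a Ribaucour pair if $x_i\neq\hat x_i$ for all $i$ and the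 endpoints of corresponding edges are concircular, i.e. $\dim\langle\xi_i,\xi_{i+1},\hat\xi_i,\hat\xi_{i+1}\rangle=3$. **Theorem.** Any two planar curves admit, under the following regularity assumptions, common Ribaucour transforms, which come in a $1$-parameter family in the smooth case and in a $2$-parameter family in the discrete case. More precisely: *(Smooth case.)* Let $I\subset\mathbb R$ be an interval with more than one point and let $x_0,x_1:I\to\mathbb R^2$ be smooth regular curves with smooth unit normal fields $n_0,n_1$ and Legendre lifts $\lambda_0,\lambda_1$. Assume that the curves do not touch a common oriented circle at corresponding points, that is, $\lambda_0(u)\cap\lambda_1(u)=0$ for all $u\in I$. Then $b=\lambda_0\oplus\lambda_1$ is a bundle of $(2,2)$-planes, and there are a family $(\hat\lambda_c)_{c\in\mathbb RP^1}$ of null $2$-plane subbundles of $b$ and a family of maps $\hat x_c:I\to\mathbb R^2$ such that: 1. the family depends smoothly on $c$: there are smooth frames $(s_1,s_2)$ of $\lambda_0$ and $(t_1,t_2)$ of $\lambda_1$ with $\hat\lambda_{[a_1:a_2]}=\langle a_1s_1+a_2s_2,\ a_1t_1+a_2t_2\rangle$; 2. each $\hat\lambda_c$ is a Legendre curve and a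 Ribaucour transform of both $\lambda_0$ and $\lambda_1$, and each Legendre curve with these properties equals $\hat\lambda_c$ for exactly one $c$; 3. for $c\ne c'$ and $u\in I$, $\hat\lambda_c(u)\cap\hat\lambda_{c'}(u)=0$; and for each $u\in I$ and each null $2$-plane $W$ in $\mathbb R^{3,2}$ that intersects both $\lambda_0(u)$ and $\lambda_1(u)$ non-trivially there is exactly one $c$ with $\hat\lambda_c(u)=W$; 4. $\hat x_c$ is the curve of points of $\hat\lambda_c$: wherever $q\notin\hat\lambda_c(u)$ (that is, the point is finite), $\hat x_c$ is smooth and its lift satisfies $\hat\xi_c(u)\in\hat\lambda_c(u)$; 5. call $u$ regular for $c$ if $q\notin\hat\lambda_c(u)$, $\hat x_c'(u)\neq0$ and $\hat x_c(u)\ne x_0(u),x_1(u)$; then $\hat x_c$ forms a Ribaucour pair with $x_0$ as well as with $x_1$ at every $u$ that is regular for $c$; 6. for each $u_0\in I$, for all but at most five $c$, all $u\in I$ close to $u_0$ are regular for $c$; and for all but countably many $c$ the regular $u$ are dense in $I$. *(Discrete case.)* Let $I\subset\mathbb Z$ be an interval (finite or infinite), $i_0\in I$, and let $x_0,x_1:I\to\mathbb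 R^2$ be such that for each edge $(i,i+1)$ in $I$ the four points $x_0(i),x_0(i+1),x_1(i),x_1(i+1)$ are pairwise distinct. Then there is a residual (hence dense) set $G\subset\mathbb R^2$, which can be taken open if $I$ is finite, such that for each $y\in G$ there is exactly one discrete curve $\hat x^y:I\to\mathbb R^2$ with $\hat x^y(i_0)=y$ that forms a Ribaucour pair with $x_0$ as well as with $x_1$. The curves $\hat x^y$ depend smoothly on $y$: there is a map $F:\mathbb R^2\times I\to\mathbb R^2$ with $F(y,i)=\hat x^y(i)$ for all $y\in G$, $i\in I$, such that each $F(\cdot,i)$ is smooth at each $y\in G$. -/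

import Mathlib

open scoped ContDiff Topology RealInnerProductSpace

noncomputable section

namespace Ribaucour

/-- The Euclidean plane. -/
abbrev Plane : Type := EuclideanSpace ℝ (Fin 2)

/-- The space of Lie sphere geometry of the plane: `(a, b, c, v)` stands for the vector
`a o + b p + c q + v` of the orthogonal sum of `⟨o, q⟩`, `⟨p⟩` and the Euclidean plane. -/
abbrev LieSpace : Type := ℝ × ℝ × ℝ × Plane

/-- The inner product of signature (3,2): `(o,o) = (q,q) = 0`, `(o,q) = -1`, `(p,p) = -1`. Its
restriction to the orthogonal complement of `p` has signature (3,1) and is the inner product of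
the Moebius geometric model. -/
def lieInner (v w : LieSpace) : ℝ :=
  -(v.1 * w.2.2.1) - v.2.2.1 * w.1 - v.2.1 * w.2.1 + ⟪v.2.2.2, w.2.2.2⟫

/-- The isotropic vector `q`, which represents the point at infinity. -/
def infinityVec : LieSpace := (0, 0, 1, 0)

/-- The Euclidean lift `o + x + (x,x)/2 q` of a point of the plane. -/
def pointLift (x : Plane) : LieSpace := (1, 0, ⟪x, x⟫ / 2, x)

/-- The lift `p + n + (n,x) q` of the oriented line through `x` with unit normal `n`. -/
def lineLift (x n : Plane) : LieSpace := (0, 1, ⟪n, x⟫, n)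

/-- The plane `λ(u)` spanned by the lifts of the point `x(u)` and of the tangent line there. Its
projective points are the oriented circles (lines and the point `x(u)` included) that touch the
curve `x` at `x(u)`, with normal `n(u)`. -/
def legendreLift (x n : ℝ → Plane) (u : ℝ) : Submodule ℝ LieSpace :=
  Submodule.span ℝ {pointLift (x u), lineLift (x u) (n u)}

/-- A smooth, regular curve in the plane on the interval `I`, with a smooth unit normal field. -/
structure IsFramedCurve (I : Set ℝ) (x n : ℝ → Plane) : Prop where
  smooth_curve : ContDiffOn ℝ ∞ x I
  smooth_normal : ContDiffOn ℝ ∞ n I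
  immersed : ∀ u ∈ I, derivWithin x I u ≠ 0
  unit : ∀ u ∈ I, ‖n u‖ = 1
  orthogonal : ∀ u ∈ I, ⟪derivWithin x I u, n u⟫ = 0

/-- A null (totally isotropic) subspace of dimension 2. -/
structure IsNullPlane (W : Submodule ℝ LieSpace) : Prop where
  finrank_eq : Module.finrank ℝ W = 2
  null : ∀ v ∈ W, ∀ w ∈ W, lieInner v w = 0

/-- A subspace of dimension 4 on which the inner product has signature (2,2). -/
def IsTwoTwoPlane (W : Submodule ℝ LieSpace) : Prop :=
  ∃ e : Fin 4 → LieSpace, Submodule.span ℝ (Set.range e) = W ∧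
    ∀ i j, lieInner (e i) (e j) = if i = j then (if i < 2 then 1 else -1) else 0

/-- A Legendre curve on the interval `I`: a smooth curve of null 2-planes that satisfies the
contact condition `σ' ⊥ Λ` for every smooth section `σ` of `Λ`. -/
structure IsLegendreCurve (I : Set ℝ) (Λ : ℝ → Submodule ℝ LieSpace) : Prop where
  frame : ∃ σ τ : ℝ → LieSpace, ContDiffOn ℝ ∞ σ I ∧ ContDiffOn ℝ ∞ τ I ∧
    ∀ u ∈ I, Λ u = Submodule.span ℝ {σ u, τ u}
  null : ∀ u ∈ I, IsNullPlane (Λ u)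
  contact : ∀ σ : ℝ → LieSpace, ContDiffOn ℝ ∞ σ I → (∀ u ∈ I, σ u ∈ Λ u) →
    ∀ u ∈ I, ∀ w ∈ Λ u, lieInner (derivWithin σ I u) w = 0

/-- Ribaucour transforms in Lie sphere geometry: at every parameter value the two Legendre curves
share exactly one oriented circle. (Over a 1-dimensional base, there is no further condition: the
flatness that has to be required over bases of higher dimension holds always.) -/
def IsLieRibaucourPair (I : Set ℝ) (Λ Λ' : ℝ → Submodule ℝ LieSpace) : Prop :=
  ∀ u ∈ I, Module.finrank ℝ ↥(Λ u ⊓ Λ' u) = 1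

/-- The curves `x` and `y`, regular at `u`, have distinct points and share a common tangent circle
at `u`: the lifts and their derivatives span a space of dimension 3, which represents that
circle (or line). -/
structure IsRibaucourPairAt (I : Set ℝ) (x y : ℝ → Plane) (u : ℝ) : Prop where
  ne : x u ≠ y u
  immersed_left : derivWithin x I u ≠ 0
  immersed_right : derivWithin y I u ≠ 0
  circular : Module.finrank ℝ (Submodule.span ℝ
    {pointLift (x u), derivWithin (fun v => pointLift (x v)) I u,
      pointLift (y u), derivWithin (fun v => pointLift (y v)) I u}) = 3

/-- A discrete curve on `I`: adjacent points are distinct. -/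
def IsDiscreteCurve (I : Set ℤ) (x : ℤ → Plane) : Prop :=
  ∀ i, i ∈ I → i + 1 ∈ I → x i ≠ x (i + 1)

/-- A Ribaucour pair of discrete curves: corresponding points are distinct and the endpoints of
corresponding edges are concircular, that is, their lifts span a space of dimension 3. (As this
space contains independent isotropic vectors of a Lorentz space, its signature is (2,1).) -/
structure IsDiscreteRibaucourPair (I : Set ℤ) (x y : ℤ → Plane) : Prop where
  ne : ∀ i ∈ I, x i ≠ y i
  circular : ∀ i, i ∈ I → i + 1 ∈ I → Module.finrank ℝ (Submodule.span ℝ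
    {pointLift (x i), pointLift (x (i + 1)), pointLift (y i), pointLift (y (i + 1))}) = 3

/-- `y` is a discrete curve on `I` that is a Ribaucour transform of both `x₀` and `x₁`. -/
structure IsCommonDiscreteTransform (I : Set ℤ) (x₀ x₁ y : ℤ → Plane) : Prop where
  curve : IsDiscreteCurve I y
  pair₀ : IsDiscreteRibaucourPair I x₀ y
  pair₁ : IsDiscreteRibaucourPair I x₁ y

/-- A Legendre curve that is a Ribaucour transform of both `Λ₀` and `Λ₁`. -/
structure IsCommonLieTransform (I : Set ℝ) (Λ₀ Λ₁ Λ : ℝ → Submodule ℝ LieSpace) : Prop where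
  legendre : IsLegendreCurve I Λ
  pair₀ : IsLieRibaucourPair I Λ₀ Λ
  pair₁ : IsLieRibaucourPair I Λ₁ Λ

/-- The points `y` of the curve of null planes `Λ` are regular at `u`, relative to `x₀` and `x₁`:
`y(u)` is finite, `y` is immersed at `u`, and `y(u)` differs from `x₀(u)` and `x₁(u)`. -/
structure IsRegularPoint (I : Set ℝ) (x₀ x₁ : ℝ → Plane) (Λ : ℝ → Submodule ℝ LieSpace)
    (y : ℝ → Plane) (u : ℝ) : Prop where
  finite : infinityVec ∉ Λ u
  immersed : derivWithin y I u ≠ 0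
  ne₀ : y u ≠ x₀ u
  ne₁ : y u ≠ x₁ u

end Ribaucour

end

open Ribaucour

open Ribaucour

open Set Submodule

/-! Smooth case. Totally isotropic subspaces have dimension at most 2, so two disjoint null planes
pair nondegenerately (`gram_ne_zero`). Frames `s`, `t` of λ₀, λ₁ can then be chosen such that the
pairing of `comb s a` with `comb t b` is a nonzero multiple of det(a, b) (`IsHyperbolicFrame`). The
null planes that meet both λ₀ and λ₁ are exactly the spans of `comb s a` and `comb t a`, one for
each point [a] of the projective line. For constant a, nullity of this plane makes every contact
condition automatic, except that the derivative of `comb s a` be orthogonal to `comb t a`. It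
therefore suffices that the derivatives of s₀, s₁ are orthogonal to λ₁, which is a linear
differential equation for the coefficients of `s` in a given frame (`exists_parallelFrame`).
Conversely, contact forces the direction [a(u)] of any common transform to be locally constant,
hence constant (`existsUnique_eqOn`).

The point of a member is the vector of its plane without p-component. If the curve of points is
singular at u, the derivative of this vector is orthogonal to a normal vector e of the bundle b.
This is the vanishing of a binary quadratic form in a. The form is not zero: at the parameter whose
plane contains ξ₀ it is a nonzero multiple of (ξ₀', e). So singularity excludes at most two
parameters, and the conditions that q, ξ₀ or ξ₁ lie in the plane exclude at most one each; hence the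
bound five. A countable dense set of parameter values gives the density statement.

Discrete case. Given a point y over one end of an edge, the point over the other end must lie on the
circle through y and the edge of x₀ and on the one through y and the edge of x₁. Inversion at y
turns these circles into lines, whose intersection is the second common point. For generic y this
defines a smooth involution of an open dense set. As such maps are open, their compositions again
have open dense domains, and a countable intersection of these is residual. -/

/-! ### Linear differential equations on arbitrary intervals. -/

theorem norm_le_exp_of_norm_deriv_le_right {E : Type*} [NormedAddCommGroup E] [NormedSpace ℝ E]
    {f f' : ℝ → E} {T C : ℝ} (hf : ∀ t ∈ Icc 0 T, HasDerivWithinAt f (f' t) (Icc 0 T) t)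
    (hC : ∀ t ∈ Icc 0 T, ‖f' t‖ ≤ C * ‖f t‖) :
    ∀ t ∈ Icc 0 T, ‖f t‖ ≤ ‖f 0‖ * Real.exp (C * t) := by
  intro t ht
  have := norm_le_gronwallBound_of_norm_deriv_right_le (f := f) (f' := f') (δ := ‖f 0‖) (K := C)
    (ε := 0) (a := 0) (b := T) (fun s hs => (hf s hs).continuousWithinAt)
    (fun s hs => (hf s (Ico_subset_Icc_self hs)).mono_of_mem_nhdsWithin
      (Icc_mem_nhdsGE_of_mem hs)) le_rfl
    (fun s hs => by simpa using hC s (Ico_subset_Icc_self hs)) t ht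
  simpa [gronwallBound_ε0] using this

/-- Translation on the right of `t₀` and reflection on its left reduce this to the one-sided
estimate. -/
theorem norm_le_exp_of_norm_deriv_le {E : Type*} [NormedAddCommGroup E] [NormedSpace ℝ E]
    {f f' : ℝ → E} {a b t₀ C : ℝ} (ht₀ : t₀ ∈ Icc a b)
    (hf : ∀ t ∈ Icc a b, HasDerivWithinAt f (f' t) (Icc a b) t)
    (hC : ∀ t ∈ Icc a b, ‖f' t‖ ≤ C * ‖f t‖) :
    ∀ t ∈ Icc a b, ‖f t‖ ≤ ‖f t₀‖ * Real.exp (C * |t - t₀|) := by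
  intro t ht
  rcases le_total t₀ t with h | h
  · have hm : MapsTo (fun s => t₀ + s) (Icc 0 (t - t₀)) (Icc a b) := fun s hs =>
      ⟨by linarith [hs.1, ht₀.1], by linarith [hs.2, ht.2]⟩
    have := norm_le_exp_of_norm_deriv_le_right (f := fun s => f (t₀ + s))
      (f' := fun s => f' (t₀ + s)) (T := t - t₀) (C := C) (fun s hs => by
        simpa using! (hf _ (hm hs)).scomp s
          (((hasDerivAt_id s).const_add t₀).hasDerivWithinAt) hm) (fun s hs => hC _ (hm hs))
      (t - t₀) ⟨by linarith, le_rfl⟩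
    simpa [abs_of_nonneg (sub_nonneg.2 h)] using this
  · have hm : MapsTo (fun s => t₀ - s) (Icc 0 (t₀ - t)) (Icc a b) := fun s hs =>
      ⟨by linarith [hs.2, ht.1], by linarith [hs.1, ht₀.2]⟩
    have := norm_le_exp_of_norm_deriv_le_right (f := fun s => f (t₀ - s))
      (f' := fun s => -f' (t₀ - s)) (T := t₀ - t) (C := C) (fun s hs => by
        simpa using! (hf _ (hm hs)).scomp s
          (((hasDerivAt_id s).const_sub t₀).hasDerivWithinAt) hm)
      (fun s hs => by simpa using hC _ (hm hs))
      (t₀ - t) ⟨by linarith, le_rfl⟩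
    simpa [abs_sub_comm t t₀, abs_of_nonneg (sub_nonneg.2 h)] using this

/-- Truncation of both coordinates to the interval `[-R, R]`. -/
def truncate (R : ℝ) (y : ℝ × ℝ) : ℝ × ℝ := (max (-R) (min R y.1), max (-R) (min R y.2))

theorem lipschitzWith_truncate (R : ℝ) : LipschitzWith 1 (truncate R) := by
  have h1 := (LipschitzWith.prod_fst (α := ℝ) (β := ℝ)).const_min R |>.const_max (-R)
  have h2 := (LipschitzWith.prod_snd (α := ℝ) (β := ℝ)).const_min R |>.const_max (-R)
  simpa using! h1.prodMk h2

theorem abs_max_min_le (R s : ℝ) (hR : 0 ≤ R) :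
    |max (-R) (min R s)| ≤ R ∧ |max (-R) (min R s)| ≤ |s| := by
  constructor <;> rw [abs_le] <;> constructor
  · exact le_max_left _ _
  · exact max_le (by linarith) (min_le_left _ _)
  · rcases le_total R s with h | h
    · rw [min_eq_left h]
      exact (by linarith [abs_nonneg s] : -|s| ≤ R).trans (le_max_right _ _)
    · rw [min_eq_right h]; exact (neg_abs_le s).trans (le_max_right _ _)
  · rcases le_total R s with h | h
    · rw [min_eq_left h]; exact max_le (by linarith [abs_nonneg s]) (h.trans (le_abs_self s))
    · rw [min_eq_right h]; exact max_le (by linarith [abs_nonneg s]) (le_abs_self s)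

theorem norm_truncate_le (R : ℝ) (hR : 0 ≤ R) (y : ℝ × ℝ) :
    ‖truncate R y‖ ≤ R ∧ ‖truncate R y‖ ≤ ‖y‖ := by
  have h1 := abs_max_min_le R y.1 hR
  have h2 := abs_max_min_le R y.2 hR
  simp only [truncate, Prod.norm_def, Real.norm_eq_abs]
  exact ⟨max_le h1.1 h2.1, max_le_max h1.2 h2.2⟩

theorem truncate_eq_self {R : ℝ} {y : ℝ × ℝ} (h : ‖y‖ ≤ R) : truncate R y = y := by
  simp only [Prod.norm_def, Real.norm_eq_abs, max_le_iff, abs_le] at h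
  ext <;> simp [truncate, h.1.1, h.1.2, h.2.1, h.2.2]

/-- Solutions of linear differential equations exist on compact intervals. -/
theorem exists_linearODE_Icc {A : ℝ → (ℝ × ℝ) →L[ℝ] (ℝ × ℝ)} {a b t₀ : ℝ} (ht₀ : t₀ ∈ Icc a b)
    (hA : ContinuousOn A (Icc a b)) (x : ℝ × ℝ) :
    ∃ y : ℝ → ℝ × ℝ, y t₀ = x ∧ ∀ t ∈ Icc a b, HasDerivWithinAt y (A t (y t)) (Icc a b) t := by
  obtain ⟨C₀, hC₀⟩ := isCompact_Icc.exists_bound_of_continuousOn hA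
  set C : NNReal := ⟨max C₀ 0, le_max_right _ _⟩
  have hC : ∀ t ∈ Icc a b, ‖A t‖ ≤ C := fun t ht => (hC₀ t ht).trans (le_max_left _ _)
  -- The Gronwall bound for a solution with initial value `x`.
  set R : ℝ := ‖x‖ * Real.exp (C * (b - a))
  have hR : 0 ≤ R := by positivity
  set L : NNReal := C * ⟨R, hR⟩
  have hab : a ≤ b := ht₀.1.trans ht₀.2
  -- The truncated field is bounded by `L` everywhere, so a solution moves at most `L * (b - a)` and
  -- exists on all of `[a, b]`. For the linear field itself the size condition could fail on long
  -- intervals.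
  have hP : IsPicardLindelof (fun t y => A t (truncate R y)) (tmin := a) (tmax := b) ⟨t₀, ht₀⟩ x
      (L * ⟨b - a, by linarith⟩) 0 L C := by
    refine ⟨fun t ht => LipschitzWith.lipschitzOnWith ?_, fun y _ => ?_, fun t ht y _ => ?_, ?_⟩
    · have := (A t).lipschitz.comp (lipschitzWith_truncate R)
      rw [mul_one] at this
      exact this.weaken (hC t ht)
    · exact hA.clm_apply continuousOn_const
    · exact ((A t).le_opNorm _).trans (mul_le_mul (hC t ht) (norm_truncate_le R hR y).1
        (norm_nonneg _) C.2)
    · simp only [NNReal.coe_zero, sub_zero]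
      exact mul_le_mul_of_nonneg_left (max_le (by linarith [ht₀.1]) (by linarith [ht₀.2])) L.2
  obtain ⟨y, hy0, hy⟩ := hP.exists_eq_forall_mem_Icc_hasDerivWithinAt (x := x) (by simp)
  refine ⟨y, hy0, fun t ht => ?_⟩
  -- Truncation does not increase norms, so the Gronwall bound holds for the truncated equation too.
  -- Hence the solution stays within `R`, where truncation does nothing.
  have hb := norm_le_exp_of_norm_deriv_le (C := C) ht₀ hy (fun s hs =>
    ((A s).le_opNorm _).trans (mul_le_mul (hC s hs) (norm_truncate_le R hR _).2
        (norm_nonneg _) C.2)) t ht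
  have h1 := hy t ht
  rw [truncate_eq_self] at h1
  · exact h1
  · simp only at hy0
    rw [hy0] at hb
    refine hb.trans (mul_le_mul_of_nonneg_left (Real.exp_le_exp.2 (mul_le_mul_of_nonneg_left ?_ C.2))
      (norm_nonneg _))
    rw [abs_le]
    constructor <;> linarith [ht.1, ht.2, ht₀.1, ht₀.2]

/-- Solutions of linear differential equations are determined by one of their values. -/
theorem linearODE_unique {E : Type*} [NormedAddCommGroup E] [NormedSpace ℝ E]
    {A : ℝ → E →L[ℝ] E} {I : Set ℝ} (hI : I.OrdConnected)
    (hA : ContinuousOn A I) {y z : ℝ → E} {t₀ : ℝ} (ht₀ : t₀ ∈ I)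
    (hy : ∀ t ∈ I, HasDerivWithinAt y (A t (y t)) I t)
    (hz : ∀ t ∈ I, HasDerivWithinAt z (A t (z t)) I t) (h : y t₀ = z t₀) : EqOn y z I := by
  intro t ht
  have hs : Icc (min t₀ t) (max t₀ t) ⊆ I := hI.uIcc_subset ht₀ ht
  obtain ⟨C, hC⟩ := isCompact_Icc.exists_bound_of_continuousOn (hA.mono hs)
  have := norm_le_exp_of_norm_deriv_le (f := fun s => y s - z s)
    (f' := fun s => A s (y s) - A s (z s)) (C := C) (t₀ := t₀) (a := min t₀ t) (b := max t₀ t)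
    ⟨min_le_left _ _, le_max_left _ _⟩
    (fun s h' => ((hy s (hs h')).sub (hz s (hs h'))).mono hs)
    (fun s h' => by
      rw [← map_sub]
      exact ((A s).le_opNorm _).trans (mul_le_mul_of_nonneg_right (hC s h') (norm_nonneg _)))
    t ⟨min_le_right _ _, le_max_right _ _⟩
  simpa [h, sub_eq_zero] using this

/-- If `t` is an end of `I`, it serves as an end of the compact interval, which is then still a
neighbourhood within `I`. -/
theorem exists_Icc_mem_nhdsWithin {I : Set ℝ} (hI : I.OrdConnected) {t₀ t : ℝ} (ht₀ : t₀ ∈ I)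
    (ht : t ∈ I) : ∃ a b, t₀ ∈ Icc a b ∧ t ∈ Icc a b ∧ Icc a b ⊆ I ∧ Icc a b ∈ 𝓝[I] t := by
  have hl : ∃ a ∈ I, a ≤ t₀ ∧ a ≤ t ∧ ∀ᶠ s in 𝓝[I] t, a ≤ s := by
    by_cases h : ∃ a ∈ I, a < t
    · obtain ⟨a, ha, hat⟩ := h
      refine ⟨min t₀ a, by rcases min_choice t₀ a with h | h <;> rwa [h], min_le_left _ _,
        (min_le_right _ _).trans hat.le, nhdsWithin_le_nhds ?_⟩
      filter_upwards [lt_mem_nhds hat] with s hs using (min_le_right _ _).trans hs.le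
    · push Not at h
      exact ⟨t, ht, h _ ht₀, le_rfl, by filter_upwards [self_mem_nhdsWithin] with s hs using h s hs⟩
  have hr : ∃ b ∈ I, t₀ ≤ b ∧ t ≤ b ∧ ∀ᶠ s in 𝓝[I] t, s ≤ b := by
    by_cases h : ∃ b ∈ I, t < b
    · obtain ⟨a, ha, hat⟩ := h
      refine ⟨max t₀ a, by rcases max_choice t₀ a with h | h <;> rwa [h], le_max_left _ _,
        hat.le.trans (le_max_right _ _), nhdsWithin_le_nhds ?_⟩
      filter_upwards [gt_mem_nhds hat] with s hs using hs.le.trans (le_max_right _ _)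
    · push Not at h
      exact ⟨t, ht, h _ ht₀, le_rfl, by filter_upwards [self_mem_nhdsWithin] with s hs using h s hs⟩
  obtain ⟨a, ha, ha1, ha2, ha3⟩ := hl
  obtain ⟨b, hb, hb1, hb2, hb3⟩ := hr
  exact ⟨a, b, ⟨ha1, hb1⟩, ⟨ha2, hb2⟩, hI.out ha hb, by filter_upwards [ha3, hb3] with s h1 h2 using ⟨h1, h2⟩⟩

/-- Solutions of linear differential equations exist on arbitrary intervals. -/
theorem exists_linearODE {A : ℝ → (ℝ × ℝ) →L[ℝ] (ℝ × ℝ)} {I : Set ℝ} (hI : I.OrdConnected)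
    {t₀ : ℝ} (ht₀ : t₀ ∈ I) (hA : ContinuousOn A I) (x : ℝ × ℝ) :
    ∃ y : ℝ → ℝ × ℝ, y t₀ = x ∧ ∀ t ∈ I, HasDerivWithinAt y (A t (y t)) I t := by
  have key : ∀ t, ∃ y : ℝ → ℝ × ℝ, y t₀ = x ∧ (t ∈ I → ∀ s ∈ uIcc t₀ t,
      HasDerivWithinAt y (A s (y s)) (uIcc t₀ t) s) := by
    intro t
    by_cases ht : t ∈ I
    · obtain ⟨y, h1, h2⟩ := exists_linearODE_Icc (A := A) (a := min t₀ t) (b := max t₀ t)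
        (t₀ := t₀) ⟨min_le_left _ _, le_max_left _ _⟩ (hA.mono (hI.uIcc_subset ht₀ ht)) x
      exact ⟨y, h1, fun _ => h2⟩
    · exact ⟨fun _ => x, rfl, fun h => absurd h ht⟩
  choose Y hY0 hY using key
  have heq : ∀ a b, t₀ ∈ Icc a b → Icc a b ⊆ I → ∀ y : ℝ → ℝ × ℝ, y t₀ = x →
      (∀ t ∈ Icc a b, HasDerivWithinAt y (A t (y t)) (Icc a b) t) →
      ∀ t ∈ Icc a b, Y t t = y t := by
    intro a b h0 hs y hy0 hy t ht
    have hu : uIcc t₀ t ⊆ Icc a b := ordConnected_Icc.uIcc_subset h0 ht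
    exact linearODE_unique (A := A) ordConnected_uIcc (hA.mono (hu.trans hs)) left_mem_uIcc
      (hY t (hs ht)) (fun s h => (hy s (hu h)).mono hu) ((hY0 t).trans hy0.symm) right_mem_uIcc
  -- The value at `t` is taken from the solution between `t₀` and `t`. By uniqueness it agrees with
  -- a solution on a compact interval around `t`, which has the required derivative.
  refine ⟨fun t => Y t t, hY0 t₀, fun t ht => ?_⟩
  obtain ⟨a, b, h0, h1, hs, hn⟩ := exists_Icc_mem_nhdsWithin hI ht₀ ht
  obtain ⟨y, hy0, hy⟩ := exists_linearODE_Icc h0 (hA.mono hs) x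
  have he := heq a b h0 hs y hy0 hy
  have := (hy t h1).congr (f₁ := fun t => Y t t) he (he t h1)
  rw [← he t h1] at this
  exact this.mono_of_mem_nhdsWithin hn

/-- Bootstrapping: if `y` is of class Cⁿ, so is its derivative `A t (y t)`. -/
theorem contDiffOn_linearODE {E : Type*} [NormedAddCommGroup E] [NormedSpace ℝ E]
    {A : ℝ → E →L[ℝ] E} {I : Set ℝ} (hI : UniqueDiffOn ℝ I)
    (hA : ContDiffOn ℝ ∞ A I) {y : ℝ → E} (hy : ∀ t ∈ I, HasDerivWithinAt y (A t (y t)) I t) :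
    ContDiffOn ℝ ∞ y I := by
  rw [contDiffOn_infty]
  intro n
  induction n with
  | zero => exact contDiffOn_zero.2 fun t ht => (hy t ht).continuousWithinAt
  | succ n ih =>
    rw [Nat.cast_succ, contDiffOn_succ_iff_derivWithin hI]
    refine ⟨fun t ht => (hy t ht).differentiableWithinAt, by simp, ?_⟩
    refine ContDiffOn.congr (f := fun t => A t (y t)) ?_
      fun t ht => (hy t ht).derivWithin (hI t ht)
    exact (hA.of_le (by exact_mod_cast le_top)).clm_apply ih

/-! ### Null planes that meet two complementary null planes. -/

section Algebra

theorem lieInner_add_left (u v w : LieSpace) :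
    lieInner (u + v) w = lieInner u w + lieInner v w := by
  simp [lieInner, inner_add_left]; ring

theorem lieInner_smul_left (r : ℝ) (v w : LieSpace) : lieInner (r • v) w = r * lieInner v w := by
  simp [lieInner, inner_smul_left]; ring

theorem lieInner_comm (v w : LieSpace) : lieInner v w = lieInner w v := by
  simp only [lieInner, real_inner_comm]; ring

theorem lieInner_add_right (u v w : LieSpace) :
    lieInner u (v + w) = lieInner u v + lieInner u w := by
  rw [lieInner_comm, lieInner_add_left, lieInner_comm v, lieInner_comm w]

theorem lieInner_smul_right (r : ℝ) (v w : LieSpace) : lieInner v (r • w) = r * lieInner v w := by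
  rw [lieInner_comm, lieInner_smul_left, lieInner_comm]

theorem lieInner_zero_left (v : LieSpace) : lieInner 0 v = 0 := by simp [lieInner]

theorem lieInner_zero_right (v : LieSpace) : lieInner v 0 = 0 := by simp [lieInner]

theorem lieInner_neg_left (v w : LieSpace) : lieInner (-v) w = -lieInner v w := by
  rw [← neg_one_smul ℝ, lieInner_smul_left]; ring

theorem lieInner_neg_right (v w : LieSpace) : lieInner v (-w) = -lieInner v w := by
  rw [lieInner_comm, lieInner_neg_left, lieInner_comm]

theorem lieInner_sub_left (u v w : LieSpace) :
    lieInner (u - v) w = lieInner u w - lieInner v w := by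
  rw [sub_eq_add_neg, lieInner_add_left, lieInner_neg_left]; ring

theorem lieInner_sub_right (u v w : LieSpace) :
    lieInner u (v - w) = lieInner u v - lieInner u w := by
  rw [sub_eq_add_neg, lieInner_add_right, lieInner_neg_right]; ring

/-- The inner product as a continuous bilinear map. -/
noncomputable def lieInnerCLM : LieSpace →L[ℝ] LieSpace →L[ℝ] ℝ :=
  (LinearMap.mk₂ ℝ lieInner lieInner_add_left lieInner_smul_left lieInner_add_right
    lieInner_smul_right).toContinuousBilinearMap

/-- The linear combination of a pair of vectors with the coefficients `a`. -/
noncomputable def comb (s : Fin 2 → LieSpace) (a : Fin 2 → ℝ) : LieSpace := a 0 • s 0 + a 1 • s 1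

/-- The determinant of a pair of vectors in the coordinate plane. -/
def wedge (a b : Fin 2 → ℝ) : ℝ := a 0 * b 1 - a 1 * b 0

theorem exists_wedge_ne_zero {a : Fin 2 → ℝ} (ha : a ≠ 0) : ∃ b, wedge a b ≠ 0 := by
  by_cases h : a 0 = 0
  · refine ⟨![1, 0], fun h' => ha ?_⟩
    have h1 : a 1 = 0 := by simpa [wedge] using h'
    ext i; fin_cases i <;> simp [h, h1]
  · exact ⟨![0, 1], by simpa [wedge] using h⟩

theorem eq_smul_of_wedge_eq_zero {a b : Fin 2 → ℝ} (ha : a ≠ 0) (h : wedge a b = 0) :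
    ∃ r : ℝ, b = r • a := by
  simp only [wedge] at h
  by_cases h0 : a 0 = 0
  · have h1 : a 1 ≠ 0 := fun h1 => ha (by ext i; fin_cases i <;> simp [h0, h1])
    have h2 : b 0 = 0 := by
      rw [h0] at h
      exact (mul_eq_zero.1 (by linarith : a 1 * b 0 = 0)).resolve_left h1
    exact ⟨b 1 / a 1, by ext i; fin_cases i <;> simp [h0, h1, h2]⟩
  · refine ⟨b 0 / a 0, ?_⟩
    ext i
    fin_cases i
    · simp [h0]
    · simp only [Fin.mk_one, Pi.smul_apply, smul_eq_mul]
      field_simp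
      linarith

theorem projectivization_mk_eq_iff_wedge {a b : Fin 2 → ℝ} (ha : a ≠ 0) (hb : b ≠ 0) :
    Projectivization.mk ℝ a ha = Projectivization.mk ℝ b hb ↔ wedge a b = 0 := by
  rw [Projectivization.mk_eq_mk_iff']
  constructor
  · rintro ⟨r, rfl⟩; simp [wedge]; ring
  · intro h
    have : wedge b a = 0 := by simp only [wedge] at *; linarith
    obtain ⟨r, hr⟩ := eq_smul_of_wedge_eq_zero hb this
    exact ⟨r, hr.symm⟩

theorem projectivization_eq_iff_wedge (c d : Projectivization ℝ (Fin 2 → ℝ)) :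
    c = d ↔ wedge c.rep d.rep = 0 := by
  rw [← projectivization_mk_eq_iff_wedge c.rep_nonzero d.rep_nonzero, c.mk_rep, d.mk_rep]

theorem comb_mem_span (s : Fin 2 → LieSpace) (a : Fin 2 → ℝ) : comb s a ∈ span ℝ {s 0, s 1} :=
  mem_span_pair.2 ⟨a 0, a 1, rfl⟩

theorem mem_span_iff_comb {s : Fin 2 → LieSpace} {v : LieSpace} :
    v ∈ span ℝ {s 0, s 1} ↔ ∃ a, v = comb s a := by
  rw [mem_span_pair]
  constructor
  · rintro ⟨x, y, rfl⟩; exact ⟨![x, y], by simp [comb]⟩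
  · rintro ⟨a, rfl⟩; exact ⟨a 0, a 1, rfl⟩

theorem comb_smul (s : Fin 2 → LieSpace) (r : ℝ) (a : Fin 2 → ℝ) :
    comb s (r • a) = r • comb s a := by
  simp [comb, smul_smul]

theorem comb_zero (s : Fin 2 → LieSpace) : comb s 0 = 0 := by simp [comb]

theorem span_smul_smul_pair {r : ℝ} (hr : r ≠ 0) (v w : LieSpace) :
    span ℝ {r • v, r • w} = span ℝ {v, w} := by
  apply le_antisymm <;> rw [span_le, pair_subset_iff]
  · exact ⟨smul_mem _ _ (subset_span (by simp)), smul_mem _ _ (subset_span (by simp))⟩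
  · constructor
    · exact mem_span_pair.2 ⟨r⁻¹, 0, by simp [hr]⟩
    · exact mem_span_pair.2 ⟨0, r⁻¹, by simp [hr]⟩

theorem lieInner_eq_zero_of_mem_span_pair {v w z u : LieSpace} (hu : u ∈ span ℝ {v, w})
    (hv : lieInner v z = 0) (hw : lieInner w z = 0) : lieInner u z = 0 := by
  obtain ⟨x, y, rfl⟩ := mem_span_pair.1 hu
  simp [lieInner_add_left, lieInner_smul_left, hv, hw]

theorem null_span_pair {v w : LieSpace} (hv : lieInner v v = 0) (hw : lieInner w w = 0)
    (hvw : lieInner v w = 0) :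
    ∀ x ∈ span ℝ {v, w}, ∀ y ∈ span ℝ {v, w}, lieInner x y = 0 := fun x hx y hy => by
  have h1 := lieInner_eq_zero_of_mem_span_pair hy hv (lieInner_comm w v ▸ hvw)
  have h2 := lieInner_eq_zero_of_mem_span_pair hy hvw hw
  refine lieInner_eq_zero_of_mem_span_pair hx ?_ ?_ <;> rw [lieInner_comm] <;> assumption

theorem finrank_span_pair_of_linearIndependent {v w : LieSpace}
    (h : ∀ x y : ℝ, x • v + y • w = 0 → x = 0 ∧ y = 0) :
    Module.finrank ℝ (span ℝ {v, w}) = 2 := by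
  have := finrank_span_eq_card (LinearIndependent.pair_iff.2 h)
  rw [show range ![v, w] = {v, w} by ext; simp [eq_comm]; tauto] at this
  simpa using this

/-- A pair of frames of complementary null planes, with mutual inner products that are a multiple
of the standard symplectic form. -/
structure IsHyperbolicFrame (s t : Fin 2 → LieSpace) : Prop where
  ss : ∀ i j, lieInner (s i) (s j) = 0
  tt : ∀ i j, lieInner (t i) (t j) = 0
  st : ∀ i, lieInner (s i) (t i) = 0
  skew : lieInner (s 1) (t 0) = -lieInner (s 0) (t 1)
  ne : lieInner (s 0) (t 1) ≠ 0

namespace IsHyperbolicFrame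

variable {s t : Fin 2 → LieSpace} (h : IsHyperbolicFrame s t)
include h

theorem comb_comb_left (a b : Fin 2 → ℝ) : lieInner (comb s a) (comb s b) = 0 := by
  simp [comb, lieInner_add_left, lieInner_add_right, lieInner_smul_left, lieInner_smul_right, h.ss]

theorem comb_comb_right (a b : Fin 2 → ℝ) : lieInner (comb t a) (comb t b) = 0 := by
  simp [comb, lieInner_add_left, lieInner_add_right, lieInner_smul_left, lieInner_smul_right, h.tt]

/-- Key formula of the hyperbolic frame: orthogonality across the two planes becomes proportionality
of the coefficients. -/
theorem comb_comb (a b : Fin 2 → ℝ) :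
    lieInner (comb s a) (comb t b) = wedge a b * lieInner (s 0) (t 1) := by
  simp only [comb, lieInner_add_left, lieInner_add_right, lieInner_smul_left, lieInner_smul_right,
    h.st, h.skew, wedge]
  ring

theorem comb_left_injective {a b : Fin 2 → ℝ} (hab : comb s a = comb s b) : a = b := by
  have h0 := h.comb_comb a ![1, 0]
  have h1 := h.comb_comb a ![0, 1]
  rw [hab, h.comb_comb, mul_left_inj' h.ne] at h0 h1
  simp [wedge] at h0 h1
  ext i; fin_cases i <;> simp [h0, h1]

theorem comb_right_injective {a b : Fin 2 → ℝ} (hab : comb t a = comb t b) : a = b := by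
  have h0 := h.comb_comb ![1, 0] a
  have h1 := h.comb_comb ![0, 1] a
  rw [hab, h.comb_comb, mul_left_inj' h.ne] at h0 h1
  simp [wedge] at h0 h1
  ext i; fin_cases i <;> simp [h0, h1]

/-- Pairing with `comb t b` and `comb s b`, for `b` not proportional to `a`, isolates the two
coefficients. -/
theorem linearIndependent_comb {a : Fin 2 → ℝ} (ha : a ≠ 0) (x y : ℝ)
    (hz : x • comb s a + y • comb t a = 0) : x = 0 ∧ y = 0 := by
  obtain ⟨b, hb⟩ := exists_wedge_ne_zero ha
  have h1 : lieInner (x • comb s a + y • comb t a) (comb t b) = 0 := by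
    rw [hz, lieInner_zero_left]
  have h2 : lieInner (comb s b) (x • comb s a + y • comb t a) = 0 := by
    rw [hz, lieInner_zero_right]
  have hb' : wedge b a ≠ 0 := fun h' => hb (by simp only [wedge] at *; linarith)
  simp only [lieInner_add_left, lieInner_smul_left, lieInner_add_right, lieInner_smul_right,
    h.comb_comb, h.comb_comb_right, h.comb_comb_left] at h1 h2
  constructor
  · simpa [hb, h.ne] using h1
  · simpa [hb', h.ne] using h2

theorem isNullPlane {a : Fin 2 → ℝ} (ha : a ≠ 0) : IsNullPlane (span ℝ {comb s a, comb t a}) where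
  finrank_eq := finrank_span_pair_of_linearIndependent (h.linearIndependent_comb ha)
  null := null_span_pair (h.comb_comb_left _ _) (h.comb_comb_right _ _)
    (by rw [h.comb_comb]; simp [wedge]; ring_nf; simp)

theorem left_inf_eq {a : Fin 2 → ℝ} (ha : a ≠ 0) :
    span ℝ {s 0, s 1} ⊓ span ℝ {comb s a, comb t a} = span ℝ {comb s a} := by
  apply le_antisymm
  · rintro v ⟨h1, h2⟩
    obtain ⟨d, rfl⟩ := mem_span_iff_comb.1 h1
    obtain ⟨x, y, hxy⟩ := mem_span_pair.1 h2
    obtain ⟨b, hb⟩ := exists_wedge_ne_zero ha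
    have hb' : wedge b a ≠ 0 := fun h' => hb (by simp only [wedge] at *; linarith)
    have h3 : lieInner (comb s b) (x • comb s a + y • comb t a) = 0 := by
      rw [hxy, h.comb_comb_left]
    simp only [lieInner_add_right, lieInner_smul_right, h.comb_comb_left, h.comb_comb] at h3
    have hy : y = 0 := by simpa [hb', h.ne] using h3
    rw [← hxy, hy]
    exact mem_span_singleton.2 ⟨x, by simp⟩
  · rw [span_le, singleton_subset_iff]
    exact ⟨comb_mem_span s a, subset_span (by simp)⟩

theorem right_inf_eq {a : Fin 2 → ℝ} (ha : a ≠ 0) :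
    span ℝ {t 0, t 1} ⊓ span ℝ {comb s a, comb t a} = span ℝ {comb t a} := by
  apply le_antisymm
  · rintro v ⟨h1, h2⟩
    obtain ⟨d, rfl⟩ := mem_span_iff_comb.1 h1
    obtain ⟨x, y, hxy⟩ := mem_span_pair.1 h2
    obtain ⟨b, hb⟩ := exists_wedge_ne_zero ha
    have h3 : lieInner (x • comb s a + y • comb t a) (comb t b) = 0 := by
      rw [hxy, h.comb_comb_right]
    simp only [lieInner_add_left, lieInner_smul_left, h.comb_comb_right, h.comb_comb] at h3
    have hx : x = 0 := by simpa [hb, h.ne] using h3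
    rw [← hxy, hx]
    exact mem_span_singleton.2 ⟨y, by simp⟩
  · rw [span_le, singleton_subset_iff]
    exact ⟨comb_mem_span t a, subset_span (by simp)⟩

theorem comb_left_ne_zero {a : Fin 2 → ℝ} (ha : a ≠ 0) : comb s a ≠ 0 := fun h' =>
  ha (h.comb_left_injective (h'.trans (comb_zero s).symm))

theorem comb_right_ne_zero {a : Fin 2 → ℝ} (ha : a ≠ 0) : comb t a ≠ 0 := fun h' =>
  ha (h.comb_right_injective (h'.trans (comb_zero t).symm))

theorem disjoint_span {a b : Fin 2 → ℝ} (hab : wedge a b ≠ 0) :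
    Disjoint (span ℝ {comb s a, comb t a}) (span ℝ {comb s b, comb t b}) := by
  have hba : wedge b a ≠ 0 := fun h' => hab (by simp only [wedge] at *; linarith)
  rw [Submodule.disjoint_def]
  intro v h1 h2
  obtain ⟨x, y, rfl⟩ := mem_span_pair.1 h2
  have haa : wedge a a = 0 := by simp [wedge]; ring
  have e1 : lieInner (x • comb s b + y • comb t b) (comb t a) = 0 :=
    lieInner_eq_zero_of_mem_span_pair h1 (by rw [h.comb_comb, haa, zero_mul])
      (h.comb_comb_right _ _)
  have e2 : lieInner (x • comb s b + y • comb t b) (comb s a) = 0 :=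
    lieInner_eq_zero_of_mem_span_pair h1 (h.comb_comb_left _ _)
      (by rw [lieInner_comm, h.comb_comb, haa, zero_mul])
  rw [lieInner_comm] at e2
  simp only [lieInner_add_left, lieInner_smul_left, h.comb_comb_right, h.comb_comb,
    h.comb_comb_left, lieInner_add_right, lieInner_smul_right] at e1 e2
  have hx : x = 0 := by simpa [hba, h.ne] using e1
  have hy : y = 0 := by simpa [hab, h.ne] using e2
  simp [hx, hy]

/-- `W` contains some `comb s a` and some `comb t b`. They are orthogonal as `W` is null, so `b` is
proportional to `a`, and `W` is the span by dimension. -/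
theorem exists_eq_span {W : Submodule ℝ LieSpace} (hW : IsNullPlane W)
    (h0 : span ℝ {s 0, s 1} ⊓ W ≠ ⊥) (h1 : span ℝ {t 0, t 1} ⊓ W ≠ ⊥) :
    ∃ a ≠ 0, W = span ℝ {comb s a, comb t a} := by
  obtain ⟨v, hv, hv0⟩ := exists_mem_ne_zero_of_ne_bot h0
  obtain ⟨w, hw, hw0⟩ := exists_mem_ne_zero_of_ne_bot h1
  obtain ⟨a, rfl⟩ := mem_span_iff_comb.1 hv.1
  obtain ⟨b, rfl⟩ := mem_span_iff_comb.1 hw.1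
  have ha : a ≠ 0 := fun h' => hv0 (by rw [h', comb_zero])
  have hab := hW.null _ hv.2 _ hw.2
  rw [h.comb_comb, mul_eq_zero, or_iff_left h.ne] at hab
  obtain ⟨r, rfl⟩ := eq_smul_of_wedge_eq_zero ha hab
  have hr : r ≠ 0 := fun h' => hw0 (by rw [h', zero_smul, comb_zero])
  refine ⟨a, ha, (eq_of_le_of_finrank_eq ?_ ?_).symm⟩
  · rw [span_le, pair_subset_iff]
    refine ⟨hv.2, ?_⟩
    have := W.smul_mem r⁻¹ hw.2
    rwa [comb_smul, smul_smul, inv_mul_cancel₀ hr, one_smul] at this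
  · rw [(h.isNullPlane ha).finrank_eq, hW.finrank_eq]

theorem isTwoTwoPlane : IsTwoTwoPlane (span ℝ {s 0, s 1} ⊔ span ℝ {t 0, t 1}) := by
  -- Each pair s₀, t₁ and s₁, t₀ spans a hyperbolic plane, and these planes are orthogonal. The
  -- constant `k = 1 / (2 D)` normalizes the sums and differences to squared length 1 and -1.
  set D := lieInner (s 0) (t 1) with hD
  have hne : D ≠ 0 := h.ne
  set k : ℝ := 1 / (2 * D)
  have hk : k * D = 1 / 2 := by simp only [k]; field_simp
  have st0 := h.st 0
  have st1 := h.st 1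
  have sk := h.skew
  have e2 : lieInner (t 1) (s 0) = D := lieInner_comm _ _
  have e3 : lieInner (t 0) (s 1) = -D := by rw [lieInner_comm, sk]
  have e4 : lieInner (t 0) (s 0) = 0 := by rw [lieInner_comm, st0]
  have e5 : lieInner (t 1) (s 1) = 0 := by rw [lieInner_comm, st1]
  refine ⟨![s 0 + k • t 1, s 1 - k • t 0, s 0 - k • t 1, s 1 + k • t 0], ?_, ?_⟩
  · rw [← span_union]
    apply le_antisymm
    · rw [span_le]
      have m0 : s 0 ∈ span ℝ ({s 0, s 1} ∪ {t 0, t 1} : Set LieSpace) := subset_span (by simp)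
      have m1 : s 1 ∈ span ℝ ({s 0, s 1} ∪ {t 0, t 1} : Set LieSpace) := subset_span (by simp)
      have m2 : t 0 ∈ span ℝ ({s 0, s 1} ∪ {t 0, t 1} : Set LieSpace) := subset_span (by simp)
      have m3 : t 1 ∈ span ℝ ({s 0, s 1} ∪ {t 0, t 1} : Set LieSpace) := subset_span (by simp)
      rintro _ ⟨i, rfl⟩
      fin_cases i
      · exact add_mem m0 (smul_mem _ _ m3)
      · exact sub_mem m1 (smul_mem _ _ m2)
      · exact sub_mem m0 (smul_mem _ _ m3)
      · exact add_mem m1 (smul_mem _ _ m2)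
    · rw [span_le]
      set V := span ℝ (range ![s 0 + k • t 1, s 1 - k • t 0, s 0 - k • t 1, s 1 + k • t 0])
      have m0 : s 0 + k • t 1 ∈ V := subset_span ⟨0, rfl⟩
      have m1 : s 1 - k • t 0 ∈ V := subset_span ⟨1, rfl⟩
      have m2 : s 0 - k • t 1 ∈ V := subset_span ⟨2, rfl⟩
      have m3 : s 1 + k • t 0 ∈ V := subset_span ⟨3, rfl⟩
      have hD2 : D * k = 1 / 2 := by linarith
      rintro _ ((rfl | rfl) | (rfl | rfl)) <;> rw [SetLike.mem_coe]
      · convert V.smul_mem (1 / 2 : ℝ) (add_mem m0 m2) using 1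
        module
      · convert V.smul_mem (1 / 2 : ℝ) (add_mem m1 m3) using 1
        module
      · convert V.smul_mem D (sub_mem m3 m1) using 1
        have : D • (s 1 + k • t 0 - (s 1 - k • t 0)) = (2 * (D * k)) • t 0 := by module
        rw [this, hD2]; module
      · convert V.smul_mem D (sub_mem m0 m2) using 1
        have : D • (s 0 + k • t 1 - (s 0 - k • t 1)) = (2 * (D * k)) • t 1 := by module
        rw [this, hD2]; module
  · intro i j
    fin_cases i <;> fin_cases j <;>
      simp [lieInner_add_left, lieInner_add_right, lieInner_smul_left, lieInner_smul_right,
        lieInner_sub_left, lieInner_sub_right, h.ss, h.tt, st0, st1, sk, e2, e3, e4, e5, ← hD] <;>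
      linarith

end IsHyperbolicFrame

end Algebra

/-! ### Isotropic subspaces, points of null planes, common tangent circles. -/

section Algebra

theorem lieInner_self (v : LieSpace) :
    lieInner v v = ‖v.2.2.2‖ ^ 2 - v.2.1 ^ 2 - 2 * v.1 * v.2.2.1 := by
  simp [lieInner]; ring

theorem eq_zero_of_null_of_sum_eq_zero {v : LieSpace} (hv : lieInner v v = 0) (hb : v.2.1 = 0)
    (hs : v.1 + v.2.2.1 = 0) : v = 0 := by
  rw [lieInner_self, hb] at hv
  have hc : v.2.2.1 = -v.1 := by linarith
  rw [hc] at hv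
  have h1 : v.1 = 0 := by nlinarith [sq_nonneg ‖v.2.2.2‖, sq_nonneg v.1]
  have h2 : ‖v.2.2.2‖ = 0 := by rw [h1] at hv; simpa using hv
  rw [h1] at hc
  exact Prod.ext h1 (Prod.ext hb (Prod.ext (by simpa using hc) (norm_eq_zero.1 h2)))

/-- The kernel of `f` is the orthogonal complement of the negative definite plane ⟨o + q, p⟩. It is
positive definite and contains no nonzero isotropic vector. -/
theorem finrank_null_le_two {W : Submodule ℝ LieSpace}
    (hW : ∀ v ∈ W, ∀ w ∈ W, lieInner v w = 0) : Module.finrank ℝ W ≤ 2 := by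
  let f : LieSpace →ₗ[ℝ] ℝ × ℝ :=
    { toFun := fun v => (v.1 + v.2.2.1, v.2.1)
      map_add' := fun v w => by ext <;> simp; ring
      map_smul' := fun r v => by ext <;> simp; ring }
  have : Function.Injective (f.comp W.subtype) := by
    rw [← LinearMap.ker_eq_bot, LinearMap.ker_eq_bot']
    intro v hv
    have h1 := congrArg Prod.fst hv
    have h2 := congrArg Prod.snd hv
    exact Subtype.ext (eq_zero_of_null_of_sum_eq_zero (hW v v.2 v v.2) h2 h1)
  simpa using LinearMap.finrank_le_finrank_of_injective this

/-- The complement of p is a Lorentz space, in which o + q alone spans a maximal negative definite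
subspace. -/
theorem finrank_null_le_one {W : Submodule ℝ LieSpace}
    (hW : ∀ v ∈ W, ∀ w ∈ W, lieInner v w = 0) (hb : ∀ v ∈ W, v.2.1 = 0) :
    Module.finrank ℝ W ≤ 1 := by
  let f : LieSpace →ₗ[ℝ] ℝ :=
    { toFun := fun v => v.1 + v.2.2.1
      map_add' := fun v w => by simp; ring
      map_smul' := fun r v => by simp; ring }
  have : Function.Injective (f.comp W.subtype) := by
    rw [← LinearMap.ker_eq_bot, LinearMap.ker_eq_bot']
    intro v hv
    exact Subtype.ext (eq_zero_of_null_of_sum_eq_zero (hW v v.2 v v.2) (hb v v.2) hv)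
  simpa using LinearMap.finrank_le_finrank_of_injective this

theorem eq_zero_of_finrank_span_pair {v w : LieSpace}
    (h : Module.finrank ℝ (span ℝ {v, w}) = 2) {x y : ℝ} (hz : x • v + y • w = 0) :
    x = 0 ∧ y = 0 := by
  have : LinearIndependent ℝ ![v, w] := by
    rw [linearIndependent_iff_card_eq_finrank_span, Set.finrank,
      show range ![v, w] = {v, w} by ext; simp [eq_comm]; tauto, h]
    simp
  exact LinearIndependent.pair_iff.1 this x y hz

theorem comb_eq_zero_of_finrank {s : Fin 2 → LieSpace}
    (h : Module.finrank ℝ (span ℝ {s 0, s 1}) = 2) {a : Fin 2 → ℝ} (ha : comb s a = 0) :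
    a = 0 := by
  obtain ⟨h0, h1⟩ := eq_zero_of_finrank_span_pair h ha
  ext i; fin_cases i <;> simp [h0, h1]

/-- The determinant of the mutual inner products of two pairs of vectors. -/
noncomputable def gram (s t : Fin 2 → LieSpace) : ℝ :=
  lieInner (s 0) (t 0) * lieInner (s 1) (t 1) - lieInner (s 0) (t 1) * lieInner (s 1) (t 0)

/-- Otherwise a nonzero vector in the span of `s` is orthogonal to `t`. With the span of `t` it
generates a totally isotropic space of dimension 3. -/
theorem gram_ne_zero {s t : Fin 2 → LieSpace} (hs : IsNullPlane (span ℝ {s 0, s 1}))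
    (ht : IsNullPlane (span ℝ {t 0, t 1}))
    (hd : Disjoint (span ℝ {s 0, s 1}) (span ℝ {t 0, t 1})) : gram s t ≠ 0 := by
  intro hg
  have key : ∃ a ≠ 0, ∀ j, lieInner (comb s a) (t j) = 0 := by
    simp only [gram] at hg
    simp only [comb, lieInner_add_left, lieInner_smul_left, Fin.forall_fin_two]
    by_cases h0 : lieInner (s 0) (t 0) = 0 ∧ lieInner (s 1) (t 0) = 0
    · by_cases h1 : lieInner (s 0) (t 1) = 0 ∧ lieInner (s 1) (t 1) = 0
      · exact ⟨![1, 0], by simp, by simp [h0.1], by simp [h1.1]⟩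
      · refine ⟨![lieInner (s 1) (t 1), -lieInner (s 0) (t 1)], fun h => h1 ?_, ?_, ?_⟩
        · have e0 := congrFun h 0
          have e1 := congrFun h 1
          simp at e0 e1
          exact ⟨e1, e0⟩
        · simp [h0]
        · simp; ring
    · refine ⟨![lieInner (s 1) (t 0), -lieInner (s 0) (t 0)], fun h => h0 ?_, ?_, ?_⟩
      · have e0 := congrFun h 0
        have e1 := congrFun h 1
        simp at e0 e1
        exact ⟨e1, e0⟩
      · simp; ring
      · simp; linarith
  obtain ⟨a, ha, hat⟩ := key
  set v := comb s a with hv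
  have hv0 : v ≠ 0 := fun h => ha (comb_eq_zero_of_finrank hs.finrank_eq h)
  have hvs : v ∈ span ℝ {s 0, s 1} := comb_mem_span s a
  have hvt : ∀ w ∈ span ℝ {t 0, t 1}, lieInner w v = 0 := fun w hw =>
    lieInner_eq_zero_of_mem_span_pair hw (by rw [lieInner_comm, hat]) (by rw [lieInner_comm, hat])
  have hvv := hs.null v hvs v hvs
  have hle := finrank_null_le_two (W := span ℝ {t 0, t 1} ⊔ span ℝ {v}) (by
    intro x hx y hy
    obtain ⟨x₁, hx₁, x₂, hx₂, rfl⟩ := mem_sup.1 hx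
    obtain ⟨y₁, hy₁, y₂, hy₂, rfl⟩ := mem_sup.1 hy
    obtain ⟨k, rfl⟩ := mem_span_singleton.1 hx₂
    obtain ⟨l, rfl⟩ := mem_span_singleton.1 hy₂
    simp [lieInner_add_left, lieInner_add_right, lieInner_smul_left, lieInner_smul_right,
      ht.null _ hx₁ _ hy₁, hvt _ hx₁, lieInner_comm v, hvt _ hy₁, hvv])
  have hsum := Submodule.finrank_sup_add_finrank_inf_eq (span ℝ {t 0, t 1}) (span ℝ {v})
  have hinf : span ℝ {t 0, t 1} ⊓ span ℝ {v} = ⊥ :=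
    (hd.symm.mono_right (by rw [span_le, singleton_subset_iff]; exact hvs)).eq_bot
  rw [hinf, finrank_bot, ht.finrank_eq, finrank_span_singleton hv0] at hsum
  omega

/-- The vectors in the span of `t` that are orthogonal to the members of `s`. -/
noncomputable def dualPair (s t : Fin 2 → LieSpace) (j : Fin 2) : LieSpace :=
  lieInner (s j) (t 1) • t 0 - lieInner (s j) (t 0) • t 1

/-- Skewness is built into `dualPair`: both mixed products are the Gram determinant up to sign. -/
theorem isHyperbolicFrame_dualPair {s t : Fin 2 → LieSpace}
    (hs : ∀ i j, lieInner (s i) (s j) = 0) (ht : ∀ i j, lieInner (t i) (t j) = 0)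
    (hg : gram s t ≠ 0) : IsHyperbolicFrame s (dualPair s t) where
  ss := hs
  tt i j := by
    simp [dualPair, lieInner_sub_left, lieInner_sub_right, lieInner_smul_left,
      lieInner_smul_right, ht]
  st i := by simp [dualPair, lieInner_sub_right, lieInner_smul_right]; ring
  skew := by simp [dualPair, lieInner_sub_right, lieInner_smul_right]; ring
  ne := by
    convert hg using 1
    simp [dualPair, lieInner_sub_right, lieInner_smul_right, gram]; ring

theorem IsHyperbolicFrame.finrank_left {s t : Fin 2 → LieSpace} (h : IsHyperbolicFrame s t) :
    Module.finrank ℝ (span ℝ {s 0, s 1}) = 2 :=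
  finrank_span_pair_of_linearIndependent fun x y hxy => by
    have : (![x, y] : Fin 2 → ℝ) = 0 := h.comb_left_injective (by simpa [comb] using hxy)
    exact ⟨congrFun this 0, congrFun this 1⟩

theorem IsHyperbolicFrame.finrank_right {s t : Fin 2 → LieSpace} (h : IsHyperbolicFrame s t) :
    Module.finrank ℝ (span ℝ {t 0, t 1}) = 2 :=
  finrank_span_pair_of_linearIndependent fun x y hxy => by
    have : (![x, y] : Fin 2 → ℝ) = 0 := h.comb_right_injective (by simpa [comb] using hxy)
    exact ⟨congrFun this 0, congrFun this 1⟩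

theorem IsHyperbolicFrame.span_dualPair {s t : Fin 2 → LieSpace}
    (h : IsHyperbolicFrame s (dualPair s t)) (ht : Module.finrank ℝ (span ℝ {t 0, t 1}) = 2) :
    span ℝ {dualPair s t 0, dualPair s t 1} = span ℝ {t 0, t 1} := by
  refine eq_of_le_of_finrank_eq ?_ (h.finrank_right.trans ht.symm)
  have : ∀ j, dualPair s t j ∈ span ℝ {t 0, t 1} := fun j =>
    sub_mem (smul_mem _ _ (subset_span (by simp))) (smul_mem _ _ (subset_span (by simp)))
  rw [span_le, pair_subset_iff]
  exact ⟨this 0, this 1⟩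

/-- The vector orthogonal to `p` in the plane spanned by `v` and `w`, which represents a point. -/
noncomputable def pointVec (v w : LieSpace) : LieSpace := w.2.1 • v - v.2.1 • w

theorem pointVec_mem (v w : LieSpace) : pointVec v w ∈ span ℝ {v, w} :=
  sub_mem (smul_mem _ _ (subset_span (by simp))) (smul_mem _ _ (subset_span (by simp)))

theorem pointVec_snd (v w : LieSpace) : (pointVec v w).2.1 = 0 := by
  simp [pointVec]; ring

theorem snd_ne_zero_of_isNullPlane {v w : LieSpace} (h : IsNullPlane (span ℝ {v, w})) :
    v.2.1 ≠ 0 ∨ w.2.1 ≠ 0 := by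
  by_contra! hvw
  have := finrank_null_le_one h.null fun z hz => by
    obtain ⟨x, y, rfl⟩ := mem_span_pair.1 hz
    simp [hvw]
  rw [h.finrank_eq] at this
  omega

theorem pointVec_ne_zero {v w : LieSpace} (h : IsNullPlane (span ℝ {v, w})) :
    pointVec v w ≠ 0 := by
  intro h0
  have := eq_zero_of_finrank_span_pair h.finrank_eq (x := w.2.1) (y := -v.2.1)
    (by rw [neg_smul, ← sub_eq_add_neg]; exact h0)
  rcases snd_ne_zero_of_isNullPlane h with h1 | h1
  · exact h1 (neg_eq_zero.1 this.2)
  · exact h1 this.1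

/-- The p-coordinate does not vanish identically on a null plane, so its kernel there is a line, the
unique point of the plane. -/
theorem eq_smul_pointVec {v w z : LieSpace} (h : IsNullPlane (span ℝ {v, w}))
    (hz : z ∈ span ℝ {v, w}) (hb : z.2.1 = 0) : ∃ r : ℝ, z = r • pointVec v w := by
  obtain ⟨x, y, rfl⟩ := mem_span_pair.1 hz
  simp at hb
  have hw : wedge ![w.2.1, -v.2.1] ![x, y] = 0 := by simp [wedge]; linarith
  obtain ⟨r, hr⟩ := eq_smul_of_wedge_eq_zero (fun h0 => by
    have e0 := congrFun h0 0
    have e1 := congrFun h0 1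
    simp at e0 e1
    exact (snd_ne_zero_of_isNullPlane h).elim (· e1) (· e0)) hw
  have e0 : x = r * w.2.1 := by simpa using congrFun hr 0
  have e1 : y = -(r * v.2.1) := by simpa using congrFun hr 1
  refine ⟨r, ?_⟩
  rw [e0, e1, pointVec]
  module

theorem eq_smul_infinityVec {v : LieSpace} (hv : lieInner v v = 0) (hb : v.2.1 = 0)
    (h0 : v.1 = 0) : v = v.2.2.1 • infinityVec := by
  rw [lieInner_self, hb, h0] at hv
  have h2 : v.2.2.2 = 0 := by simpa using hv
  refine Prod.ext ?_ (Prod.ext ?_ (Prod.ext ?_ ?_)) <;> simp [infinityVec, h0, hb, h2]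

/-- An isotropic vector without o- and p-components is a multiple of q, so the point of the plane is
infinite exactly when its o-component vanishes. -/
theorem infinityVec_mem_iff {v w : LieSpace} (h : IsNullPlane (span ℝ {v, w})) :
    infinityVec ∈ span ℝ {v, w} ↔ (pointVec v w).1 = 0 := by
  constructor
  · intro hq
    obtain ⟨r, hr⟩ := eq_smul_pointVec h hq rfl
    have hr0 : r ≠ 0 := by
      rintro rfl
      have := congrArg (fun z : LieSpace => z.2.2.1) hr
      simp [infinityVec] at this
    have := congrArg (fun z : LieSpace => z.1) hr
    simpa [infinityVec, hr0] using this
  · intro h0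
    have hm := pointVec_mem v w
    have he := eq_smul_infinityVec (h.null _ hm _ hm) (pointVec_snd v w) h0
    have hc : (pointVec v w).2.2.1 ≠ 0 := fun hc => pointVec_ne_zero h (by rw [he, hc, zero_smul])
    have := smul_mem (span ℝ {v, w}) (pointVec v w).2.2.1⁻¹ hm
    rwa [he, smul_smul, ← he, inv_mul_cancel₀ hc, one_smul] at this

theorem smul_pointLift {v : LieSpace} (hv : lieInner v v = 0) (hb : v.2.1 = 0) (h0 : v.1 ≠ 0) :
    v = v.1 • pointLift (v.1⁻¹ • v.2.2.2) := by
  rw [lieInner_self, hb] at hv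
  refine Prod.ext ?_ (Prod.ext ?_ (Prod.ext ?_ ?_))
  · simp [pointLift]
  · simp [pointLift, hb]
  · simp only [pointLift, Prod.smul_mk, inner_smul_left, inner_smul_right, smul_eq_mul,
      real_inner_self_eq_norm_sq, RCLike.conj_to_real]
    field_simp
    linarith
  · simp [pointLift, h0]

theorem lieInner_pointLift_pointLift (x y : Plane) :
    lieInner (pointLift x) (pointLift y) = -‖x - y‖ ^ 2 / 2 := by
  rw [norm_sub_sq_real]
  simp [lieInner, pointLift]; ring

theorem pointLift_ne_zero (x : Plane) : pointLift x ≠ 0 := fun h => by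
  have := congrArg (fun z : LieSpace => z.1) h
  simp [pointLift] at this

theorem infinityVec_ne_zero : infinityVec ≠ 0 := fun h => by
  have := congrArg (fun z : LieSpace => z.2.2.1) h
  simp [infinityVec] at this

theorem isNullPlane_point_line (x n : Plane) (hn : ‖n‖ = 1) :
    IsNullPlane (span ℝ {pointLift x, lineLift x n}) where
  finrank_eq := finrank_span_pair_of_linearIndependent fun a b h => by
    have h1 := congrArg (fun z : LieSpace => z.1) h
    have h2 := congrArg (fun z : LieSpace => z.2.1) h
    simp [pointLift, lineLift] at h1 h2
    exact ⟨h1, h2⟩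
  null := null_span_pair (by simp [lieInner, pointLift]; ring) (by simp [lieInner, lineLift, hn])
    (by simp [lieInner, pointLift, lineLift, real_inner_comm])

/-- Two distinct points with tangent vectors, the first of which does not vanish, whose lifts are
orthogonal to a common circle, span a space of dimension 3. -/
theorem finrank_span_point_tangent {x y x' y' : Plane} (hxy : x ≠ y) (hx' : x' ≠ 0)
    {z : LieSpace} (hz : z ≠ 0) (hzz : lieInner z z = 0)
    (h₁ : lieInner (pointLift x) z = 0) (h₂ : lieInner (0, 0, ⟪x, x'⟫, x') z = 0)
    (h₃ : lieInner (pointLift y) z = 0) (h₄ : lieInner (0, 0, ⟪y, y'⟫, y') z = 0) :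
    Module.finrank ℝ (span ℝ
      ({pointLift x, (0, 0, ⟪x, x'⟫, x'), pointLift y, (0, 0, ⟪y, y'⟫, y')} : Set LieSpace)) = 3 := by
  apply le_antisymm
  · let f : LieSpace →ₗ[ℝ] ℝ × ℝ :=
      { toFun := fun v => (lieInner v z, v.2.1)
        map_add' := fun v w => by ext <;> simp [lieInner_add_left]
        map_smul' := fun r v => by ext <;> simp [lieInner_smul_left] }
    have hf : Function.Surjective f := by
      -- The vector `w` is orthogonal to p, and its product with `z` is a sum of squares. This
      -- vanishes only if `z` is a multiple of p, which is not isotropic unless zero.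
      set w : LieSpace := (-z.2.2.1, 0, -z.1, z.2.2.2)
      have hw : lieInner w z ≠ 0 := by
        have e : lieInner w z = z.1 ^ 2 + z.2.2.1 ^ 2 + ‖z.2.2.2‖ ^ 2 := by
          simp [lieInner, w]; ring
        intro h0
        rw [e] at h0
        have z1 : z.1 = 0 := by nlinarith [sq_nonneg z.2.2.1, sq_nonneg ‖z.2.2.2‖]
        have z3 : z.2.2.1 = 0 := by nlinarith [sq_nonneg z.1, sq_nonneg ‖z.2.2.2‖]
        have z4 : ‖z.2.2.2‖ = 0 := by nlinarith [sq_nonneg z.1, sq_nonneg z.2.2.1]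
        rw [lieInner_self, z1, z3, z4] at hzz
        exact hz (Prod.ext z1 (Prod.ext (by simpa using hzz) (Prod.ext z3 (norm_eq_zero.1 z4))))
      rintro ⟨a, b⟩
      set p : LieSpace := (0, 1, 0, 0)
      refine ⟨((a - b * lieInner p z) / lieInner w z) • w + b • p, ?_⟩
      simp only [f, LinearMap.coe_mk, AddHom.coe_mk, lieInner_add_left, lieInner_smul_left]
      ext
      · simp only; field_simp; ring
      · simp [w, p]
    have hk := LinearMap.finrank_range_add_finrank_ker f
    rw [LinearMap.range_eq_top.2 hf, finrank_top] at hk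
    have h5 : Module.finrank ℝ LieSpace = 5 := by simp
    have h2 : Module.finrank ℝ (ℝ × ℝ) = 2 := by simp
    rw [h5, h2] at hk
    have hle : span ℝ ({pointLift x, (0, 0, ⟪x, x'⟫, x'), pointLift y, (0, 0, ⟪y, y'⟫, y')} :
        Set LieSpace) ≤ LinearMap.ker f := by
      rw [span_le]
      rintro _ (rfl | rfl | rfl | rfl) <;> rw [SetLike.mem_coe, LinearMap.mem_ker] <;>
        simp only [f, LinearMap.coe_mk, AddHom.coe_mk, Prod.mk_eq_zero]
      exacts [⟨h₁, rfl⟩, ⟨h₂, trivial⟩, ⟨h₃, rfl⟩, ⟨h₄, trivial⟩]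
    have := Submodule.finrank_mono hle
    omega
  · have hli : LinearIndependent ℝ ![pointLift x, pointLift y, ((0, 0, ⟪x, x'⟫, x') : LieSpace)] := by
      rw [Fintype.linearIndependent_iff]
      intro g hg
      simp only [Fin.sum_univ_three, Matrix.cons_val_zero, Matrix.cons_val_one,
        Matrix.cons_val] at hg
      have hξ : lieInner (pointLift x) (0, 0, ⟪x, x'⟫, x') = 0 := by simp [lieInner, pointLift]
      have hx0 := lieInner_pointLift_pointLift x x
      have e := congrArg (lieInner (pointLift x)) hg
      simp only [lieInner_add_right, lieInner_smul_right, hx0, hξ, lieInner_pointLift_pointLift,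
        lieInner_zero_right] at e
      have hn : ‖x - y‖ ≠ 0 := norm_ne_zero_iff.2 (sub_ne_zero.2 hxy)
      have g1 : g 1 = 0 := by simpa [hn] using e
      have g0 : g 0 = 0 := by
        have := congrArg (fun z : LieSpace => z.1) hg
        simpa [pointLift, g1] using this
      have g2 : g 2 = 0 := by
        have := congrArg (fun z : LieSpace => z.2.2.2) hg
        simpa [pointLift, g0, g1, hx'] using this
      intro i
      fin_cases i <;> assumption
    have hc := finrank_span_eq_card hli
    have hle : span ℝ (range ![pointLift x, pointLift y, ((0, 0, ⟪x, x'⟫, x') : LieSpace)]) ≤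
        span ℝ ({pointLift x, (0, 0, ⟪x, x'⟫, x'), pointLift y, (0, 0, ⟪y, y'⟫, y')} :
          Set LieSpace) := by
      rw [span_le]
      rintro _ ⟨i, rfl⟩
      fin_cases i <;> exact subset_span (by simp)
    have := Submodule.finrank_mono hle
    rw [hc] at this
    simpa using this

end Algebra

/-! ### Parallel hyperbolic frames. -/

section Calculus

theorem HasDerivWithinAt.lieInner {f g : ℝ → LieSpace} {f' g' : LieSpace} {I : Set ℝ} {u : ℝ}
    (hf : HasDerivWithinAt f f' I u) (hg : HasDerivWithinAt g g' I u) :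
    HasDerivWithinAt (fun v => Ribaucour.lieInner (f v) (g v))
      (Ribaucour.lieInner f' (g u) + Ribaucour.lieInner (f u) g') I u :=
  (lieInnerCLM.hasFDerivAt.comp_hasDerivWithinAt u hf).clm_apply hg

theorem ContDiffWithinAt.lieInner {f g : ℝ → LieSpace} {I : Set ℝ} {u : ℝ}
    (hf : ContDiffWithinAt ℝ ∞ f I u) (hg : ContDiffWithinAt ℝ ∞ g I u) :
    ContDiffWithinAt ℝ ∞ (fun v => Ribaucour.lieInner (f v) (g v)) I u :=
  (lieInnerCLM.contDiff.comp_contDiffWithinAt hf).clm_apply hg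

theorem ContDiffOn.lieInner {f g : ℝ → LieSpace} {I : Set ℝ}
    (hf : ContDiffOn ℝ ∞ f I) (hg : ContDiffOn ℝ ∞ g I) :
    ContDiffOn ℝ ∞ (fun v => Ribaucour.lieInner (f v) (g v)) I :=
  fun u hu => (hf u hu).lieInner (hg u hu)

theorem ContDiffOn.hasDerivWithinAt {E : Type*} [NormedAddCommGroup E] [NormedSpace ℝ E]
    {f : ℝ → E} {I : Set ℝ} (hf : ContDiffOn ℝ ∞ f I)
    {u : ℝ} (hu : u ∈ I) : HasDerivWithinAt f (derivWithin f I u) I u :=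
  ((hf.differentiableOn (by simp)) u hu).hasDerivWithinAt

theorem lieInner_derivWithin_comm {f g : ℝ → LieSpace} {I : Set ℝ} (hI : UniqueDiffOn ℝ I)
    (hf : ContDiffOn ℝ ∞ f I) (hg : ContDiffOn ℝ ∞ g I)
    (h : ∀ u ∈ I, lieInner (f u) (g u) = 0) {u : ℝ} (hu : u ∈ I) :
    lieInner (derivWithin f I u) (g u) = -lieInner (f u) (derivWithin g I u) := by
  have h1 := (hf.hasDerivWithinAt hu).lieInner (hg.hasDerivWithinAt hu)
  have h2 : HasDerivWithinAt (fun v => lieInner (f v) (g v)) 0 I u :=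
    (hasDerivWithinAt_const u I (0 : ℝ)).congr h (h u hu)
  have := (hI u hu).eq_deriv _ h1 h2
  linarith

theorem uniqueDiffOn_of_ordConnected {I : Set ℝ} (hI : I.OrdConnected) (hn : I.Nontrivial) :
    UniqueDiffOn ℝ I := by
  obtain ⟨a, ha, b, hb, hab⟩ := hn.exists_lt
  refine uniqueDiffOn_convex hI.convex ⟨(a + b) / 2, ?_⟩
  refine mem_interior.2 ⟨Ioo a b, Ioo_subset_Icc_self.trans (hI.out ha hb), isOpen_Ioo, ?_⟩
  constructor <;> linarith

/-- Smooth hyperbolic frames, the first half of which has derivatives orthogonal to the span of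
the second half. -/
structure IsParallelFrame (I : Set ℝ) (s t : Fin 2 → ℝ → LieSpace) : Prop where
  smooth_left : ∀ j, ContDiffOn ℝ ∞ (s j) I
  smooth_right : ∀ j, ContDiffOn ℝ ∞ (t j) I
  hyperbolic : ∀ u ∈ I, IsHyperbolicFrame (fun j => s j u) (fun j => t j u)
  parallel : ∀ u ∈ I, ∀ i j, lieInner (derivWithin (s i) I u) (t j u) = 0

theorem contDiffOn_comb {I : Set ℝ} {s : Fin 2 → ℝ → LieSpace}
    (hs : ∀ j, ContDiffOn ℝ ∞ (s j) I) {a : Fin 2 → ℝ → ℝ} (ha : ∀ j, ContDiffOn ℝ ∞ (a j) I) :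
    ContDiffOn ℝ ∞ (fun u => comb (fun j => s j u) (fun j => a j u)) I :=
  ((ha 0).smul (hs 0)).add ((ha 1).smul (hs 1))

theorem derivWithin_comb {I : Set ℝ} (hI : UniqueDiffOn ℝ I) {s : Fin 2 → ℝ → LieSpace}
    (hs : ∀ j, ContDiffOn ℝ ∞ (s j) I) {a : Fin 2 → ℝ → ℝ} (ha : ∀ j, ContDiffOn ℝ ∞ (a j) I)
    {u : ℝ} (hu : u ∈ I) :
    derivWithin (fun u => comb (fun j => s j u) (fun j => a j u)) I u =
      comb (fun j => derivWithin (s j) I u) (fun j => a j u) +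
        comb (fun j => s j u) (fun j => derivWithin (a j) I u) := by
  have h := (((ha 0).hasDerivWithinAt hu).smul ((hs 0).hasDerivWithinAt hu)).add
    (((ha 1).hasDerivWithinAt hu).smul ((hs 1).hasDerivWithinAt hu))
  rw [show (fun u => comb (fun j => s j u) (fun j => a j u)) = (a 0 • s 0) + (a 1 • s 1) from rfl,
    h.derivWithin (hI u hu)]
  simp only [comb]
  abel

theorem lieInner_comb_left (s : Fin 2 → LieSpace) (a : Fin 2 → ℝ) (v : LieSpace) :
    lieInner (comb s a) v = a 0 * lieInner (s 0) v + a 1 * lieInner (s 1) v := by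
  simp [comb, lieInner_add_left, lieInner_smul_left]

theorem gram_comb (s t : Fin 2 → LieSpace) (a : Fin 2 → Fin 2 → ℝ) :
    gram (fun j => comb s (a j)) t = wedge (a 0) (a 1) * gram s t := by
  simp only [gram, lieInner_comb_left, wedge]; ring

/-- Two pairs of smooth frames of complementary null planes can be replaced by parallel ones. -/
theorem exists_parallelFrame {I : Set ℝ} (hI : I.OrdConnected) (hn : I.Nontrivial)
    {σ τ : Fin 2 → ℝ → LieSpace} (hσ : ∀ j, ContDiffOn ℝ ∞ (σ j) I)
    (hτ : ∀ j, ContDiffOn ℝ ∞ (τ j) I)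
    (nσ : ∀ u ∈ I, IsNullPlane (span ℝ {σ 0 u, σ 1 u}))
    (nτ : ∀ u ∈ I, IsNullPlane (span ℝ {τ 0 u, τ 1 u}))
    (hd : ∀ u ∈ I, Disjoint (span ℝ {σ 0 u, σ 1 u}) (span ℝ {τ 0 u, τ 1 u})) :
    ∃ s t, IsParallelFrame I s t ∧ ∀ u ∈ I, span ℝ {s 0 u, s 1 u} = span ℝ {σ 0 u, σ 1 u} ∧
      span ℝ {t 0 u, t 1 u} = span ℝ {τ 0 u, τ 1 u} := by
  have hU := uniqueDiffOn_of_ordConnected hI hn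
  obtain ⟨u₀, hu₀⟩ := hn.nonempty
  set G : ℝ → ℝ := fun u => gram (fun j => σ j u) (fun j => τ j u) with hG
  have hG0 : ∀ u ∈ I, G u ≠ 0 := fun u hu => gram_ne_zero (nσ u hu) (nτ u hu) (hd u hu)
  set M : Fin 2 → Fin 2 → ℝ → ℝ := fun j k u => lieInner (σ j u) (τ k u) with hM
  set N : Fin 2 → Fin 2 → ℝ → ℝ := fun j k u => lieInner (derivWithin (σ j) I u) (τ k u) with hN
  have sM : ∀ j k, ContDiffOn ℝ ∞ (M j k) I := fun j k => (hσ j).lieInner (hτ k)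
  have sN : ∀ j k, ContDiffOn ℝ ∞ (N j k) I := fun j k =>
    ((contDiffOn_infty_iff_derivWithin hU).1 (hσ j)).2.lieInner (hτ k)
  have hGM : ∀ u, G u = M 0 0 u * M 1 1 u - M 0 1 u * M 1 0 u := fun u => rfl
  have sG : ContDiffOn ℝ ∞ G I := ((sM 0 0).mul (sM 1 1)).sub ((sM 0 1).mul (sM 1 0))
  -- With sᵢ = Σ aᵢⱼ σⱼ, orthogonality of sᵢ' to `τ` reads a' M + a N = 0. The functions `p` and `q`
  -- are the columns of -N M⁻¹, by Cramer's rule.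
  set p : Fin 2 → ℝ → ℝ := fun j u => (N j 1 u * M 1 0 u - N j 0 u * M 1 1 u) / G u with hp
  set q : Fin 2 → ℝ → ℝ := fun j u => (N j 0 u * M 0 1 u - N j 1 u * M 0 0 u) / G u with hq
  have sp : ∀ j, ContDiffOn ℝ ∞ (p j) I := fun j =>
    (((sN j 1).mul (sM 1 0)).sub ((sN j 0).mul (sM 1 1))).div sG hG0
  have sq : ∀ j, ContDiffOn ℝ ∞ (q j) I := fun j =>
    (((sN j 0).mul (sM 0 1)).sub ((sN j 1).mul (sM 0 0))).div sG hG0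
  set f := ContinuousLinearMap.fst ℝ ℝ ℝ
  set g := ContinuousLinearMap.snd ℝ ℝ ℝ
  set A : ℝ → (ℝ × ℝ) →L[ℝ] (ℝ × ℝ) := fun u =>
    p 0 u • f.prod 0 + p 1 u • g.prod 0 + q 0 u • (0 : (ℝ × ℝ) →L[ℝ] ℝ).prod f +
      q 1 u • (0 : (ℝ × ℝ) →L[ℝ] ℝ).prod g with hA
  have sA : ContDiffOn ℝ ∞ A I :=
    ((((sp 0).smul contDiffOn_const).add ((sp 1).smul contDiffOn_const)).add
      ((sq 0).smul contDiffOn_const)).add ((sq 1).smul contDiffOn_const)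
  have hAv : ∀ u x, A u x = (p 0 u * x.1 + p 1 u * x.2, q 0 u * x.1 + q 1 u * x.2) := by
    intro u x; ext <;> simp [hA, f, g]
  have key : ∀ x, ∃ y : ℝ → ℝ × ℝ, y u₀ = x ∧ ∀ t ∈ I, HasDerivWithinAt y (A t (y t)) I t :=
    exists_linearODE hI hu₀ sA.continuousOn
  choose Y hY0 hY using key
  have sY : ∀ x, ContDiffOn ℝ ∞ (Y x) I := fun x => contDiffOn_linearODE hU sA (hY x)
  set e : Fin 2 → ℝ × ℝ := ![(1, 0), (0, 1)] with he
  set a : Fin 2 → Fin 2 → ℝ → ℝ := fun i => ![fun u => (Y (e i) u).1, fun u => (Y (e i) u).2] with ha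
  have sa : ∀ i j, ContDiffOn ℝ ∞ (a i j) I := by
    intro i j
    fin_cases j
    · exact contDiff_fst.comp_contDiffOn (sY (e i))
    · exact contDiff_snd.comp_contDiffOn (sY (e i))
  have da0 : ∀ i, ∀ u ∈ I, derivWithin (a i 0) I u = p 0 u * a i 0 u + p 1 u * a i 1 u := by
    intro i u hu
    have := f.hasFDerivAt.comp_hasDerivWithinAt u (hY (e i) u hu)
    rw [hAv] at this
    exact this.derivWithin (hU u hu)
  have da1 : ∀ i, ∀ u ∈ I, derivWithin (a i 1) I u = q 0 u * a i 0 u + q 1 u * a i 1 u := by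
    intro i u hu
    have := g.hasFDerivAt.comp_hasDerivWithinAt u (hY (e i) u hu)
    rw [hAv] at this
    exact this.derivWithin (hU u hu)
  -- A linear relation between the two solutions at one parameter value persists by uniqueness, but
  -- at `u₀` they are the standard basis.
  have hw : ∀ u ∈ I, wedge (fun j => a 0 j u) (fun j => a 1 j u) ≠ 0 := by
    intro u hu h0
    have hex : ∃ c d : ℝ, (c ≠ 0 ∨ d ≠ 0) ∧ c • Y (e 0) u + d • Y (e 1) u = 0 := by
      by_cases h1 : (fun j => a 0 j u) = 0
      · refine ⟨1, 0, by simp, ?_⟩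
        have h2 := congrFun h1 0
        have h3 := congrFun h1 1
        simp only [ha, Matrix.cons_val_zero, Matrix.cons_val_one, Pi.zero_apply] at h2 h3
        ext <;> simp [h2, h3]
      · obtain ⟨r, hr⟩ := eq_smul_of_wedge_eq_zero h1 h0
        refine ⟨-r, 1, by simp, ?_⟩
        have h2 := congrFun hr 0
        have h3 := congrFun hr 1
        simp only [ha, Matrix.cons_val_zero, Matrix.cons_val_one, Pi.smul_apply,
          smul_eq_mul] at h2 h3
        ext <;> simp [h2, h3]
    obtain ⟨c, d, hcd, h2⟩ := hex
    have := linearODE_unique (A := A) (y := fun v => c • Y (e 0) v + d • Y (e 1) v)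
      (z := fun _ => 0) hI sA.continuousOn hu
      (fun v hv => by
        simpa using! ((hY (e 0) v hv).const_smul c).add ((hY (e 1) v hv).const_smul d))
      (fun v hv => by simpa using! hasDerivWithinAt_const v I (0 : ℝ × ℝ)) h2 hu₀
    simp only [hY0, he, Matrix.cons_val_zero, Matrix.cons_val_one] at this
    have t1 := congrArg Prod.fst this
    have t2 := congrArg Prod.snd this
    simp at t1 t2
    exact hcd.elim (· t1) (· t2)
  set s : Fin 2 → ℝ → LieSpace := fun i u => comb (fun j => σ j u) (fun j => a i j u) with hs
  have ss : ∀ i, ContDiffOn ℝ ∞ (s i) I := fun i => contDiffOn_comb hσ (sa i)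
  -- No equation is imposed on `t`: it stays in the span of `τ`, to which the derivatives of `s` are
  -- already orthogonal.
  set t : Fin 2 → ℝ → LieSpace := fun j u => dualPair (fun j => s j u) (fun j => τ j u) j with ht
  have st : ∀ j, ContDiffOn ℝ ∞ (t j) I := fun j =>
    (((ss j).lieInner (hτ 1)).smul (hτ 0)).sub (((ss j).lieInner (hτ 0)).smul (hτ 1))
  have ms : ∀ u i, s i u ∈ span ℝ {σ 0 u, σ 1 u} := fun u i =>
    comb_mem_span (fun j => σ j u) (fun j => a i j u)
  have mτ : ∀ u j, τ j u ∈ span ℝ {τ 0 u, τ 1 u} := by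
    intro u j; fin_cases j <;> exact subset_span (by simp)
  have hyp : ∀ u ∈ I, IsHyperbolicFrame (fun j => s j u) (fun j => t j u) := fun u hu =>
    isHyperbolicFrame_dualPair (fun i j => (nσ u hu).null _ (ms u i) _ (ms u j))
      (fun i j => (nτ u hu).null _ (mτ u i) _ (mτ u j)) (by
        rw [show (fun j => s j u) = fun i => comb (fun j => σ j u) (fun j => a i j u) from rfl,
          gram_comb]
        exact mul_ne_zero (hw u hu) (hG0 u hu))
  refine ⟨s, t, ⟨ss, st, hyp, fun u hu i j => ?_⟩, fun u hu => ⟨?_, ?_⟩⟩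
  · have hk : ∀ k, lieInner (derivWithin (s i) I u) (τ k u) = 0 := by
      intro k
      have hGu := hG0 u hu
      rw [hs, derivWithin_comb hU hσ (sa i) hu, lieInner_add_left, lieInner_comb_left,
        lieInner_comb_left, da0 i u hu, da1 i u hu]
      change a i 0 u * N 0 k u + a i 1 u * N 1 k u + ((p 0 u * a i 0 u + p 1 u * a i 1 u) * M 0 k u
        + (q 0 u * a i 0 u + q 1 u * a i 1 u) * M 1 k u) = 0
      simp only [hp, hq]
      field_simp
      rw [hGM]
      fin_cases k <;> simp <;> ring
    simp only [ht, dualPair]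
    rw [lieInner_sub_right, lieInner_smul_right, lieInner_smul_right, hk, hk]
    ring
  · refine eq_of_le_of_finrank_eq ?_ ((hyp u hu).finrank_left.trans (nσ u hu).finrank_eq.symm)
    rw [span_le, pair_subset_iff]
    exact ⟨ms u 0, ms u 1⟩
  · exact (hyp u hu).span_dualPair (nτ u hu).finrank_eq

end Calculus

/-! ### The one-parameter family of Legendre curves. -/

section Family

/-- The null planes that are spanned by corresponding vectors in the spans of two frames. -/
noncomputable def ribaucourFamily (s t : Fin 2 → ℝ → LieSpace)
    (c : Projectivization ℝ (Fin 2 → ℝ)) (u : ℝ) : Submodule ℝ LieSpace :=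
  span ℝ {comb (fun j => s j u) c.rep, comb (fun j => t j u) c.rep}

/-- The vectors that represent the points of a member of the family. -/
noncomputable def familyVec (s t : Fin 2 → ℝ → LieSpace)
    (c : Projectivization ℝ (Fin 2 → ℝ)) (u : ℝ) : LieSpace :=
  pointVec (comb (fun j => s j u) c.rep) (comb (fun j => t j u) c.rep)

/-- The points of a member of the family. -/
noncomputable def familyPoint (s t : Fin 2 → ℝ → LieSpace)
    (c : Projectivization ℝ (Fin 2 → ℝ)) (u : ℝ) : Plane :=
  (familyVec s t c u).1⁻¹ • (familyVec s t c u).2.2.2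

theorem ribaucourFamily_mk (s t : Fin 2 → ℝ → LieSpace) {a : Fin 2 → ℝ} (ha : a ≠ 0) (u : ℝ) :
    ribaucourFamily s t (Projectivization.mk ℝ a ha) u =
      span ℝ {comb (fun j => s j u) a, comb (fun j => t j u) a} := by
  obtain ⟨r, hr⟩ := Projectivization.exists_smul_eq_mk_rep ℝ a ha
  rw [ribaucourFamily, ← hr, Units.smul_def, comb_smul, comb_smul, span_smul_smul_pair r.ne_zero]

theorem familyVec_mem (s t : Fin 2 → ℝ → LieSpace) (c : Projectivization ℝ (Fin 2 → ℝ)) (u : ℝ) :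
    familyVec s t c u ∈ ribaucourFamily s t c u := pointVec_mem _ _

theorem ribaucourFamily_le_sup (s t : Fin 2 → ℝ → LieSpace)
    (c : Projectivization ℝ (Fin 2 → ℝ)) (u : ℝ) :
    ribaucourFamily s t c u ≤ span ℝ {s 0 u, s 1 u} ⊔ span ℝ {t 0 u, t 1 u} := by
  rw [ribaucourFamily, span_le, pair_subset_iff]
  exact ⟨mem_sup_left (comb_mem_span (fun j => s j u) c.rep),
    mem_sup_right (comb_mem_span (fun j => t j u) c.rep)⟩

theorem derivWithin_comb_const {I : Set ℝ} (hI : UniqueDiffOn ℝ I) {s : Fin 2 → ℝ → LieSpace}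
    (hs : ∀ j, ContDiffOn ℝ ∞ (s j) I) (a : Fin 2 → ℝ) {u : ℝ} (hu : u ∈ I) :
    derivWithin (fun u => comb (fun j => s j u) a) I u =
      comb (fun j => derivWithin (s j) I u) a := by
  have := derivWithin_comb hI hs (a := fun j _ => a j) (fun _ => contDiffOn_const) hu
  rw [this]
  simp [comb]

theorem contDiffOn_comb_const {I : Set ℝ} {s : Fin 2 → ℝ → LieSpace}
    (hs : ∀ j, ContDiffOn ℝ ∞ (s j) I) (a : Fin 2 → ℝ) :
    ContDiffOn ℝ ∞ (fun u => comb (fun j => s j u) a) I :=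
  contDiffOn_comb hs (a := fun j _ => a j) fun _ => contDiffOn_const

theorem lieInner_comb_right (s : Fin 2 → LieSpace) (a : Fin 2 → ℝ) (v : LieSpace) :
    lieInner v (comb s a) = a 0 * lieInner v (s 0) + a 1 * lieInner v (s 1) := by
  simp [comb, lieInner_add_right, lieInner_smul_right]

namespace IsParallelFrame

variable {I : Set ℝ} {s t : Fin 2 → ℝ → LieSpace} (h : IsParallelFrame I s t)
include h

theorem isNullPlane (c : Projectivization ℝ (Fin 2 → ℝ)) {u : ℝ} (hu : u ∈ I) :
    IsNullPlane (ribaucourFamily s t c u) :=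
  (h.hyperbolic u hu).isNullPlane c.rep_nonzero

theorem lieInner_deriv_left_right (hI : UniqueDiffOn ℝ I) (a b : Fin 2 → ℝ) {u : ℝ} (hu : u ∈ I) :
    lieInner (derivWithin (fun u => comb (fun j => s j u) a) I u)
      (comb (fun j => t j u) b) = 0 := by
  rw [derivWithin_comb_const hI h.smooth_left a hu, lieInner_comb_left, lieInner_comb_right,
    lieInner_comb_right]
  simp [h.parallel u hu]

/-- Differentiating the three null relations of the plane leaves one condition, orthogonality of the
derivative of `comb s a` to `comb t a`, which is the parallelism of `s`. -/
theorem lieInner_comb_deriv (hI : UniqueDiffOn ℝ I) (a : Fin 2 → ℝ) {u : ℝ} (hu : u ∈ I) :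
    lieInner (comb (fun j => s j u) a)
        (derivWithin (fun u => comb (fun j => s j u) a) I u) = 0 ∧
      lieInner (comb (fun j => t j u) a)
        (derivWithin (fun u => comb (fun j => s j u) a) I u) = 0 ∧
      lieInner (comb (fun j => s j u) a)
        (derivWithin (fun u => comb (fun j => t j u) a) I u) = 0 ∧
      lieInner (comb (fun j => t j u) a)
        (derivWithin (fun u => comb (fun j => t j u) a) I u) = 0 := by
  have cs := contDiffOn_comb_const h.smooth_left a
  have ct := contDiffOn_comb_const h.smooth_right a
  have h1 := lieInner_derivWithin_comm hI cs cs
    (fun v hv => (h.hyperbolic v hv).comb_comb_left a a) hu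
  have h2 := lieInner_derivWithin_comm hI ct ct
    (fun v hv => (h.hyperbolic v hv).comb_comb_right a a) hu
  have h3 := lieInner_derivWithin_comm hI cs ct
    (fun v hv => by rw [(h.hyperbolic v hv).comb_comb a a]; simp [wedge]; ring_nf; simp) hu
  have h4 := h.lieInner_deriv_left_right hI a a hu
  refine ⟨?_, ?_, ?_, ?_⟩
  · rw [lieInner_comm] at h1; linarith
  · rw [lieInner_comm]; exact h4
  · linarith
  · rw [lieInner_comm] at h2; linarith

/-- Differentiating the orthogonality of a section to a frame vector shifts the derivative to the
frame vector, so contact need only be known for the frame. -/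
theorem isLegendreCurve (hI : UniqueDiffOn ℝ I) (c : Projectivization ℝ (Fin 2 → ℝ)) :
    IsLegendreCurve I (ribaucourFamily s t c) where
  frame := ⟨_, _, contDiffOn_comb_const h.smooth_left c.rep,
    contDiffOn_comb_const h.smooth_right c.rep, fun _ _ => rfl⟩
  null u hu := h.isNullPlane c hu
  contact σ hσ hm u hu w hw := by
    obtain ⟨h1, h2, h3, h4⟩ := h.lieInner_comb_deriv hI c.rep hu
    rw [lieInner_comm]
    refine lieInner_eq_zero_of_mem_span_pair hw ?_ ?_ <;> rw [lieInner_comm]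
    · rw [lieInner_derivWithin_comm hI hσ (contDiffOn_comb_const h.smooth_left c.rep)
        (fun v hv => (h.isNullPlane c hv).null _ (hm v hv) _ (subset_span (by simp))) hu,
        lieInner_eq_zero_of_mem_span_pair (hm u hu) h1 h2, neg_zero]
    · rw [lieInner_derivWithin_comm hI hσ (contDiffOn_comb_const h.smooth_right c.rep)
        (fun v hv => (h.isNullPlane c hv).null _ (hm v hv) _ (subset_span (by simp))) hu,
        lieInner_eq_zero_of_mem_span_pair (hm u hu) h3 h4, neg_zero]

theorem isCommonLieTransform (hI : UniqueDiffOn ℝ I) {Λ₀ Λ₁ : ℝ → Submodule ℝ LieSpace}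
    (h₀ : ∀ u ∈ I, span ℝ {s 0 u, s 1 u} = Λ₀ u) (h₁ : ∀ u ∈ I, span ℝ {t 0 u, t 1 u} = Λ₁ u)
    (c : Projectivization ℝ (Fin 2 → ℝ)) :
    IsCommonLieTransform I Λ₀ Λ₁ (ribaucourFamily s t c) where
  legendre := h.isLegendreCurve hI c
  pair₀ u hu := by
    have hh := h.hyperbolic u hu
    rw [← h₀ u hu, ribaucourFamily, hh.left_inf_eq c.rep_nonzero,
      finrank_span_singleton (hh.comb_left_ne_zero c.rep_nonzero)]
  pair₁ u hu := by
    have hh := h.hyperbolic u hu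
    rw [← h₁ u hu, ribaucourFamily, hh.right_inf_eq c.rep_nonzero,
      finrank_span_singleton (hh.comb_right_ne_zero c.rep_nonzero)]

theorem disjoint {c c' : Projectivization ℝ (Fin 2 → ℝ)} (hc : c ≠ c') {u : ℝ} (hu : u ∈ I) :
    Disjoint (ribaucourFamily s t c u) (ribaucourFamily s t c' u) :=
  (h.hyperbolic u hu).disjoint_span fun hw => hc ((projectivization_eq_iff_wedge _ _).2 hw)

/-- Members through a common nonzero vector coincide; this bounds the number of exceptional
parameters for q and for the lifts of the given points. -/
theorem eq_of_mem {c c' : Projectivization ℝ (Fin 2 → ℝ)} {u : ℝ} (hu : u ∈ I) {v : LieSpace}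
    (hv : v ≠ 0) (hc : v ∈ ribaucourFamily s t c u) (hc' : v ∈ ribaucourFamily s t c' u) :
    c = c' := by
  by_contra hne
  exact hv ((Submodule.disjoint_def.1 (h.disjoint hne hu)) v hc hc')

theorem ribaucourFamily_injective {u : ℝ} (hu : u ∈ I) {c c' : Projectivization ℝ (Fin 2 → ℝ)}
    (hc : ribaucourFamily s t c u = ribaucourFamily s t c' u) : c = c' :=
  h.eq_of_mem hu ((h.hyperbolic u hu).comb_left_ne_zero c.rep_nonzero) (subset_span (by simp))
    (hc ▸ subset_span (by simp))

theorem existsUnique_eq {u : ℝ} (hu : u ∈ I) {W : Submodule ℝ LieSpace} (hW : IsNullPlane W)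
    (h₀ : span ℝ {s 0 u, s 1 u} ⊓ W ≠ ⊥) (h₁ : span ℝ {t 0 u, t 1 u} ⊓ W ≠ ⊥) :
    ∃! c, ribaucourFamily s t c u = W := by
  obtain ⟨a, ha, rfl⟩ := (h.hyperbolic u hu).exists_eq_span hW h₀ h₁
  exact ⟨Projectivization.mk ℝ a ha, ribaucourFamily_mk s t ha u, fun c hc =>
    h.ribaucourFamily_injective hu (hc.trans (ribaucourFamily_mk s t ha u).symm)⟩

theorem contDiffOn_familyVec (c : Projectivization ℝ (Fin 2 → ℝ)) :
    ContDiffOn ℝ ∞ (familyVec s t c) I := by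
  have cs := contDiffOn_comb_const h.smooth_left c.rep
  have ct := contDiffOn_comb_const h.smooth_right c.rep
  exact ((contDiff_fst.comp contDiff_snd).comp_contDiffOn ct |>.smul cs).sub
    ((contDiff_fst.comp contDiff_snd).comp_contDiffOn cs |>.smul ct)

theorem infinityVec_mem_iff (c : Projectivization ℝ (Fin 2 → ℝ)) {u : ℝ} (hu : u ∈ I) :
    infinityVec ∈ ribaucourFamily s t c u ↔ (familyVec s t c u).1 = 0 :=
  _root_.infinityVec_mem_iff (h.isNullPlane c hu)

theorem familyVec_eq_smul (c : Projectivization ℝ (Fin 2 → ℝ)) {u : ℝ} (hu : u ∈ I)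
    (h0 : (familyVec s t c u).1 ≠ 0) :
    familyVec s t c u = (familyVec s t c u).1 • pointLift (familyPoint s t c u) :=
  smul_pointLift ((h.isNullPlane c hu).null _ (familyVec_mem s t c u) _ (familyVec_mem s t c u))
    (pointVec_snd _ _) h0

theorem pointLift_mem (c : Projectivization ℝ (Fin 2 → ℝ)) {u : ℝ} (hu : u ∈ I)
    (h0 : (familyVec s t c u).1 ≠ 0) :
    pointLift (familyPoint s t c u) ∈ ribaucourFamily s t c u := by
  have := smul_mem _ (familyVec s t c u).1⁻¹ (familyVec_mem s t c u)
  rw [h.familyVec_eq_smul c hu h0] at this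
  simpa [pointLift, smul_smul, h0] using this

theorem contDiffWithinAt_familyPoint (c : Projectivization ℝ (Fin 2 → ℝ)) {u : ℝ} (hu : u ∈ I)
    (h0 : (familyVec s t c u).1 ≠ 0) : ContDiffWithinAt ℝ ∞ (familyPoint s t c) I u := by
  have hv := h.contDiffOn_familyVec c u hu
  have h1 : ContDiffWithinAt ℝ ∞ (fun u => (familyVec s t c u).1) I u :=
    contDiff_fst.contDiffAt.comp_contDiffWithinAt u hv
  exact (h1.inv h0).smul
    ((contDiff_snd.comp (contDiff_snd.comp contDiff_snd)).contDiffAt.comp_contDiffWithinAt u hv)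

/-- A smooth section of the span of the first frame has smooth coefficients. -/
theorem exists_coefficients {v : ℝ → LieSpace} (hv : ContDiffOn ℝ ∞ v I)
    (hm : ∀ u ∈ I, v u ∈ span ℝ {s 0 u, s 1 u}) :
    ∃ f : Fin 2 → ℝ → ℝ, (∀ j, ContDiffOn ℝ ∞ (f j) I) ∧
      ∀ u ∈ I, v u = comb (fun j => s j u) (fun j => f j u) := by
  have sD := (h.smooth_left 0).lieInner (h.smooth_right 1)
  have hD : ∀ u ∈ I, lieInner (s 0 u) (t 1 u) ≠ 0 := fun u hu => (h.hyperbolic u hu).ne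
  -- Pairing with t₁ and t₀ reads off the coefficients, since the frames are dual up to the
  -- nonvanishing factor (s₀, t₁).
  refine ⟨![fun u => lieInner (v u) (t 1 u) / lieInner (s 0 u) (t 1 u),
    fun u => -lieInner (v u) (t 0 u) / lieInner (s 0 u) (t 1 u)], ?_, fun u hu => ?_⟩
  · intro j
    fin_cases j
    · exact (hv.lieInner (h.smooth_right 1)).div sD hD
    · exact (hv.lieInner (h.smooth_right 0)).neg.div sD hD
  · obtain ⟨a, ha⟩ := mem_span_iff_comb (s := fun j => s j u).1 (hm u hu)
    have hh := h.hyperbolic u hu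
    have hst := hh.st
    have hsk := hh.skew
    have hne := hD u hu
    refine ha.trans (congrArg _ ?_)
    ext j
    fin_cases j
    · simp [ha, lieInner_comb_left, hst, hne]
    · simp [ha, lieInner_comb_left, hst, hsk, hne]

end IsParallelFrame

end Family

/-! ### Every common transform belongs to the family. -/

section Contains

/-- A curve in the plane whose velocity is parallel to it does not change its direction. -/
theorem wedge_eq_zero_of_wedge_derivWithin {I : Set ℝ} (hI : I.OrdConnected)
    {f : Fin 2 → ℝ → ℝ} (hf : ∀ j, ContDiffOn ℝ ∞ (f j) I) (hU : UniqueDiffOn ℝ I)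
    (hw : ∀ u ∈ I, wedge (fun j => derivWithin (f j) I u) (fun j => f j u) = 0)
    {u₀ : ℝ} (hu₀ : u₀ ∈ I) (h0 : (fun j => f j u₀) ≠ 0) :
    ∀ᶠ u in 𝓝[I] u₀, (fun j => f j u) ≠ 0 ∧ wedge (fun j => f j u) (fun j => f j u₀) = 0 := by
  set g : ℝ → ℝ := fun u => f 0 u ^ 2 + f 1 u ^ 2 with hg
  have hgf : ∀ u, g u ≠ 0 ↔ (fun j => f j u) ≠ 0 := by
    intro u
    rw [not_iff_not]
    constructor
    · intro h
      have h1 : f 0 u = 0 := by simp only [hg] at h; nlinarith [sq_nonneg (f 0 u), sq_nonneg (f 1 u)]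
      have h2 : f 1 u = 0 := by simp only [hg] at h; nlinarith [sq_nonneg (f 0 u), sq_nonneg (f 1 u)]
      ext j; fin_cases j <;> simp [h1, h2]
    · intro h
      have h1 : f 0 u = 0 := congrFun h 0
      have h2 : f 1 u = 0 := congrFun h 1
      simp [hg, h1, h2]
  have sf : ∀ j, ContinuousOn (f j) I := fun j => (hf j).continuousOn
  have sd : ∀ j, ContinuousOn (derivWithin (f j) I) I := fun j =>
    (hf j).continuousOn_derivWithin hU (by simp)
  have sg : ContinuousOn g I := ((sf 0).pow 2).add ((sf 1).pow 2)
  obtain ⟨ε, hε, hball⟩ := Metric.mem_nhdsWithin_iff.1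
    ((sg u₀ hu₀).eventually_ne ((hgf u₀).2 h0))
  set J := Metric.ball u₀ ε ∩ I
  have hJI : J ⊆ I := inter_subset_right
  have hJ : J.OrdConnected := by
    rw [show J = Metric.ball u₀ ε ∩ I from rfl, Real.ball_eq_Ioo]
    exact ordConnected_Ioo.inter hI
  -- Since f' is parallel to f, it equals `κ` f. Hence the determinant of f(u) and f(u₀) solves the
  -- scalar equation z' = κ z with initial value 0.
  set κ : ℝ → ℝ := fun u => (f 0 u * derivWithin (f 0) I u + f 1 u * derivWithin (f 1) I u) / g u
  have sκ : ContinuousOn κ J :=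
    ((((sf 0).mul (sd 0)).add ((sf 1).mul (sd 1))).mono hJI).div (sg.mono hJI) fun u hu => hball hu
  have hu₀J : u₀ ∈ J := ⟨Metric.mem_ball_self hε, hu₀⟩
  have hz := linearODE_unique (A := fun u => κ u • ContinuousLinearMap.id ℝ ℝ)
    (y := fun u => f 0 u * f 1 u₀ - f 1 u * f 0 u₀) (z := fun _ => 0) hJ
    (sκ.smul continuousOn_const) hu₀J (fun u hu => by
      have h1 := (((hf 0).hasDerivWithinAt hu.2).mul_const (f 1 u₀)).sub
        (((hf 1).hasDerivWithinAt hu.2).mul_const (f 0 u₀))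
      refine (h1.mono hJI).congr_deriv ?_
      have h2 := hw u hu.2
      have h3 : g u ≠ 0 := hball hu
      simp only [wedge] at h2
      simp only [smul_apply, ContinuousLinearMap.id_apply, smul_eq_mul, κ]
      field_simp
      simp only [hg]
      linear_combination (f 1 u * f 1 u₀ + f 0 u * f 0 u₀) * h2)
    (fun u hu => by simpa using! hasDerivWithinAt_const u J (0 : ℝ)) (by ring)
  filter_upwards [inter_mem_nhdsWithin I (Metric.ball_mem_nhds u₀ hε)] with u hu
  have hu' : u ∈ J := ⟨hu.2, hu.1⟩
  exact ⟨(hgf u).1 (hball hu'), hz hu'⟩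

namespace IsParallelFrame

variable {I : Set ℝ} {s t : Fin 2 → ℝ → LieSpace} (h : IsParallelFrame I s t)
include h

/-- Each plane of `Λ` is a member at that parameter value. A smooth section of its intersection with
the first bundle, nonzero at `u₀`, tracks the member, and contact keeps it constant. -/
theorem eventually_exists_eq (hI : I.OrdConnected) (hU : UniqueDiffOn ℝ I)
    {Λ₀ Λ₁ Λ : ℝ → Submodule ℝ LieSpace}
    (h₀ : ∀ u ∈ I, span ℝ {s 0 u, s 1 u} = Λ₀ u) (h₁ : ∀ u ∈ I, span ℝ {t 0 u, t 1 u} = Λ₁ u)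
    (hΛ : IsCommonLieTransform I Λ₀ Λ₁ Λ) {u₀ : ℝ} (hu₀ : u₀ ∈ I) :
    ∀ᶠ u in 𝓝[I] u₀, ∃ c, Λ u₀ = ribaucourFamily s t c u₀ ∧ Λ u = ribaucourFamily s t c u := by
  have hb : ∀ u ∈ I, ∃ b ≠ 0, Λ u =
      span ℝ {comb (fun j => s j u) b, comb (fun j => t j u) b} := by
    intro u hu
    refine (h.hyperbolic u hu).exists_eq_span (hΛ.legendre.null u hu) ?_ ?_
    · intro hbot
      have := hΛ.pair₀ u hu
      rw [← h₀ u hu, hbot, finrank_bot] at this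
      omega
    · intro hbot
      have := hΛ.pair₁ u hu
      rw [← h₁ u hu, hbot, finrank_bot] at this
      omega
  obtain ⟨p, r, sp, sr, hpr⟩ := hΛ.legendre.frame
  -- The combination of `p` and `r` orthogonal to `s k`. It cancels the component along `comb t b`
  -- and so is a smooth section of the intersection with the first bundle; for one `k` at least it
  -- does not vanish at a given point.
  set v : Fin 2 → ℝ → LieSpace := fun k u =>
    lieInner (p u) (s k u) • r u - lieInner (r u) (s k u) • p u with hv
  have sv : ∀ k, ContDiffOn ℝ ∞ (v k) I := fun k =>
    ((sp.lieInner (h.smooth_left k)).smul sr).sub ((sr.lieInner (h.smooth_left k)).smul sp)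
  have hvΛ : ∀ k, ∀ u ∈ I, v k u ∈ Λ u := by
    intro k u hu
    rw [hpr u hu]
    exact sub_mem (smul_mem _ _ (subset_span (by simp))) (smul_mem _ _ (subset_span (by simp)))
  have hvb : ∀ u ∈ I, ∀ b ≠ 0, Λ u = span ℝ {comb (fun j => s j u) b, comb (fun j => t j u) b} →
      (∀ k, ∃ m : ℝ, v k u = m • comb (fun j => s j u) b) ∧ ∃ k, v k u ≠ 0 := by
    intro u hu b hb0 hΛu
    have hh := h.hyperbolic u hu
    have hp : p u ∈ Λ u := by rw [hpr u hu]; exact subset_span (by simp)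
    have hr : r u ∈ Λ u := by rw [hpr u hu]; exact subset_span (by simp)
    rw [hΛu] at hp hr
    obtain ⟨x, y, hxy⟩ := mem_span_pair.1 hp
    obtain ⟨x', y', hxy'⟩ := mem_span_pair.1 hr
    have e : ∀ k, v k u = ((y * x' - y' * x) * lieInner (comb (fun j => t j u) b) (s k u)) •
        comb (fun j => s j u) b := by
      intro k
      have e0 : lieInner (comb (fun j => s j u) b) (s k u) = 0 := by
        rw [lieInner_comb_left, hh.ss, hh.ss]; ring
      simp only [hv]
      rw [← hxy, ← hxy']
      simp only [lieInner_add_left, lieInner_smul_left, e0]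
      module
    refine ⟨fun k => ⟨_, e k⟩, ?_⟩
    have hne : y * x' - y' * x ≠ 0 := by
      intro h0
      have hnull := (hΛ.legendre.null u hu).finrank_eq
      rw [hpr u hu] at hnull
      have e1 : y' • p u + (-y) • r u = 0 := by
        rw [← hxy, ← hxy']
        have : y' • (x • comb (fun j => s j u) b + y • comb (fun j => t j u) b) +
          (-y) • (x' • comb (fun j => s j u) b + y' • comb (fun j => t j u) b) =
          (-(y * x' - y' * x)) • comb (fun j => s j u) b := by module
        rw [this, h0, neg_zero, zero_smul]
      obtain ⟨hy', hy⟩ := eq_zero_of_finrank_span_pair hnull e1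
      have hy0 : y = 0 := neg_eq_zero.1 hy
      have e2 : x' • p u + (-x) • r u = 0 := by
        rw [← hxy, ← hxy', hy', hy0]; module
      obtain ⟨hx', -⟩ := eq_zero_of_finrank_span_pair hnull e2
      have e3 : (0 : ℝ) • p u + (1 : ℝ) • r u = 0 := by
        rw [← hxy', hx', hy']; module
      exact one_ne_zero (eq_zero_of_finrank_span_pair hnull e3).2
    by_contra! hall
    have ht : ∀ k, lieInner (comb (fun j => t j u) b) (s k u) = 0 := fun k => by
      have := e k
      rw [hall k, eq_comm, smul_eq_zero, or_iff_left (hh.comb_left_ne_zero hb0), mul_eq_zero] at this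
      exact this.resolve_left hne
    obtain ⟨d, hd⟩ := exists_wedge_ne_zero hb0
    have e4 := hh.comb_comb d b
    rw [lieInner_comm, lieInner_comb_right, ht, ht] at e4
    have : wedge d b ≠ 0 := fun h' => hd (by simp only [wedge] at *; linarith)
    simp [this, hh.ne] at e4
  obtain ⟨b₀, hb₀, hΛ₀⟩ := hb u₀ hu₀
  obtain ⟨k, hk⟩ := (hvb u₀ hu₀ b₀ hb₀ hΛ₀).2
  obtain ⟨f, sf, hf⟩ := h.exists_coefficients (sv k) fun u hu => by
    obtain ⟨b, hb0, hΛu⟩ := hb u hu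
    obtain ⟨m, hm⟩ := (hvb u hu b hb0 hΛu).1 k
    rw [hm]
    exact smul_mem _ _ (comb_mem_span (fun j => s j u) b)
  have hfb : ∀ u ∈ I, ∀ b ≠ 0,
      Λ u = span ℝ {comb (fun j => s j u) b, comb (fun j => t j u) b} →
      ∃ m : ℝ, (fun j => f j u) = m • b := by
    intro u hu b hb0 hΛu
    obtain ⟨m, hm⟩ := (hvb u hu b hb0 hΛu).1 k
    exact ⟨m, (h.hyperbolic u hu).comb_left_injective (by rw [← hf u hu, hm, comb_smul])⟩
  have hΛf : ∀ u ∈ I, ∀ h0 : (fun j => f j u) ≠ 0,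
      Λ u = ribaucourFamily s t (Projectivization.mk ℝ _ h0) u := by
    intro u hu h0
    obtain ⟨b, hb0, hΛu⟩ := hb u hu
    obtain ⟨m, hm⟩ := hfb u hu b hb0 hΛu
    have hm0 : m ≠ 0 := by rintro rfl; exact h0 (by rw [hm, zero_smul])
    rw [ribaucourFamily_mk, hm, comb_smul, comb_smul, span_smul_smul_pair hm0, hΛu]
  have hw : ∀ u ∈ I, wedge (fun j => derivWithin (f j) I u) (fun j => f j u) = 0 := by
    intro u hu
    obtain ⟨b, hb0, hΛu⟩ := hb u hu
    obtain ⟨m, hm⟩ := hfb u hu b hb0 hΛu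
    have hh := h.hyperbolic u hu
    -- In the derivative of the section, the terms with derivatives of `s` are orthogonal to `t`.
    -- Contact with `comb t b` thus says that f' is parallel to b, hence to f.
    have hc := hΛ.legendre.contact (v k) (sv k) (hvΛ k) u hu (comb (fun j => t j u) b)
      (by rw [hΛu]; exact subset_span (by simp))
    have hd := derivWithin_comb hU h.smooth_left sf hu
    rw [← derivWithin_congr hf (hf u hu)] at hd
    have hpar := h.parallel u hu
    rw [hd, lieInner_add_left, hh.comb_comb, lieInner_comb_left, lieInner_comb_right,
      lieInner_comb_right, hpar, hpar, hpar, hpar] at hc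
    have h5 : wedge (fun j => derivWithin (f j) I u) b = 0 := by simpa [hh.ne] using hc
    rw [hm]
    simp only [wedge, Pi.smul_apply, smul_eq_mul] at h5 ⊢
    linear_combination m * h5
  have h0 : (fun j => f j u₀) ≠ 0 := fun h0 => hk (by rw [hf u₀ hu₀, h0, comb_zero])
  filter_upwards [wedge_eq_zero_of_wedge_derivWithin hI sf hU hw hu₀ h0, self_mem_nhdsWithin]
    with u hu huI
  refine ⟨_, hΛf u₀ hu₀ h0, ?_⟩
  rw [hΛf u huI hu.1, (projectivization_mk_eq_iff_wedge hu.1 h0).2 hu.2]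

theorem existsUnique_eqOn (hI : I.OrdConnected) (hn : I.Nontrivial)
    {Λ₀ Λ₁ Λ : ℝ → Submodule ℝ LieSpace}
    (h₀ : ∀ u ∈ I, span ℝ {s 0 u, s 1 u} = Λ₀ u) (h₁ : ∀ u ∈ I, span ℝ {t 0 u, t 1 u} = Λ₁ u)
    (hΛ : IsCommonLieTransform I Λ₀ Λ₁ Λ) : ∃! c, EqOn Λ (ribaucourFamily s t c) I := by
  have hU := uniqueDiffOn_of_ordConnected hI hn
  obtain ⟨u₀, hu₀⟩ := hn.nonempty
  -- Lying on a common member is a locally valid equivalence relation on parameter values;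
  -- connectedness of `I` makes it global.
  have key : ∀ u ∈ I, ∃ c, Λ u₀ = ribaucourFamily s t c u₀ ∧ Λ u = ribaucourFamily s t c u :=
    fun u hu => hI.isPreconnected.induction₂
      (fun u v => ∃ c, Λ u = ribaucourFamily s t c u ∧ Λ v = ribaucourFamily s t c v)
      (fun u hu => h.eventually_exists_eq hI hU h₀ h₁ hΛ hu)
      (fun x y z _ hy _ ⟨c, hc, hc'⟩ ⟨d, hd, hd'⟩ => ⟨c, hc, by
        rw [h.ribaucourFamily_injective hy (hc'.symm.trans hd)]; exact hd'⟩)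
      (fun x y _ _ ⟨c, hc, hc'⟩ => ⟨c, hc', hc⟩) hu₀ hu
  obtain ⟨c, hc, -⟩ := key u₀ hu₀
  refine ⟨c, fun u hu => ?_, fun d hd => h.ribaucourFamily_injective hu₀ ((hd hu₀).symm.trans hc)⟩
  obtain ⟨d, hd, hd'⟩ := key u hu
  rw [hd', h.ribaucourFamily_injective hu₀ (hd.symm.trans hc)]

end IsParallelFrame

end Contains

/-! ### Curves of points and their singularities. -/

section Regular

theorem hasDerivWithinAt_pointLift {x : ℝ → Plane} {x' : Plane} {I : Set ℝ} {u : ℝ}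
    (hx : HasDerivWithinAt x x' I u) :
    HasDerivWithinAt (fun v => pointLift (x v)) (0, 0, ⟪x u, x'⟫, x') I u := by
  have h1 : HasDerivWithinAt (fun v => ⟪x v, x v⟫ / 2) ⟪x u, x'⟫ I u := by
    refine ((hx.inner ℝ hx).div_const 2).congr_deriv ?_
    rw [real_inner_comm (x u) x']; ring
  exact (hasDerivWithinAt_const u I (1 : ℝ)).prodMk
    ((hasDerivWithinAt_const u I (0 : ℝ)).prodMk (h1.prodMk hx))

namespace Ribaucour.IsFramedCurve

variable {I : Set ℝ} {x n : ℝ → Plane} (hx : Ribaucour.IsFramedCurve I x n)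
include hx

theorem contDiffOn_pointLift : ContDiffOn ℝ ∞ (fun u => pointLift (x u)) I :=
  contDiffOn_const.prodMk (contDiffOn_const.prodMk
    (((hx.smooth_curve.inner ℝ hx.smooth_curve).div_const 2).prodMk hx.smooth_curve))

theorem contDiffOn_lineLift : ContDiffOn ℝ ∞ (fun u => lineLift (x u) (n u)) I :=
  contDiffOn_const.prodMk (contDiffOn_const.prodMk
    ((hx.smooth_normal.inner ℝ hx.smooth_curve).prodMk hx.smooth_normal))

theorem isNullPlane_legendreLift {u : ℝ} (hu : u ∈ I) : IsNullPlane (legendreLift x n u) :=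
  isNullPlane_point_line _ _ (hx.unit u hu)

theorem lieInner_tangent {u : ℝ} (hu : u ∈ I) {z : LieSpace} (hz : z ∈ legendreLift x n u) :
    lieInner (0, 0, ⟪x u, derivWithin x I u⟫, derivWithin x I u) z = 0 := by
  rw [lieInner_comm]
  refine lieInner_eq_zero_of_mem_span_pair hz ?_ ?_
  · simp [lieInner, pointLift]
  · have := hx.orthogonal u hu
    rw [real_inner_comm] at this
    simp [lieInner, lineLift, this]

end Ribaucour.IsFramedCurve

/-- A nonzero binary quadratic form has at most two zeros on the projective line. -/
theorem encard_zeros_quadratic_le_two {A B C : ℝ} {d : Fin 2 → ℝ}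
    (hd : A * d 0 ^ 2 + B * (d 0 * d 1) + C * d 1 ^ 2 ≠ 0) :
    {c : Projectivization ℝ (Fin 2 → ℝ) |
      A * c.rep 0 ^ 2 + B * (c.rep 0 * c.rep 1) + C * c.rep 1 ^ 2 = 0}.encard ≤ 2 := by
  by_contra! hlt
  obtain ⟨S, hS, hS3⟩ := exists_subset_encard_eq (Order.add_one_le_of_lt hlt)
  norm_num at hS3
  obtain ⟨c₁, c₂, c₃, h12, h13, h23, rfl⟩ := encard_eq_three.1 hS3
  have q1 := hS (show c₁ ∈ _ by simp)
  have q2 := hS (show c₂ ∈ _ by simp)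
  have q3 := hS (show c₃ ∈ _ by simp)
  rw [Ne, projectivization_eq_iff_wedge] at h12 h13 h23
  simp only [mem_ofPred_eq, wedge] at *
  set x₁ := c₁.rep 0
  set y₁ := c₁.rep 1
  set x₂ := c₂.rep 0
  set y₂ := c₂.rep 1
  set x₃ := c₃.rep 0
  set y₃ := c₃.rep 1
  -- Up to sign, this is the determinant of the three equations for `A`, `B`, `C`. The weights below
  -- are cofactors of its columns.
  have hV : (x₁ * y₂ - y₁ * x₂) * (x₁ * y₃ - y₁ * x₃) * (x₂ * y₃ - y₂ * x₃) ≠ 0 :=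
    mul_ne_zero (mul_ne_zero h12 h13) h23
  have hA : A = 0 := by
    refine (mul_eq_zero.1 ?_).resolve_right hV
    linear_combination y₂ * y₃ * (x₂ * y₃ - y₂ * x₃) * q1 - y₃ * y₁ * (x₁ * y₃ - y₁ * x₃) * q2 +
      y₁ * y₂ * (x₁ * y₂ - y₁ * x₂) * q3
  have hC : C = 0 := by
    refine (mul_eq_zero.1 ?_).resolve_right hV
    linear_combination x₂ * x₃ * (x₂ * y₃ - y₂ * x₃) * q1 - x₃ * x₁ * (x₁ * y₃ - y₁ * x₃) * q2 +
      x₁ * x₂ * (x₁ * y₂ - y₁ * x₂) * q3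
  have hB : B = 0 := by
    refine (mul_eq_zero.1 ?_).resolve_right hV
    linear_combination -(x₂ * y₃ + y₂ * x₃) * (x₂ * y₃ - y₂ * x₃) * q1 +
      (x₃ * y₁ + y₃ * x₁) * (x₁ * y₃ - y₁ * x₃) * q2 -
      (x₁ * y₂ + y₁ * x₂) * (x₁ * y₂ - y₁ * x₂) * q3
  simp [hA, hB, hC] at hd

namespace IsParallelFrame

variable {I : Set ℝ} {s t : Fin 2 → ℝ → LieSpace} (h : IsParallelFrame I s t)
include h

theorem eventually_fst_ne_zero (c : Projectivization ℝ (Fin 2 → ℝ)) {u : ℝ} (hu : u ∈ I)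
    (h0 : (familyVec s t c u).1 ≠ 0) : ∀ᶠ v in 𝓝[I] u, (familyVec s t c v).1 ≠ 0 :=
  (continuous_fst.continuousAt.comp_continuousWithinAt
    ((h.contDiffOn_familyVec c).continuousOn u hu)).eventually_ne h0

/-- Product rule for the representing vector as a multiple of the Euclidean lift. It transfers
contact and singularity between the two. -/
theorem derivWithin_familyVec (hU : UniqueDiffOn ℝ I) (c : Projectivization ℝ (Fin 2 → ℝ)) {u : ℝ}
    (hu : u ∈ I) (h0 : (familyVec s t c u).1 ≠ 0) :
    ∃ r : ℝ, derivWithin (familyVec s t c) I u = r • pointLift (familyPoint s t c u) +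
      (familyVec s t c u).1 • (0, 0, ⟪familyPoint s t c u, derivWithin (familyPoint s t c) I u⟫,
        derivWithin (familyPoint s t c) I u) := by
  have h1 : HasDerivWithinAt (familyPoint s t c) (derivWithin (familyPoint s t c) I u) I u :=
    ((h.contDiffWithinAt_familyPoint c hu h0).differentiableWithinAt (by simp)).hasDerivWithinAt
  have h2 := (h.contDiffOn_familyVec c).hasDerivWithinAt hu
  have h3 := (ContinuousLinearMap.fst ℝ ℝ (ℝ × ℝ × Plane)).hasFDerivAt.comp_hasDerivWithinAt u h2
  have h4 := h3.smul (hasDerivWithinAt_pointLift h1)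
  have h5 : familyVec s t c =ᶠ[𝓝[I] u]
      (fun v => (familyVec s t c v).1 • pointLift (familyPoint s t c v)) := by
    filter_upwards [h.eventually_fst_ne_zero c hu h0, self_mem_nhdsWithin] with v hv hvI
      using h.familyVec_eq_smul c hvI hv
  rw [h5.derivWithin_eq (h.familyVec_eq_smul c hu h0)]
  refine ⟨_, (h4.derivWithin (hU u hu)).trans (add_comm _ _)⟩

theorem lieInner_tangent (hU : UniqueDiffOn ℝ I) (c : Projectivization ℝ (Fin 2 → ℝ)) {u : ℝ}
    (hu : u ∈ I) (h0 : (familyVec s t c u).1 ≠ 0) {z : LieSpace}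
    (hz : z ∈ ribaucourFamily s t c u) :
    lieInner (0, 0, ⟪familyPoint s t c u, derivWithin (familyPoint s t c) I u⟫,
        derivWithin (familyPoint s t c) I u) z = 0 := by
  have h1 := (h.isLegendreCurve hU c).contact _ (h.contDiffOn_familyVec c)
    (fun v _ => familyVec_mem s t c v) u hu z hz
  obtain ⟨r, hr⟩ := h.derivWithin_familyVec hU c hu h0
  rw [hr, lieInner_add_left, lieInner_smul_left, lieInner_smul_left,
    (h.isNullPlane c hu).null _ (h.pointLift_mem c hu h0) z hz] at h1
  simpa [h0] using h1

/-- The shared vector `z` is the common tangent circle: contact of both Legendre curves makes the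
points and both tangent vectors orthogonal to it. -/
theorem isRibaucourPairAt (hU : UniqueDiffOn ℝ I) (c : Projectivization ℝ (Fin 2 → ℝ)) {u : ℝ}
    (hu : u ∈ I) {x n : ℝ → Plane} (hx : Ribaucour.IsFramedCurve I x n) {z : LieSpace}
    (hz : z ≠ 0) (hzx : z ∈ legendreLift x n u) (hzc : z ∈ ribaucourFamily s t c u)
    (h0 : (familyVec s t c u).1 ≠ 0) (hd : derivWithin (familyPoint s t c) I u ≠ 0)
    (hne : familyPoint s t c u ≠ x u) : IsRibaucourPairAt I x (familyPoint s t c) u where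
  ne := hne.symm
  immersed_left := hx.immersed u hu
  immersed_right := hd
  circular := by
    have h1 : HasDerivWithinAt (familyPoint s t c) (derivWithin (familyPoint s t c) I u) I u :=
      ((h.contDiffWithinAt_familyPoint c hu h0).differentiableWithinAt (by simp)).hasDerivWithinAt
    rw [(hasDerivWithinAt_pointLift h1).derivWithin (hU u hu),
      (hasDerivWithinAt_pointLift (hx.smooth_curve.hasDerivWithinAt hu)).derivWithin (hU u hu)]
    exact finrank_span_point_tangent hne.symm (hx.immersed u hu) hz
      ((h.isNullPlane c hu).null z hzc z hzc)
      ((hx.isNullPlane_legendreLift hu).null _ (subset_span (by simp)) z hzx)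
      (hx.lieInner_tangent hu hzx)
      ((h.isNullPlane c hu).null _ (h.pointLift_mem c hu h0) z hzc)
      (h.lieInner_tangent hU c hu h0 hzc)

/-- There is a vector orthogonal to both frames that is not orthogonal to the tangent vector of
a regular curve with lifts in the span of the first frame. -/
theorem exists_normal {x n : ℝ → Plane} (hx : Ribaucour.IsFramedCurve I x n)
    {u : ℝ} (hu : u ∈ I) (h₀ : span ℝ {s 0 u, s 1 u} = legendreLift x n u) :
    ∃ e : LieSpace, (∀ j, lieInner (s j u) e = 0) ∧ (∀ j, lieInner (t j u) e = 0) ∧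
      lieInner (0, 0, ⟪x u, derivWithin x I u⟫, derivWithin x I u) e ≠ 0 := by
  set ξ : LieSpace := (0, 0, ⟪x u, derivWithin x I u⟫, derivWithin x I u) with hξ
  have hh := h.hyperbolic u hu
  set D := lieInner (s 0 u) (t 1 u) with hD
  have hD0 : D ≠ 0 := hh.ne
  have hsk : lieInner (s 1 u) (t 0 u) = -D := hh.skew
  have hst : ∀ j, lieInner (s j u) (t j u) = 0 := hh.st
  have hss : ∀ i j, lieInner (s i u) (s j u) = 0 := hh.ss
  have hs : ∀ j, lieInner (s j u) ξ = 0 := by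
    intro j
    rw [lieInner_comm]
    refine hx.lieInner_tangent hu ?_
    rw [← h₀]
    fin_cases j <;> exact subset_span (by simp)
  -- The component of `ξ` normal to both planes. As `ξ` is orthogonal to `s` by contact, only a
  -- combination of `s` is subtracted, and the product with `ξ` remains the squared speed of `x`.
  refine ⟨ξ - D⁻¹ • (lieInner ξ (t 1 u) • s 0 u - lieInner ξ (t 0 u) • s 1 u), fun j => ?_,
    fun j => ?_, ?_⟩
  · simp [lieInner_sub_right, lieInner_smul_right, hs, hss]
  · rw [lieInner_comm]
    simp only [lieInner_sub_left, lieInner_smul_left]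
    fin_cases j
    · simp only [Fin.zero_eta, hst, hsk]; field_simp; ring
    · simp only [Fin.mk_one, hst, ← hD]; field_simp; ring
  · simp only [lieInner_sub_right, lieInner_smul_right, lieInner_comm ξ (s _ u), hs]
    have := hx.immersed u hu
    simpa [lieInner_self, hξ] using this

/-- At a singular point the derivative of the representing vector is a multiple of the vector
itself, hence orthogonal to `e`. The terms with derivatives of p-components drop out, as `e` is
orthogonal to the frames. -/
theorem lieInner_deriv_eq_zero (hU : UniqueDiffOn ℝ I) (c : Projectivization ℝ (Fin 2 → ℝ)) {u : ℝ}
    (hu : u ∈ I) (h0 : (familyVec s t c u).1 ≠ 0) (hd : derivWithin (familyPoint s t c) I u = 0)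
    {e : LieSpace} (hs : ∀ j, lieInner (s j u) e = 0) (ht : ∀ j, lieInner (t j u) e = 0) :
    (comb (fun j => t j u) c.rep).2.1 *
        lieInner (comb (fun j => derivWithin (s j) I u) c.rep) e -
      (comb (fun j => s j u) c.rep).2.1 *
        lieInner (comb (fun j => derivWithin (t j) I u) c.rep) e = 0 := by
  have cs := (contDiffOn_comb_const h.smooth_left c.rep).hasDerivWithinAt hu
  have ct := (contDiffOn_comb_const h.smooth_right c.rep).hasDerivWithinAt hu
  have ce := hasDerivWithinAt_const u I e
  let b := (ContinuousLinearMap.fst ℝ ℝ (ℝ × Plane)).comp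
    (ContinuousLinearMap.snd ℝ ℝ (ℝ × ℝ × Plane))
  have h1 := ((b.hasFDerivAt.comp_hasDerivWithinAt u ct).mul (cs.lieInner ce)).sub
    ((b.hasFDerivAt.comp_hasDerivWithinAt u cs).mul (ct.lieInner ce))
  have h2 := ((h.contDiffOn_familyVec c).hasDerivWithinAt hu).lieInner ce
  have es : lieInner (comb (fun j => s j u) c.rep) e = 0 := by
    simp [lieInner_comb_left, hs]
  have et : lieInner (comb (fun j => t j u) c.rep) e = 0 := by
    simp [lieInner_comb_left, ht]
  have h3 : (fun v => lieInner (familyVec s t c v) e) = fun v =>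
      b (comb (fun j => t j v) c.rep) * lieInner (comb (fun j => s j v) c.rep) e -
      b (comb (fun j => s j v) c.rep) * lieInner (comb (fun j => t j v) c.rep) e := by
    ext v
    rw [familyVec, pointVec, lieInner_sub_left, lieInner_smul_left, lieInner_smul_left]
    rfl
  rw [h3] at h2
  have h4 := (hU u hu).eq_deriv _ h1 h2
  obtain ⟨r, hr⟩ := h.derivWithin_familyVec hU c hu h0
  have hp : lieInner (pointLift (familyPoint s t c u)) e = 0 :=
    lieInner_eq_zero_of_mem_span_pair (h.pointLift_mem c hu h0) es et
  rw [hr, hd] at h4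
  simp only [Function.comp_apply, es, et, lieInner_zero_right, lieInner_add_left,
    lieInner_smul_left, hp, derivWithin_comb_const hU h.smooth_left c.rep hu,
    derivWithin_comb_const hU h.smooth_right c.rep hu] at h4
  have hz : lieInner ((0, 0, ⟪familyPoint s t c u, (0 : Plane)⟫, 0) : LieSpace) e = 0 := by
    simp [lieInner]
  rw [hz] at h4
  simpa [b] using h4

theorem eventually_isRegularPoint (hU : UniqueDiffOn ℝ I) {x₀ x₁ : ℝ → Plane}
    (hx₀ : ContinuousOn x₀ I) (hx₁ : ContinuousOn x₁ I)
    (c : Projectivization ℝ (Fin 2 → ℝ)) {u : ℝ} (hu : u ∈ I)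
    (hr : IsRegularPoint I x₀ x₁ (ribaucourFamily s t c) (familyPoint s t c) u) :
    ∀ᶠ v in 𝓝[I] u, IsRegularPoint I x₀ x₁ (ribaucourFamily s t c) (familyPoint s t c) v := by
  have h0 : (familyVec s t c u).1 ≠ 0 := fun h0 => hr.finite ((h.infinityVec_mem_iff c hu).2 h0)
  have hy := h.contDiffWithinAt_familyPoint c hu h0
  have hy' : ContDiffWithinAt ℝ 0 (derivWithin (familyPoint s t c) I) I u :=
    hy.derivWithin hU (by simp) hu
  filter_upwards [self_mem_nhdsWithin, h.eventually_fst_ne_zero c hu h0,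
    hy'.continuousWithinAt.eventually_ne hr.immersed,
    (hy.continuousWithinAt.sub (hx₀ u hu)).eventually_ne (sub_ne_zero.2 hr.ne₀),
    (hy.continuousWithinAt.sub (hx₁ u hu)).eventually_ne (sub_ne_zero.2 hr.ne₁)]
    with v hv h1 h2 h3 h4
  exact ⟨fun hq => h1 ((h.infinityVec_mem_iff c hv).1 hq), h2, sub_ne_zero.1 h3, sub_ne_zero.1 h4⟩

theorem encard_mem_le_one {u : ℝ} (hu : u ∈ I) {z : LieSpace} (hz : z ≠ 0) :
    {c | z ∈ ribaucourFamily s t c u}.encard ≤ 1 :=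
  encard_le_one_iff.2 fun _ _ hc hc' => h.eq_of_mem hu hz hc hc'

theorem encard_not_regular_le_five (hU : UniqueDiffOn ℝ I) {x₀ n₀ x₁ : ℝ → Plane}
    (hx₀ : Ribaucour.IsFramedCurve I x₀ n₀) (hx₁ : ContinuousOn x₁ I)
    (h₀ : ∀ u ∈ I, span ℝ {s 0 u, s 1 u} = legendreLift x₀ n₀ u) {u : ℝ} (hu : u ∈ I) :
    {c | ¬ ∀ᶠ v in 𝓝[I] u, IsRegularPoint I x₀ x₁ (ribaucourFamily s t c)
      (familyPoint s t c) v}.encard ≤ 5 := by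
  obtain ⟨e, hs, ht, he⟩ := h.exists_normal hx₀ hu (h₀ u hu)
  obtain ⟨f, sf, hf⟩ := h.exists_coefficients hx₀.contDiffOn_pointLift fun v hv => by
    rw [h₀ v hv]; exact subset_span (by simp)
  set A := (t 0 u).2.1 * lieInner (derivWithin (s 0) I u) e -
    (s 0 u).2.1 * lieInner (derivWithin (t 0) I u) e with hA
  set C := (t 1 u).2.1 * lieInner (derivWithin (s 1) I u) e -
    (s 1 u).2.1 * lieInner (derivWithin (t 1) I u) e with hC
  set B := (t 0 u).2.1 * lieInner (derivWithin (s 1) I u) e +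
    (t 1 u).2.1 * lieInner (derivWithin (s 0) I u) e -
    (s 0 u).2.1 * lieInner (derivWithin (t 1) I u) e -
    (s 1 u).2.1 * lieInner (derivWithin (t 0) I u) e with hB
  have hQ : ∀ a : Fin 2 → ℝ, A * a 0 ^ 2 + B * (a 0 * a 1) + C * a 1 ^ 2 =
      (comb (fun j => t j u) a).2.1 * lieInner (comb (fun j => derivWithin (s j) I u) a) e -
      (comb (fun j => s j u) a).2.1 * lieInner (comb (fun j => derivWithin (t j) I u) a) e := by
    intro a
    rw [lieInner_comb_left, lieInner_comb_left]
    simp only [comb, Prod.snd_add, Prod.smul_snd, Prod.fst_add, Prod.smul_fst, smul_eq_mul,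
      hA, hB, hC]
    ring
  -- The parameter of the member through the lift of x₀(u). One p-component vanishes there, the
  -- other does not, and the remaining factor is the product of ξ₀' with `e`.
  have hd : A * f 0 u ^ 2 + B * (f 0 u * f 1 u) + C * f 1 u ^ 2 ≠ 0 := by
    have := hQ (fun j => f j u)
    rw [this]
    have hfu : (fun j => f j u) ≠ 0 := fun h0 => pointLift_ne_zero (x₀ u) (by
      rw [hf u hu, h0, comb_zero])
    have hb : (comb (fun j => s j u) (fun j => f j u)).2.1 = 0 := by rw [← hf u hu]; rfl
    have hb' := (snd_ne_zero_of_isNullPlane ((h.hyperbolic u hu).isNullPlane hfu)).resolve_left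
      (not_not.2 hb)
    have hder := derivWithin_comb hU h.smooth_left sf hu
    rw [← derivWithin_congr hf (hf u hu), (hasDerivWithinAt_pointLift
      (hx₀.smooth_curve.hasDerivWithinAt hu)).derivWithin (hU u hu)] at hder
    rw [hder, lieInner_add_left, lieInner_comb_left (fun j => s j u), hs, hs] at he
    rw [hb]
    simpa [hb'] using he
  have hsub : {c | ¬ ∀ᶠ v in 𝓝[I] u, IsRegularPoint I x₀ x₁ (ribaucourFamily s t c)
      (familyPoint s t c) v} ⊆ {c | infinityVec ∈ ribaucourFamily s t c u} ∪
        {c | pointLift (x₀ u) ∈ ribaucourFamily s t c u} ∪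
        {c | pointLift (x₁ u) ∈ ribaucourFamily s t c u} ∪
        {c : Projectivization ℝ (Fin 2 → ℝ) |
          A * c.rep 0 ^ 2 + B * (c.rep 0 * c.rep 1) + C * c.rep 1 ^ 2 = 0} := by
    intro c hc
    by_contra hnot
    simp only [mem_union, mem_ofPred_eq, not_or] at hnot
    obtain ⟨⟨⟨n1, n2⟩, n3⟩, n4⟩ := hnot
    have h0 : (familyVec s t c u).1 ≠ 0 := fun h0 => n1 ((h.infinityVec_mem_iff c hu).2 h0)
    have hm := h.pointLift_mem c hu h0
    refine hc (h.eventually_isRegularPoint hU hx₀.smooth_curve.continuousOn hx₁ c hu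
      ⟨n1, fun hd => n4 ?_, fun he => n2 (he ▸ hm), fun he => n3 (he ▸ hm)⟩)
    rw [hQ]
    exact h.lieInner_deriv_eq_zero hU c hu h0 hd hs ht
  calc _ ≤ _ := encard_le_encard hsub
    _ ≤ 1 + 1 + 1 + 2 := (encard_union_le _ _).trans (add_le_add ((encard_union_le _ _).trans
        (add_le_add ((encard_union_le _ _).trans (add_le_add
          (h.encard_mem_le_one hu infinityVec_ne_zero)
          (h.encard_mem_le_one hu (pointLift_ne_zero _))))
          (h.encard_mem_le_one hu (pointLift_ne_zero _))))
        (encard_zeros_quadratic_le_two (d := fun j => f j u) hd))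
    _ = 5 := by norm_num

/-- Outside the countable union of the exceptional sets over a countable dense subset of `I`, a
member is regular on that subset. -/
theorem countable_not_dense_regular (hU : UniqueDiffOn ℝ I) {x₀ n₀ x₁ : ℝ → Plane}
    (hx₀ : Ribaucour.IsFramedCurve I x₀ n₀) (hx₁ : ContinuousOn x₁ I)
    (h₀ : ∀ u ∈ I, span ℝ {s 0 u, s 1 u} = legendreLift x₀ n₀ u) :
    {c | ¬ I ⊆ closure {u ∈ I | IsRegularPoint I x₀ x₁ (ribaucourFamily s t c)
      (familyPoint s t c) u}}.Countable := by
  obtain ⟨Q, hQI, hQ, hQd⟩ :=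
    (TopologicalSpace.IsSeparable.of_separableSpace I).exists_countable_dense_subset
  refine (hQ.biUnion (t := fun u _ => {c | ¬ ∀ᶠ v in 𝓝[I] u,
    IsRegularPoint I x₀ x₁ (ribaucourFamily s t c) (familyPoint s t c) v}) fun u hu =>
    (finite_of_encard_le_coe (k := 5)
      (h.encard_not_regular_le_five hU hx₀ hx₁ h₀ (hQI hu))).countable).mono ?_
  intro c hc
  by_contra hnot
  simp only [mem_iUnion, mem_ofPred_eq, not_exists, not_not] at hnot
  exact hc (hQd.trans (closure_mono fun u hu =>
    ⟨hQI hu, (hnot u hu).self_of_nhdsWithin (hQI hu)⟩))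

end IsParallelFrame

end Regular

theorem exists_parallelFrame_legendreLift {I : Set ℝ} (hI : I.OrdConnected) (hn : I.Nontrivial)
    {x₀ n₀ x₁ n₁ : ℝ → Plane} (hx₀ : Ribaucour.IsFramedCurve I x₀ n₀)
    (hx₁ : Ribaucour.IsFramedCurve I x₁ n₁)
    (hd : ∀ u ∈ I, Disjoint (legendreLift x₀ n₀ u) (legendreLift x₁ n₁ u)) :
    ∃ s t, IsParallelFrame I s t ∧ (∀ u ∈ I, span ℝ {s 0 u, s 1 u} = legendreLift x₀ n₀ u) ∧
      ∀ u ∈ I, span ℝ {t 0 u, t 1 u} = legendreLift x₁ n₁ u := by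
  obtain ⟨s, t, h, hst⟩ := exists_parallelFrame hI hn
    (σ := ![fun u => pointLift (x₀ u), fun u => lineLift (x₀ u) (n₀ u)])
    (τ := ![fun u => pointLift (x₁ u), fun u => lineLift (x₁ u) (n₁ u)])
    (fun j => by
      fin_cases j
      exacts [hx₀.contDiffOn_pointLift, hx₀.contDiffOn_lineLift])
    (fun j => by
      fin_cases j
      exacts [hx₁.contDiffOn_pointLift, hx₁.contDiffOn_lineLift])
    (fun u hu => hx₀.isNullPlane_legendreLift hu) (fun u hu => hx₁.isNullPlane_legendreLift hu) hd
  exact ⟨s, t, h, fun u hu => (hst u hu).1, fun u hu => (hst u hu).2⟩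

/-! ### The second intersection of two circles, in complex notation. -/

section SecondIntersection

open ComplexConjugate

theorem im_mul_conj_eq_zero_iff {v : ℂ} (hv : v ≠ 0) (u : ℂ) :
    (u * conj v).im = 0 ↔ ∃ r : ℝ, u = r * v := by
  constructor
  · intro h
    refine ⟨(u / v).re, ?_⟩
    have h1 : (u / v).im = 0 := by
      have : u / v = u * conj v / (Complex.normSq v : ℂ) := by
        rw [Complex.normSq_eq_conj_mul_self]
        have := (map_ne_zero (starRingEnd ℂ)).2 hv
        field_simp
      rw [this, Complex.div_ofReal_im, h, zero_div]
    have h2 : ((u / v).re : ℂ) = u / v := Complex.ext (by simp) (by simp [h1])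
    rw [h2]; field_simp
  · rintro ⟨r, rfl⟩
    simp [Complex.mul_im, Complex.mul_re]; ring

/-- The points `a`, `b`, `y`, `z` have a real cross ratio, that is, they are concircular. -/
def Concircular (a b y z : ℂ) : Prop := ((a - y) * (b - z) * conj ((b - y) * (a - z))).im = 0

theorem concircular_comm {a b y z : ℂ} : Concircular a b y z ↔ Concircular a b z y := by
  unfold Concircular
  have : (a - z) * (b - y) * conj ((b - z) * (a - y)) =
      conj ((a - y) * (b - z) * conj ((b - y) * (a - z))) := by
    simp only [map_mul, Complex.conj_conj]; ring
  rw [this, Complex.conj_im, neg_eq_zero]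

/-- The direction of the line into which the circle through `a`, `b` and `y` is transformed by the
inversion `x ↦ 1 / (x - y)`. -/
noncomputable def chordDir (a b y : ℂ) : ℂ := (b - y)⁻¹ - (a - y)⁻¹

/-- The position of the line into which the circle through `a`, `b` and `y` is transformed by the
inversion `x ↦ 1 / (x - y)`. -/
noncomputable def chordPos (a b y : ℂ) : ℝ := ((a - y)⁻¹ * conj (chordDir a b y)).im

/-- Inversion at `y` sends the circle through `a`, `b`, `y` to the line through the images of `a`
and `b`; the right side is the equation of this line. -/
theorem concircular_iff {a b y z : ℂ} (ha : y ≠ a) (hb : y ≠ b) (hz : z ≠ y) :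
    Concircular a b y z ↔ ((z - y)⁻¹ * conj (chordDir a b y)).im = chordPos a b y := by
  set p := (a - y)⁻¹ with hp
  set q := (b - y)⁻¹ with hq
  set w := (z - y)⁻¹ with hw
  have hp0 : p ≠ 0 := inv_ne_zero (sub_ne_zero.2 ha.symm)
  have hq0 : q ≠ 0 := inv_ne_zero (sub_ne_zero.2 hb.symm)
  have hw0 : w ≠ 0 := inv_ne_zero (sub_ne_zero.2 hz)
  have e1 : a - y = p⁻¹ := (inv_inv _).symm
  have e2 : b - y = q⁻¹ := (inv_inv _).symm
  have e3 : z - y = w⁻¹ := (inv_inv _).symm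
  have e4 : a - z = p⁻¹ - w⁻¹ := by rw [← e1, ← e3]; ring
  have e5 : b - z = q⁻¹ - w⁻¹ := by rw [← e2, ← e3]; ring
  have key : (a - y) * (b - z) * conj ((b - y) * (a - z)) =
      (Complex.normSq (p * q * w)⁻¹ : ℂ) * ((w - q) * conj (w - p)) := by
    rw [← Complex.mul_conj, e1, e2, e4, e5]
    have h1 : p⁻¹ * (q⁻¹ - w⁻¹) = (p * q * w)⁻¹ * (w - q) := by field_simp
    have h2 : q⁻¹ * (p⁻¹ - w⁻¹) = (p * q * w)⁻¹ * (w - p) := by field_simp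
    rw [h1, h2, map_mul]; ring
  unfold Concircular
  have hn : Complex.normSq (p * q * w)⁻¹ ≠ 0 := by simp [hp0, hq0, hw0]
  rw [key, Complex.im_ofReal_mul, mul_eq_zero, or_iff_right hn, ← sub_eq_zero (b := chordPos a b y)]
  suffices ((w - q) * conj (w - p)).im = (w * conj (q - p)).im - (p * conj (q - p)).im by
    rw [this]; rfl
  simp only [Complex.mul_im, Complex.conj_re, Complex.conj_im, Complex.sub_re, Complex.sub_im]
  ring

theorem solve_im_mul_conj {u v w : ℂ} (hD : (u * conj v).im ≠ 0) (k l : ℝ) :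
    ((w * conj u).im = k ∧ (w * conj v).im = l) ↔
      w = (l * u - k * v) / ((u * conj v).im : ℂ) := by
  rw [eq_div_iff (by exact_mod_cast hD)]
  simp only [Complex.mul_im, Complex.conj_re, Complex.conj_im, Complex.ext_iff, Complex.mul_re,
    Complex.sub_re, Complex.sub_im, Complex.ofReal_re, Complex.ofReal_im] at hD ⊢
  constructor
  · rintro ⟨rfl, rfl⟩
    constructor <;> ring
  · rintro ⟨h1, h2⟩
    constructor
    · apply mul_right_cancel₀ hD
      linear_combination u.re * h2 - u.im * h1
    · apply mul_right_cancel₀ hD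
      linear_combination v.re * h2 - v.im * h1

/-- The determinant of the directions of the transformed circles through `a`, `b`, `y` and through
`c`, `d`, `y`. -/
noncomputable def chordDet (a b c d y : ℂ) : ℝ := (chordDir a b y * conj (chordDir c d y)).im

/-- The intersection of the lines into which the circles through `a`, `b`, `y` and through
`c`, `d`, `y` are transformed. -/
noncomputable def chordMeet (a b c d y : ℂ) : ℂ :=
  (chordPos c d y * chordDir a b y - chordPos a b y * chordDir c d y) / (chordDet a b c d y : ℂ)

/-- The second intersection of the circles through `a`, `b`, `y` and through `c`, `d`, `y`. -/
noncomputable def secondMeet (a b c d y : ℂ) : ℂ := y + (chordMeet a b c d y)⁻¹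

/-- The points `y` for which the second intersection is finite, and neither it nor `y` is one of
the given points. -/
structure IsGeneric (a b c d y : ℂ) : Prop where
  ne : y ≠ a ∧ y ≠ b ∧ y ≠ c ∧ y ≠ d
  det : chordDet a b c d y ≠ 0
  meet : chordMeet a b c d y ≠ 0
  second_ne : secondMeet a b c d y ≠ a ∧ secondMeet a b c d y ≠ b ∧ secondMeet a b c d y ≠ c ∧
    secondMeet a b c d y ≠ d

theorem concircular_and_iff_meet {a b c d y z : ℂ} (hy : y ≠ a ∧ y ≠ b ∧ y ≠ c ∧ y ≠ d)
    (hD : chordDet a b c d y ≠ 0) (hz : z ≠ y) :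
    (Concircular a b y z ∧ Concircular c d y z) ↔ (z - y)⁻¹ = chordMeet a b c d y := by
  rw [concircular_iff hy.1 hy.2.1 hz, concircular_iff hy.2.2.1 hy.2.2.2 hz,
    solve_im_mul_conj hD]
  rfl

theorem IsGeneric.secondMeet_ne {a b c d y : ℂ} (h : IsGeneric a b c d y) :
    secondMeet a b c d y ≠ y := by simp [secondMeet, h.meet]

theorem IsGeneric.concircular_and_iff {a b c d y z : ℂ} (h : IsGeneric a b c d y) (hz : z ≠ y) :
    (Concircular a b y z ∧ Concircular c d y z) ↔ z = secondMeet a b c d y := by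
  rw [concircular_and_iff_meet h.ne h.det hz, secondMeet]
  constructor
  · intro e; rw [← e]; simp
  · rintro rfl; simp

/-- The product equals (r - 1)² / r for the real cross ratio r. It compares the directions after
inversion at the two intersection points, so circles transversal at one are transversal at the
other. -/
theorem exists_chordDir_mul {a b y z : ℂ} (hab : a ≠ b) (ha : y ≠ a) (hb : y ≠ b) (hz : z ≠ y)
    (hza : z ≠ a) (hzb : z ≠ b) (h : Concircular a b y z) :
    ∃ k : ℝ, k ≠ 0 ∧ chordDir a b z * chordDir a b y * (z - y) ^ 2 = k := by
  have n1 : a - y ≠ 0 := sub_ne_zero.2 ha.symm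
  have n2 : b - y ≠ 0 := sub_ne_zero.2 hb.symm
  have n3 : a - z ≠ 0 := sub_ne_zero.2 hza.symm
  have n4 : b - z ≠ 0 := sub_ne_zero.2 hzb.symm
  obtain ⟨r, hr⟩ := (im_mul_conj_eq_zero_iff (mul_ne_zero n2 n3) _).1 h
  have hr0 : (r : ℂ) ≠ 0 := by
    intro h0
    rw [h0, zero_mul] at hr
    exact mul_ne_zero n1 n4 hr
  have hid : (a - b) * (y - z) = (r - 1) * ((b - y) * (a - z)) := by linear_combination hr
  have hr1 : (r : ℂ) - 1 ≠ 0 := by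
    intro h1
    rw [h1, zero_mul] at hid
    exact mul_ne_zero (sub_ne_zero.2 hab) (sub_ne_zero.2 hz.symm) hid
  refine ⟨(r - 1) ^ 2 / r, ?_, ?_⟩
  · exact div_ne_zero (pow_ne_zero 2 (by exact_mod_cast hr1)) (by exact_mod_cast hr0)
  · push_cast
    rw [chordDir, chordDir, inv_sub_inv n4 n3, inv_sub_inv n2 n1, eq_div_iff hr0]
    have : (a - z - (b - z)) / ((b - z) * (a - z)) * ((a - y - (b - y)) / ((b - y) * (a - y))) *
        (z - y) ^ 2 = ((a - b) * (y - z)) ^ 2 / (((a - y) * (b - z)) * ((b - y) * (a - z))) := by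
      field_simp; ring
    rw [this, hid, hr]
    field_simp

theorem chordDir_ne_zero {a b y : ℂ} (hab : a ≠ b) (ha : y ≠ a) (hb : y ≠ b) :
    chordDir a b y ≠ 0 := by
  rw [chordDir, inv_sub_inv (sub_ne_zero.2 hb.symm) (sub_ne_zero.2 ha.symm)]
  refine div_ne_zero (fun h => hab (by linear_combination h))
    (mul_ne_zero (sub_ne_zero.2 hb.symm) (sub_ne_zero.2 ha.symm))

theorem IsGeneric.chordDet_secondMeet {a b c d y : ℂ} (hab : a ≠ b) (hcd : c ≠ d)
    (h : IsGeneric a b c d y) : chordDet a b c d (secondMeet a b c d y) ≠ 0 := by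
  obtain ⟨hc₀, hc₁⟩ := (h.concircular_and_iff h.secondMeet_ne).2 rfl
  have hz := h.secondMeet_ne
  have hs := h.second_ne
  set z := secondMeet a b c d y
  obtain ⟨k, hk, ek⟩ := exists_chordDir_mul hab h.ne.1 h.ne.2.1 hz hs.1 hs.2.1 hc₀
  obtain ⟨l, hl, el⟩ := exists_chordDir_mul hcd h.ne.2.2.1 h.ne.2.2.2 hz hs.2.2.1 hs.2.2.2 hc₁
  intro h0
  obtain ⟨r, hr⟩ := (im_mul_conj_eq_zero_iff (chordDir_ne_zero hcd hs.2.2.1 hs.2.2.2) _).1 h0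
  refine h.det ?_
  have hA := chordDir_ne_zero hcd h.ne.2.2.1 h.ne.2.2.2
  have hr0 : (r : ℂ) ≠ 0 := by
    intro hr0
    rw [hr0, zero_mul] at hr
    exact chordDir_ne_zero hab hs.1 hs.2.1 hr
  have hl0 : (l : ℂ) ≠ 0 := by exact_mod_cast hl
  refine (im_mul_conj_eq_zero_iff hA _).2 ⟨k / (r * l), ?_⟩
  push_cast
  rw [div_mul_eq_mul_div, eq_div_iff (mul_ne_zero hr0 hl0), ← ek, ← el, hr]
  ring

/-- Concircularity is symmetric in `y` and `z`, and transversality carries over to `z`, so the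
construction started at `z` returns `y`. -/
theorem IsGeneric.secondMeet_secondMeet {a b c d y : ℂ} (hab : a ≠ b) (hcd : c ≠ d)
    (h : IsGeneric a b c d y) : IsGeneric a b c d (secondMeet a b c d y) ∧
      secondMeet a b c d (secondMeet a b c d y) = y := by
  have hz := h.secondMeet_ne
  have hD := h.chordDet_secondMeet hab hcd
  have hc := (h.concircular_and_iff hz).2 rfl
  rw [concircular_comm, concircular_comm (a := c),
    concircular_and_iff_meet h.second_ne hD hz.symm] at hc
  have e : secondMeet a b c d (secondMeet a b c d y) = y := by
    rw [secondMeet, ← hc]; simp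
  exact ⟨⟨h.second_ne, hD, by rw [← hc]; exact inv_ne_zero (sub_ne_zero.2 hz.symm),
    by rw [e]; exact h.ne⟩, e⟩

section Smooth

theorem contDiffAt_chordDir {a b y : ℂ} (ha : y ≠ a) (hb : y ≠ b) :
    ContDiffAt ℝ ∞ (chordDir a b) y :=
  ((contDiffAt_const.sub contDiffAt_id).inv (sub_ne_zero.2 hb.symm)).sub
    ((contDiffAt_const.sub contDiffAt_id).inv (sub_ne_zero.2 ha.symm))

theorem ContDiffAt.im_mul_conj {f g : ℂ → ℂ} {y : ℂ} (hf : ContDiffAt ℝ ∞ f y)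
    (hg : ContDiffAt ℝ ∞ g y) : ContDiffAt ℝ ∞ (fun y => (f y * conj (g y)).im) y :=
  Complex.imCLM.contDiff.contDiffAt.comp y
    (hf.mul (Complex.conjCLE.contDiff.contDiffAt.comp y hg))

theorem contDiffAt_chordPos {a b y : ℂ} (ha : y ≠ a) (hb : y ≠ b) :
    ContDiffAt ℝ ∞ (chordPos a b) y :=
  ContDiffAt.im_mul_conj ((contDiffAt_const.sub contDiffAt_id).inv (sub_ne_zero.2 ha.symm))
    (contDiffAt_chordDir ha hb)

theorem contDiffAt_chordDet {a b c d y : ℂ} (hy : y ≠ a ∧ y ≠ b ∧ y ≠ c ∧ y ≠ d) :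
    ContDiffAt ℝ ∞ (chordDet a b c d) y :=
  ContDiffAt.im_mul_conj (contDiffAt_chordDir hy.1 hy.2.1)
    (contDiffAt_chordDir hy.2.2.1 hy.2.2.2)

theorem contDiffAt_chordMeet {a b c d y : ℂ} (hy : y ≠ a ∧ y ≠ b ∧ y ≠ c ∧ y ≠ d)
    (hD : chordDet a b c d y ≠ 0) : ContDiffAt ℝ ∞ (chordMeet a b c d) y := by
  have h1 := contDiffAt_chordPos hy.1 hy.2.1
  have h2 := contDiffAt_chordPos hy.2.2.1 hy.2.2.2
  have h3 := contDiffAt_chordDir hy.1 hy.2.1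
  have h4 := contDiffAt_chordDir hy.2.2.1 hy.2.2.2
  have ho : ContDiff ℝ ∞ (fun r : ℝ => (r : ℂ)) := Complex.ofRealCLM.contDiff
  have h5 := (ho.contDiffAt.comp y (contDiffAt_chordDet hy)).inv (by simpa using hD)
  have h6 := (((ho.contDiffAt.comp y h2).mul h3).sub ((ho.contDiffAt.comp y h1).mul h4)).mul h5
  refine h6.congr_of_eventuallyEq (Filter.Eventually.of_forall fun z => ?_)
  simp [chordMeet, div_eq_mul_inv]

theorem contDiffAt_secondMeet {a b c d y : ℂ} (hy : y ≠ a ∧ y ≠ b ∧ y ≠ c ∧ y ≠ d)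
    (hD : chordDet a b c d y ≠ 0) (hM : chordMeet a b c d y ≠ 0) :
    ContDiffAt ℝ ∞ (secondMeet a b c d) y :=
  contDiffAt_id.add ((contDiffAt_chordMeet hy hD).inv hM)

theorem isOpen_isGeneric (a b c d : ℂ) : IsOpen {y | IsGeneric a b c d y} := by
  rw [isOpen_iff_mem_nhds]
  intro y h
  have c0 : ContinuousAt (fun y : ℂ => y) y := continuousAt_id
  have c1 := (contDiffAt_chordDet h.ne).continuousAt
  have c2 := (contDiffAt_chordMeet h.ne h.det).continuousAt
  have c3 := (contDiffAt_secondMeet h.ne h.det h.meet).continuousAt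
  filter_upwards [c0.eventually_ne h.ne.1, c0.eventually_ne h.ne.2.1, c0.eventually_ne h.ne.2.2.1,
    c0.eventually_ne h.ne.2.2.2, c1.eventually_ne h.det, c2.eventually_ne h.meet,
    c3.eventually_ne h.second_ne.1, c3.eventually_ne h.second_ne.2.1,
    c3.eventually_ne h.second_ne.2.2.1, c3.eventually_ne h.second_ne.2.2.2]
    with z z1 z2 z3 z4 z5 z6 z7 z8 z9 z10
  exact ⟨⟨z1, z2, z3, z4⟩, z5, z6, z7, z8, z9, z10⟩

end Smooth

/-! ### Generic points form a residual set. -/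

section Dense

/-- A real analytic function on the plane that vanishes on a nonempty open set vanishes everywhere.
At the given `y` the value is k |g(y)|², which is not zero. -/
theorem dense_im_mul_conj_ne_zero {f g : ℂ → ℂ} (hf : AnalyticOnNhd ℝ f univ)
    (hg : AnalyticOnNhd ℝ g univ) {y : ℂ} {k : ℝ} (hk : k ≠ 0) (hy : f y = k * Complex.I * g y)
    (hgy : g y ≠ 0) : {y | (f y * conj (g y)).im ≠ 0} ∈ residual ℂ := by
  have ha : AnalyticOnNhd ℝ (fun y => (f y * conj (g y)).im) univ := fun z hz =>
    Complex.imCLM.analyticAt _ |>.comp ((hf z hz).mul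
      ((Complex.conjCLE : ℂ →L[ℝ] ℂ).analyticAt _ |>.comp (hg z hz)))
  refine residual_of_dense_open ?_ ?_
  · exact isOpen_ne_fun (continuousOn_univ.1 ha.continuousOn) continuous_const
  · rw [dense_iff_inter_open]
    intro O hO ⟨z, hz⟩
    by_contra hne
    have hev : (fun y => (f y * conj (g y)).im) =ᶠ[𝓝 z] 0 := by
      filter_upwards [hO.mem_nhds hz] with x hx
      by_contra hx'
      exact hne ⟨x, hx, hx'⟩
    have h0 := ha.eqOn_zero_of_preconnected_of_eventuallyEq_zero isPreconnected_univ
      (mem_univ z) hev (mem_univ y)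
    simp only [hy, mul_assoc, Complex.mul_conj, Pi.zero_apply] at h0
    simp [hk, hgy] at h0

/-- Provides a `k` for which the polynomial equation f = k i g has nonzero leading coefficient,
hence a root. -/
theorem exists_real_mul_I_ne (u v : ℂ) (hv : v ≠ 0) : ∃ k : ℝ, k ≠ 0 ∧ u ≠ k * Complex.I * v := by
  by_cases h : u = (1 : ℝ) * Complex.I * v
  · refine ⟨2, by norm_num, fun h' => hv ?_⟩
    have : Complex.I * v = 0 := by rw [h] at h'; push_cast at h'; linear_combination -h'
    simpa using this
  · exact ⟨1, one_ne_zero, h⟩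

theorem residual_linear {u v c d : ℂ} (hu : u ≠ 0) (hv : v ≠ 0) (hcd : c ≠ d) :
    {y | ((c - y) * u * conj ((d - y) * v)).im ≠ 0} ∈ residual ℂ := by
  obtain ⟨k, hk, hne⟩ := exists_real_mul_I_ne u v hv
  have hne' := sub_ne_zero.2 hne
  set y := (c * u - k * Complex.I * v * d) / (u - k * Complex.I * v) with hy
  have e : (c - y) * u = k * Complex.I * ((d - y) * v) := by
    have : y * (u - k * Complex.I * v) = c * u - k * Complex.I * v * d := by
      rw [hy]; field_simp
    linear_combination -this
  refine dense_im_mul_conj_ne_zero (f := fun y => (c - y) * u) (g := fun y => (d - y) * v)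
    (fun z _ => by fun_prop) (fun z _ => by fun_prop) hk e ?_
  intro h0
  rw [h0, mul_zero] at e
  have h1 : d = y := sub_eq_zero.1 ((mul_eq_zero.1 h0).resolve_right hv)
  have h2 : c = y := sub_eq_zero.1 ((mul_eq_zero.1 e).resolve_right hu)
  exact hcd (h2.trans h1.symm)

theorem residual_quadratic {a b c d : ℂ} (hab : a ≠ b) (hac : a ≠ c) (had : a ≠ d) (hbc : b ≠ c)
    (hbd : b ≠ d) (hcd : c ≠ d) :
    {y | ((a - b) * ((d - y) * (c - y)) * conj ((c - d) * ((b - y) * (a - y)))).im ≠ 0} ∈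
      residual ℂ := by
  have hu := sub_ne_zero.2 hab
  have hv := sub_ne_zero.2 hcd
  obtain ⟨k, hk, hne⟩ := exists_real_mul_I_ne (a - b) (c - d) hv
  obtain ⟨y, hy⟩ := exists_quadratic_eq_zero (sub_ne_zero.2 hne)
    (b := -((a - b) * (c + d)) + k * Complex.I * (c - d) * (a + b))
    (c := (a - b) * (c * d) - k * Complex.I * (c - d) * (a * b))
    (by
      obtain ⟨s, hs⟩ := IsAlgClosed.exists_pow_nat_eq (discrim (a - b - k * Complex.I * (c - d))
        (-((a - b) * (c + d)) + k * Complex.I * (c - d) * (a + b))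
        ((a - b) * (c * d) - k * Complex.I * (c - d) * (a * b))) (n := 2) (by norm_num)
      exact ⟨s, by rw [← hs, sq]⟩)
  have e : (a - b) * ((d - y) * (c - y)) = k * Complex.I * ((c - d) * ((b - y) * (a - y))) := by
    linear_combination hy
  refine dense_im_mul_conj_ne_zero (f := fun y => (a - b) * ((d - y) * (c - y)))
    (g := fun y => (c - d) * ((b - y) * (a - y))) (fun z _ => by fun_prop) (fun z _ => by fun_prop) hk e ?_
  intro h0
  rw [h0, mul_zero] at e
  have h1 := (mul_eq_zero.1 h0).resolve_left hv
  have h2 := (mul_eq_zero.1 e).resolve_left hu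
  -- If g vanished at the root, so would f, and the root would be one of `a`, `b` and also one of
  -- `c`, `d`.
  simp only [mul_eq_zero, sub_eq_zero] at h1 h2
  rcases h1 with rfl | rfl <;> rcases h2 with h2 | h2 <;> simp_all

theorem residual_isGeneric {a b c d : ℂ} (hab : a ≠ b) (hac : a ≠ c) (had : a ≠ d) (hbc : b ≠ c)
    (hbd : b ≠ d) (hcd : c ≠ d) : {y | IsGeneric a b c d y} ∈ residual ℂ := by
  have hp : ∀ p : ℂ, {y | y ≠ p} ∈ residual ℂ := fun p =>
    residual_of_dense_open isOpen_ne (dense_compl_singleton p)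
  have sb : ∀ {p q : ℂ}, p ≠ q → q - p ≠ 0 := fun h => sub_ne_zero.2 h.symm
  filter_upwards [hp a, hp b, hp c, hp d, residual_quadratic hab hac had hbc hbd hcd,
    residual_linear (one_ne_zero (α := ℂ)) one_ne_zero hab.symm,
    residual_linear (sb had) (sb hac) hcd, residual_linear (sb hbd) (sb hbc) hcd,
    residual_linear (sb hbc.symm) (sb hac.symm) hab,
    residual_linear (sb hbd.symm) (sb had.symm) hab] with y ya yb yc yd h1 h2 h3 h4 h5 h6
  have na := sub_ne_zero.2 (Ne.symm ya)
  have nb := sub_ne_zero.2 (Ne.symm yb)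
  have nc := sub_ne_zero.2 (Ne.symm yc)
  have nd := sub_ne_zero.2 (Ne.symm yd)
  have hy : y ≠ a ∧ y ≠ b ∧ y ≠ c ∧ y ≠ d := ⟨ya, yb, yc, yd⟩
  have hD : chordDet a b c d y ≠ 0 := by
    intro h0
    obtain ⟨r, hr⟩ := (im_mul_conj_eq_zero_iff (chordDir_ne_zero hcd yc yd) _).1 h0
    refine h1 ((im_mul_conj_eq_zero_iff (mul_ne_zero (sub_ne_zero.2 hcd)
      (mul_ne_zero nb na)) _).2 ⟨r, ?_⟩)
    rw [chordDir, chordDir, inv_sub_inv nb na, inv_sub_inv nd nc] at hr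
    field_simp at hr
    linear_combination hr
  -- If the transformed lines met at 0, the second intersection would be infinite and `y` collinear
  -- with `a` and `b`, which `h2` excludes.
  have hM : chordMeet a b c d y ≠ 0 := by
    intro h0
    obtain ⟨e, -⟩ := (solve_im_mul_conj hD (chordPos a b y) (chordPos c d y)).2 h0.symm
    rw [zero_mul, Complex.zero_im] at e
    obtain ⟨r, hr⟩ := (im_mul_conj_eq_zero_iff (chordDir_ne_zero hab ya yb) _).1 e.symm
    refine h2 ((im_mul_conj_eq_zero_iff (by simpa using na) _).2 ?_)
    rw [chordDir, inv_sub_inv nb na] at hr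
    field_simp at hr
    have hr1 : (1 : ℂ) + r ≠ 0 := fun h0 => na (by linear_combination (a - y) * h0 - (b - y) * h0 + hr)
    refine ⟨r / (1 + r), ?_⟩
    push_cast
    rw [div_mul_eq_mul_div, eq_div_iff hr1]
    linear_combination hr
  have hz : secondMeet a b c d y ≠ y := by simp [secondMeet, hM]
  have hc := (concircular_and_iff_meet hy hD hz).2 (by simp [secondMeet])
  refine ⟨hy, hD, hM, fun e => ?_, fun e => ?_, fun e => ?_, fun e => ?_⟩
  · rw [e] at hc; exact h3 hc.2
  · rw [e] at hc; exact h4 hc.2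
  · rw [e] at hc; exact h5 hc.1
  · rw [e] at hc; exact h6 hc.1

end Dense

end SecondIntersection

/-! ### Concircularity as linear dependence of lifts. -/

section Circular

/-- The plane as the complex line. -/
noncomputable def planeEquiv : Plane ≃ₗᵢ[ℝ] ℂ := Complex.orthonormalBasisOneI.repr.symm

theorem planeEquiv_re (x : Plane) : (planeEquiv x).re = x 0 := by
  simp [planeEquiv, ← Complex.orthonormalBasisOneI.sum_repr_symm]

theorem planeEquiv_im (x : Plane) : (planeEquiv x).im = x 1 := by
  simp [planeEquiv, ← Complex.orthonormalBasisOneI.sum_repr_symm]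

/-- The vectors orthogonal to `p` with given coordinates. -/
noncomputable def coordVec : (Fin 4 → ℝ) →ₗ[ℝ] LieSpace where
  toFun v := (v 0, 0, v 1, !₂[v 2, v 3])
  map_add' v w := by
    refine Prod.ext rfl (Prod.ext (by simp) (Prod.ext rfl ?_))
    ext i; fin_cases i <;> simp
  map_smul' r v := by
    refine Prod.ext rfl (Prod.ext (by simp) (Prod.ext rfl ?_))
    ext i; fin_cases i <;> simp

theorem ker_coordVec : LinearMap.ker coordVec = ⊥ := by
  rw [LinearMap.ker_eq_bot']
  intro v hv
  have h0 : v 0 = 0 := congrArg (fun z : LieSpace => z.1) hv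
  have h1 : v 1 = 0 := congrArg (fun z : LieSpace => z.2.2.1) hv
  have h2 : v 2 = 0 := congrArg (fun z : LieSpace => z.2.2.2 0) hv
  have h3 : v 3 = 0 := congrArg (fun z : LieSpace => z.2.2.2 1) hv
  ext i; fin_cases i <;> assumption

theorem pointLift_eq_coordVec (x : Plane) :
    pointLift x = coordVec ![1, (x 0 ^ 2 + x 1 ^ 2) / 2, x 0, x 1] := by
  refine Prod.ext rfl (Prod.ext rfl (Prod.ext ?_ ?_))
  · simp [pointLift, coordVec, EuclideanSpace.real_norm_sq_eq]
  · ext i; fin_cases i <;> simp [pointLift, coordVec]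

/-- The determinant of the four lifts is -1/2 times the imaginary part in `Concircular`. -/
theorem linearIndependent_pointLift_iff (a b y z : Plane) :
    LinearIndependent ℝ ![pointLift a, pointLift b, pointLift y, pointLift z] ↔
      ¬ Concircular (planeEquiv a) (planeEquiv b) (planeEquiv y) (planeEquiv z) := by
  set M : Matrix (Fin 4) (Fin 4) ℝ := !![1, (a 0 ^ 2 + a 1 ^ 2) / 2, a 0, a 1;
    1, (b 0 ^ 2 + b 1 ^ 2) / 2, b 0, b 1; 1, (y 0 ^ 2 + y 1 ^ 2) / 2, y 0, y 1;
    1, (z 0 ^ 2 + z 1 ^ 2) / 2, z 0, z 1] with hM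
  have h1 : ![pointLift a, pointLift b, pointLift y, pointLift z] = coordVec ∘ M.row := by
    ext1 i
    fin_cases i <;> exact pointLift_eq_coordVec _
  rw [h1, LinearMap.linearIndependent_iff _ ker_coordVec, Matrix.linearIndependent_rows_iff_isUnit,
    Matrix.isUnit_iff_isUnit_det, isUnit_iff_ne_zero, not_iff_not, Concircular]
  simp only [Complex.mul_im, Complex.mul_re, Complex.sub_re, Complex.sub_im, map_mul, map_sub,
    Complex.conj_re, Complex.conj_im, planeEquiv_re, planeEquiv_im]
  have hdet : M.det = -(((a 0 - y 0) * (b 0 - z 0) - (a 1 - y 1) * (b 1 - z 1)) *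
      -((b 0 - y 0) * (a 1 - z 1) + (b 1 - y 1) * (a 0 - z 0)) +
      ((a 0 - y 0) * (b 1 - z 1) + (a 1 - y 1) * (b 0 - z 0)) *
      ((b 0 - y 0) * (a 0 - z 0) - (b 1 - y 1) * (a 1 - z 1))) / 2 := by
    simp [hM, Matrix.det_succ_row_zero, Fin.sum_univ_succ, Fin.succAbove]
    ring
  rw [hdet]
  constructor
  · intro h
    linear_combination -2 * h
  · intro h
    linear_combination -h / 2

/-- The Gram matrix of the lifts has zero diagonal and nonzero other entries, hence nonzero
determinant. -/
theorem linearIndependent_pointLift_three {a b y : Plane} (hab : a ≠ b) (hay : a ≠ y)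
    (hby : b ≠ y) : LinearIndependent ℝ ![pointLift a, pointLift b, pointLift y] := by
  rw [Fintype.linearIndependent_iff]
  intro g hg
  simp only [Fin.sum_univ_three, Matrix.cons_val_zero, Matrix.cons_val_one, Matrix.cons_val] at hg
  have ea := congrArg (lieInner (pointLift a)) hg
  have eb := congrArg (lieInner (pointLift b)) hg
  have ey := congrArg (lieInner (pointLift y)) hg
  simp only [lieInner_add_right, lieInner_smul_right, lieInner_pointLift_pointLift,
    lieInner_zero_right, norm_sub_rev b a, norm_sub_rev y a, norm_sub_rev y b, sub_self,
    norm_zero] at ea eb ey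
  have n1 : ‖a - b‖ ≠ 0 := norm_ne_zero_iff.2 (sub_ne_zero.2 hab)
  have n2 : ‖a - y‖ ≠ 0 := norm_ne_zero_iff.2 (sub_ne_zero.2 hay)
  have n3 : ‖b - y‖ ≠ 0 := norm_ne_zero_iff.2 (sub_ne_zero.2 hby)
  have g2 : g 2 = 0 := by
    have : g 2 * (‖a - y‖ ^ 2 * ‖b - y‖ ^ 2) = 0 := by
      linear_combination ‖a - b‖ ^ 2 * ey - ‖a - y‖ ^ 2 * eb - ‖b - y‖ ^ 2 * ea
    simpa [n2, n3] using this
  have g1 : g 1 = 0 := by simpa [g2, n1] using ea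
  have g0 : g 0 = 0 := by simpa [g2, n1] using eb
  intro i
  fin_cases i <;> assumption

theorem finrank_span_pointLift_iff {a b y z : Plane} (hab : a ≠ b) (hay : y ≠ a) (hby : y ≠ b) :
    Module.finrank ℝ (span ℝ ({pointLift a, pointLift b, pointLift y, pointLift z} :
      Set LieSpace)) = 3 ↔
      Concircular (planeEquiv a) (planeEquiv b) (planeEquiv y) (planeEquiv z) := by
  rw [← not_iff_not, ← linearIndependent_pointLift_iff]
  have hr : range ![pointLift a, pointLift b, pointLift y, pointLift z] =
      {pointLift a, pointLift b, pointLift y, pointLift z} := by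
    ext v; simp; tauto
  rw [linearIndependent_iff_card_eq_finrank_span, Set.finrank, hr, Fintype.card_fin]
  have h4 := finrank_range_le_card (R := ℝ) ![pointLift a, pointLift b, pointLift y, pointLift z]
  rw [Set.finrank, hr, Fintype.card_fin] at h4
  have h3 := finrank_span_eq_card (linearIndependent_pointLift_three hab hay.symm hby.symm)
  have hle : span ℝ (range ![pointLift a, pointLift b, pointLift y]) ≤
      span ℝ {pointLift a, pointLift b, pointLift y, pointLift z} := by
    rw [span_le]
    rintro _ ⟨i, rfl⟩
    fin_cases i <;> exact subset_span (by simp)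
  have := Submodule.finrank_mono hle
  rw [h3, Fintype.card_fin] at this
  omega

end Circular

/-! ### Iteration of involutions of open dense sets. -/

section Iteration

/-- A smooth involution of an open dense set. -/
structure IsSmoothInvolution {X : Type*} [NormedAddCommGroup X] [NormedSpace ℝ X] (V : Set X)
    (T : X → X) : Prop where
  isOpen : IsOpen V
  dense : Dense V
  mapsTo : MapsTo T V V
  invol : ∀ y ∈ V, T (T y) = y
  smooth : ∀ y ∈ V, ContDiffAt ℝ ∞ T y

variable {X : Type*} [NormedAddCommGroup X] [NormedSpace ℝ X]

theorem isSmoothInvolution_id : IsSmoothInvolution (univ : Set X) id :=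
  ⟨isOpen_univ, dense_univ, mapsTo_id _, fun _ _ => rfl, fun _ _ => contDiffAt_id⟩

/-- `T` is its own inverse on `V`, so images are preimages. -/
theorem IsSmoothInvolution.isOpen_image {V : Set X} {T : X → X} (h : IsSmoothInvolution V T)
    {O : Set X} (hO : IsOpen O) (hOV : O ⊆ V) : IsOpen (T '' O) := by
  have : T '' O = V ∩ T ⁻¹' O := by
    ext z
    constructor
    · rintro ⟨y, hy, rfl⟩
      exact ⟨h.mapsTo (hOV hy), by rw [mem_preimage, h.invol y (hOV hy)]; exact hy⟩
    · rintro ⟨hz, hz'⟩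
      exact ⟨T z, hz', h.invol z hz⟩
  rw [this]
  exact ContinuousOn.isOpen_inter_preimage
    (fun y hy => (h.smooth y hy).continuousAt.continuousWithinAt) h.isOpen hO

/-- The composition of the first `n` maps of a sequence. -/
def iterSeq (T : ℕ → X → X) : ℕ → X → X
  | 0, y => y
  | n + 1, y => T n (iterSeq T n y)

/-- The points that the first `n` maps of a sequence keep in given sets. -/
def iterDom (V : ℕ → Set X) (T : ℕ → X → X) : ℕ → Set X
  | 0 => univ
  | n + 1 => iterDom V T n ∩ iterSeq T n ⁻¹' V n

theorem iterDom_properties {V : ℕ → Set X} {T : ℕ → X → X}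
    (h : ∀ n, IsSmoothInvolution (V n) (T n)) (n : ℕ) :
    (IsOpen (iterDom V T n) ∧ Dense (iterDom V T n) ∧
      ∀ y ∈ iterDom V T n, ContDiffAt ℝ ∞ (iterSeq T n) y) ∧
      ∀ O, IsOpen O → O ⊆ iterDom V T n → IsOpen (iterSeq T n '' O) := by
  induction n with
  | zero =>
    refine ⟨⟨isOpen_univ, dense_univ, fun y _ => contDiffAt_id⟩, fun O hO _ => ?_⟩
    have : iterSeq T 0 '' O = O := image_id O
    rwa [this]
  | succ n ih =>
    obtain ⟨⟨h1, h2, h3⟩, h4⟩ := ih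
    refine ⟨⟨?_, ?_, ?_⟩, ?_⟩
    · exact ContinuousOn.isOpen_inter_preimage
        (fun y hy => (h3 y hy).continuousAt.continuousWithinAt) h1 (h n).isOpen
    · rw [dense_iff_inter_open]
      intro O hO hne
      -- Density survives because the image of an open set under the first `n` maps is open and
      -- therefore meets the dense set `V n`.
      have hne' := h2.inter_open_nonempty O hO hne
      obtain ⟨_, ⟨y, hy, rfl⟩, hz⟩ := (h n).dense.inter_open_nonempty _
        (h4 _ (hO.inter h1) inter_subset_right) (hne'.image _)
      exact ⟨y, hy.1, hy.2, hz⟩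
    · intro y hy
      exact ((h n).smooth _ hy.2).comp y (h3 y hy.1)
    · intro O hO hOV
      have : iterSeq T (n + 1) '' O = T n '' (iterSeq T n '' O) := by
        rw [image_image]; rfl
      rw [this]
      refine (h n).isOpen_image (h4 O hO fun y hy => (hOV hy).1) ?_
      rintro _ ⟨y, hy, rfl⟩
      exact (hOV hy).2

/-- A sequence of involutions, indexed by the integers, can be iterated in both directions. -/
theorem exists_iteration {V : ℤ → Set X} {T : ℤ → X → X}
    (h : ∀ i, IsSmoothInvolution (V i) (T i)) (i₀ : ℤ) :
    ∃ (F : X → ℤ → X) (E : ℤ → Set X),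
      (∀ i, IsOpen (E i) ∧ Dense (E i) ∧ ∀ y ∈ E i, ContDiffAt ℝ ∞ (fun y' => F y' i) y) ∧
      (∀ y, F y i₀ = y) ∧
      (∀ i, i₀ ≤ i → ∀ y ∈ E (i + 1), F y i ∈ V i ∧ F y (i + 1) = T i (F y i)) ∧
      (∀ i, i < i₀ → ∀ y ∈ E i, F y (i + 1) ∈ V i ∧ F y i = T i (F y (i + 1))) := by
  set V₁ : ℕ → Set X := fun n => V (i₀ + n)
  set T₁ : ℕ → X → X := fun n => T (i₀ + n)
  -- The map with index `i` belongs to the edge from `i` to `i + 1`, so the n-th backward step, from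
  -- `i₀ - n`, uses index `i₀ - n - 1`.
  set V₂ : ℕ → Set X := fun n => V (i₀ - n - 1)
  set T₂ : ℕ → X → X := fun n => T (i₀ - n - 1)
  have p₁ := iterDom_properties (V := V₁) (T := T₁) fun n => h _
  have p₂ := iterDom_properties (V := V₂) (T := T₂) fun n => h _
  set F : X → ℤ → X := fun y i =>
    if i₀ ≤ i then iterSeq T₁ (i - i₀).toNat y else iterSeq T₂ (i₀ - i).toNat y with hF
  set E : ℤ → Set X := fun i =>
    if i₀ ≤ i then iterDom V₁ T₁ (i - i₀).toNat else iterDom V₂ T₂ (i₀ - i).toNat with hE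
  have F₁ : ∀ y (n : ℕ), F y (i₀ + n) = iterSeq T₁ n y := fun y n => by simp [hF]
  have E₁ : ∀ n : ℕ, E (i₀ + n) = iterDom V₁ T₁ n := fun n => by simp [hE]
  have F₂ : ∀ y (n : ℕ), F y (i₀ - n) = iterSeq T₂ n y := by
    intro y n
    rcases n with - | n
    · simp [hF]; rfl
    · have : ¬ i₀ ≤ i₀ - ((n + 1 : ℕ) : ℤ) := by push_cast; omega
      simp only [hF, if_neg this]
      congr 1
      omega
  have E₂ : ∀ n : ℕ, E (i₀ - n) = iterDom V₂ T₂ n := by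
    intro n
    rcases n with - | n
    · simp [hE]; rfl
    · have : ¬ i₀ ≤ i₀ - ((n + 1 : ℕ) : ℤ) := by push_cast; omega
      simp only [hE, if_neg this]
      congr 1
      omega
  refine ⟨F, E, fun i => ?_, fun y => ?_, fun i hi y hy => ?_, fun i hi y hy => ?_⟩
  · rcases le_total i₀ i with hi | hi
    · obtain ⟨n, rfl⟩ := Int.le.dest hi
      rw [E₁]
      simp only [F₁]
      exact (p₁ n).1
    · obtain ⟨n, hn⟩ := Int.le.dest hi
      obtain rfl : i = i₀ - n := by omega
      rw [E₂]
      simp only [F₂]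
      exact (p₂ n).1
  · exact (by simpa using F₁ y 0 : F y i₀ = iterSeq T₁ 0 y)
  · obtain ⟨n, rfl⟩ := Int.le.dest hi
    have e : i₀ + (n : ℤ) + 1 = i₀ + ((n + 1 : ℕ) : ℤ) := by push_cast; ring
    rw [e, E₁] at hy
    rw [e, F₁, F₁]
    exact ⟨hy.2, rfl⟩
  · obtain ⟨n, hn⟩ := Int.le.dest (show i + 1 ≤ i₀ by omega)
    have e₁ : i + 1 = i₀ - (n : ℤ) := by omega
    have e₂ : i = i₀ - ((n + 1 : ℕ) : ℤ) := by push_cast; omega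
    have e₃ : i = i₀ - (n : ℤ) - 1 := by omega
    have hy' : y ∈ iterDom V₂ T₂ (n + 1) := by rw [← E₂, ← e₂]; exact hy
    have hF' : F y i = iterSeq T₂ (n + 1) y := by rw [← F₂, ← e₂]
    rw [e₁, F₂, hF']
    have h1 := hy'.2
    refine ⟨?_, ?_⟩
    · rw [e₃]; exact h1
    · rw [e₃]; rfl

end Iteration

/-! ### Common transforms of discrete curves. -/

section Discrete

/-- The second intersection of the circles through `a`, `b`, `y` and through `c`, `d`, `y`. -/
noncomputable def planeSecondMeet (a b c d y : Plane) : Plane :=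
  planeEquiv.symm (secondMeet (planeEquiv a) (planeEquiv b) (planeEquiv c) (planeEquiv d)
    (planeEquiv y))

/-- The points with a finite second intersection, such that neither it nor the point is one of
the given points. -/
def genericSet (a b c d : Plane) : Set Plane :=
  {y | IsGeneric (planeEquiv a) (planeEquiv b) (planeEquiv c) (planeEquiv d) (planeEquiv y)}

theorem isSmoothInvolution_planeSecondMeet {a b c d : Plane} (h : [a, b, c, d].Nodup) :
    IsSmoothInvolution (genericSet a b c d) (planeSecondMeet a b c d) := by
  simp only [List.nodup_cons, List.mem_cons, List.not_mem_nil, or_false, not_or,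
    not_false_eq_true, List.nodup_nil, and_true] at h
  obtain ⟨⟨hab, hac, had⟩, ⟨hbc, hbd⟩, hcd⟩ := h
  have inj : ∀ {x y : Plane}, x ≠ y → planeEquiv x ≠ planeEquiv y := fun h =>
    planeEquiv.injective.ne h
  refine ⟨?_, ?_, ?_, ?_, ?_⟩
  · exact (isOpen_isGeneric _ _ _ _).preimage planeEquiv.continuous
  · exact (dense_of_mem_residual (residual_isGeneric (inj hab) (inj hac) (inj had) (inj hbc)
      (inj hbd) (inj hcd))).preimage planeEquiv.toHomeomorph.isOpenMap
  · intro y hy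
    simp only [genericSet, mem_ofPred_eq, planeSecondMeet, LinearIsometryEquiv.apply_symm_apply]
    exact (IsGeneric.secondMeet_secondMeet (inj hab) (inj hcd) hy).1
  · intro y hy
    simp only [planeSecondMeet, LinearIsometryEquiv.apply_symm_apply]
    rw [(IsGeneric.secondMeet_secondMeet (inj hab) (inj hcd) hy).2]
    simp
  · intro y hy
    exact planeEquiv.symm.contDiff.contDiffAt.comp y
      ((contDiffAt_secondMeet hy.ne hy.det hy.meet).comp y planeEquiv.contDiff.contDiffAt)

theorem genericSet_ne {a b c d y : Plane} (hy : y ∈ genericSet a b c d) :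
    y ≠ a ∧ y ≠ b ∧ y ≠ c ∧ y ≠ d :=
  ⟨fun h => hy.ne.1 (h ▸ rfl), fun h => hy.ne.2.1 (h ▸ rfl), fun h => hy.ne.2.2.1 (h ▸ rfl),
    fun h => hy.ne.2.2.2 (h ▸ rfl)⟩

theorem planeSecondMeet_ne {a b c d y : Plane} (hy : y ∈ genericSet a b c d) :
    planeSecondMeet a b c d y ≠ y := by
  intro h
  have := congrArg planeEquiv h
  rw [planeSecondMeet, LinearIsometryEquiv.apply_symm_apply] at this
  exact IsGeneric.secondMeet_ne hy this

theorem finrank_and_iff_eq_planeSecondMeet {a b c d y z : Plane} (hab : a ≠ b) (hcd : c ≠ d)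
    (hy : y ∈ genericSet a b c d) (hz : z ≠ y) :
    (Module.finrank ℝ (span ℝ
        ({pointLift a, pointLift b, pointLift y, pointLift z} : Set LieSpace)) = 3 ∧
      Module.finrank ℝ (span ℝ
        ({pointLift c, pointLift d, pointLift y, pointLift z} : Set LieSpace)) = 3) ↔
      z = planeSecondMeet a b c d y := by
  obtain ⟨h1, h2, h3, h4⟩ := genericSet_ne hy
  rw [finrank_span_pointLift_iff hab h1 h2, finrank_span_pointLift_iff hcd h3 h4,
    IsGeneric.concircular_and_iff hy (planeEquiv.injective.ne hz), planeSecondMeet,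
    LinearIsometryEquiv.eq_symm_apply]

theorem exists_discrete_transforms {I : Set ℤ} (hI : I.OrdConnected) {i₀ : ℤ} (hi₀ : i₀ ∈ I)
    {x₀ x₁ : ℤ → Plane}
    (hx : ∀ i, i ∈ I → i + 1 ∈ I → [x₀ i, x₀ (i + 1), x₁ i, x₁ (i + 1)].Nodup) :
    ∃ (F : Plane → ℤ → Plane) (G : Set Plane), G ∈ residual Plane ∧ (I.Finite → IsOpen G) ∧
      ∀ y ∈ G, F y i₀ = y ∧ IsCommonDiscreteTransform I x₀ x₁ (F y) ∧
        (∀ z, z i₀ = y → IsCommonDiscreteTransform I x₀ x₁ z → EqOn z (F y) I) ∧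
        ∀ i ∈ I, ContDiffAt ℝ ∞ (fun y' => F y' i) y := by
  classical
  set edge : ℤ → Prop := fun i => i ∈ I ∧ i + 1 ∈ I
  -- Outside the edges of `I` the identity on the whole plane serves as a harmless default, so that
  -- the iteration runs over all integers.
  set V : ℤ → Set Plane := fun i =>
    if edge i then genericSet (x₀ i) (x₀ (i + 1)) (x₁ i) (x₁ (i + 1)) else univ with hV
  set T : ℤ → Plane → Plane := fun i =>
    if edge i then planeSecondMeet (x₀ i) (x₀ (i + 1)) (x₁ i) (x₁ (i + 1)) else id with hT
  have hVT : ∀ i, IsSmoothInvolution (V i) (T i) := by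
    intro i
    by_cases hi : edge i
    · simp only [hV, hT, if_pos hi]
      exact isSmoothInvolution_planeSecondMeet (hx i hi.1 hi.2)
    · simp only [hV, hT, if_neg hi]
      exact isSmoothInvolution_id
  obtain ⟨F, E, hE, hF0, hFr, hFl⟩ := exists_iteration hVT i₀
  have hstep : ∀ y, (∀ i ∈ I, y ∈ E i) → ∀ i, edge i → F y i ∈ V i ∧ F y (i + 1) ∈ V i ∧
      F y (i + 1) = T i (F y i) ∧ F y i = T i (F y (i + 1)) := by
    intro y hy i hi
    rcases le_or_gt i₀ i with h | h
    · obtain ⟨h1, h2⟩ := hFr i h y (hy _ hi.2)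
      exact ⟨h1, h2 ▸ (hVT i).mapsTo h1, h2, by rw [h2, (hVT i).invol _ h1]⟩
    · obtain ⟨h1, h2⟩ := hFl i h y (hy _ hi.1)
      exact ⟨h2 ▸ (hVT i).mapsTo h1, h1, by rw [h2, (hVT i).invol _ h1], h2⟩
  have hnodup : ∀ i, edge i → x₀ i ≠ x₀ (i + 1) ∧ x₁ i ≠ x₁ (i + 1) := by
    intro i hi
    have := hx i hi.1 hi.2
    simp at this
    exact ⟨this.1.1, this.2.2⟩
  -- The first two conditions matter when `I` has no edge. Otherwise genericity on an edge already
  -- separates the points from those of x₀ and x₁.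
  refine ⟨F, {y | y ≠ x₀ i₀} ∩ {y | y ≠ x₁ i₀} ∩ ⋂ i ∈ I, E i, ?_, ?_, ?_⟩
  · refine Filter.inter_mem (Filter.inter_mem
      (residual_of_dense_open isOpen_ne (dense_compl_singleton _))
      (residual_of_dense_open isOpen_ne (dense_compl_singleton _))) ?_
    exact (countable_bInter_mem I.to_countable).2 fun i _ =>
      residual_of_dense_open (hE i).1 (hE i).2.1
  · intro hfin
    exact (isOpen_ne.inter isOpen_ne).inter (hfin.isOpen_biInter fun i _ => (hE i).1)
  · rintro y ⟨⟨hy0, hy1⟩, hyE⟩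
    have hyE' : ∀ i ∈ I, y ∈ E i := fun i hi => mem_iInter₂.1 hyE i hi
    have hs := hstep y hyE'
    have hgen : ∀ i, edge i → F y i ∈ genericSet (x₀ i) (x₀ (i + 1)) (x₁ i) (x₁ (i + 1)) ∧
        F y (i + 1) ∈ genericSet (x₀ i) (x₀ (i + 1)) (x₁ i) (x₁ (i + 1)) ∧
        F y (i + 1) = planeSecondMeet (x₀ i) (x₀ (i + 1)) (x₁ i) (x₁ (i + 1)) (F y i) ∧
        F y i = planeSecondMeet (x₀ i) (x₀ (i + 1)) (x₁ i) (x₁ (i + 1)) (F y (i + 1)) := by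
      intro i hi
      have := hs i hi
      simpa only [hV, hT, if_pos hi] using this
    have hcirc : ∀ i, edge i → _ := fun i hi =>
      (finrank_and_iff_eq_planeSecondMeet (hnodup i hi).1 (hnodup i hi).2 (hgen i hi).1
        (z := F y (i + 1)) (by
          rw [(hgen i hi).2.2.1]; exact planeSecondMeet_ne (hgen i hi).1)).2 (hgen i hi).2.2.1
    have hne : ∀ i ∈ I, x₀ i ≠ F y i ∧ x₁ i ≠ F y i := by
      intro i hi
      rcases lt_trichotomy i₀ i with h | h | h
      · have he : edge (i - 1) := ⟨hI.out hi₀ hi ⟨by omega, by omega⟩, by simpa using hi⟩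
        have := genericSet_ne (hgen _ he).2.1
        rw [sub_add_cancel] at this
        exact ⟨this.2.1.symm, this.2.2.2.symm⟩
      · rw [← h, hF0]; exact ⟨Ne.symm hy0, Ne.symm hy1⟩
      · have he : edge i := ⟨hi, hI.out hi hi₀ ⟨by omega, by omega⟩⟩
        have := genericSet_ne (hgen _ he).1
        exact ⟨this.1.symm, this.2.2.1.symm⟩
    refine ⟨hF0 y, ⟨?_, ⟨fun i hi => (hne i hi).1, fun i h1 h2 => (hcirc i ⟨h1, h2⟩).1⟩,
      ⟨fun i hi => (hne i hi).2, fun i h1 h2 => (hcirc i ⟨h1, h2⟩).2⟩⟩, ?_,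
      fun i hi => (hE i).2.2 y (hyE' i hi)⟩
    · intro i h1 h2
      rw [(hgen i ⟨h1, h2⟩).2.2.1]
      exact (planeSecondMeet_ne (hgen i ⟨h1, h2⟩).1).symm
    · intro z hz0 hz
      have hright : ∀ i, edge i → z i = F y i → z (i + 1) = F y (i + 1) := by
        intro i hi e
        rw [(hgen i hi).2.2.1]
        refine (finrank_and_iff_eq_planeSecondMeet (hnodup i hi).1 (hnodup i hi).2 (hgen i hi).1
          ?_).1 ⟨?_, ?_⟩
        · rw [← e]; exact (hz.curve i hi.1 hi.2).symm
        · rw [← e]; exact hz.pair₀.circular i hi.1 hi.2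
        · rw [← e]; exact hz.pair₁.circular i hi.1 hi.2
      -- The involution makes the step symmetric: `F y i` is the second intersection determined by
      -- `F y (i + 1)`, so uniqueness propagates backwards too.
      have hleft : ∀ i, edge i → z (i + 1) = F y (i + 1) → z i = F y i := by
        intro i hi e
        rw [(hgen i hi).2.2.2]
        refine (finrank_and_iff_eq_planeSecondMeet (hnodup i hi).1 (hnodup i hi).2 (hgen i hi).2.1
          ?_).1 ⟨?_, ?_⟩
        · rw [← e]; exact hz.curve i hi.1 hi.2
        · rw [← e, pair_comm]; exact hz.pair₀.circular i hi.1 hi.2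
        · rw [← e, pair_comm]; exact hz.pair₁.circular i hi.1 hi.2
      have base : z i₀ = F y i₀ := hz0.trans (hF0 y).symm
      have up : ∀ n : ℕ, i₀ + n ∈ I → z (i₀ + n) = F y (i₀ + n) := by
        intro n
        induction n with
        | zero => intro _; simpa using base
        | succ n ih =>
          intro hn
          push_cast at hn ⊢
          rw [← add_assoc] at hn ⊢
          have hn' : i₀ + (n : ℤ) ∈ I := hI.out hi₀ hn ⟨by omega, by omega⟩
          exact hright _ ⟨hn', hn⟩ (ih hn')
      have down : ∀ n : ℕ, i₀ - n ∈ I → z (i₀ - n) = F y (i₀ - n) := by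
        intro n
        induction n with
        | zero => intro _; simpa using base
        | succ n ih =>
          intro hn
          have hn' : i₀ - (n : ℤ) ∈ I := hI.out hn hi₀ ⟨by push_cast; omega, by omega⟩
          have e : i₀ - ((n + 1 : ℕ) : ℤ) + 1 = i₀ - (n : ℤ) := by push_cast; ring
          exact hleft _ ⟨hn, by rw [e]; exact hn'⟩ (by rw [e]; exact ih hn')
      intro i hi
      rcases le_total i₀ i with h | h
      · obtain ⟨n, rfl⟩ := Int.le.dest h
        exact up n hi
      · obtain ⟨n, hn⟩ := Int.le.dest h
        obtain rfl : i = i₀ - n := by omega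
        exact down n hi

end Discrete

theorem mainTheorem6 :
    -- smooth curves
    (∀ (I : Set ℝ), I.OrdConnected → I.Nontrivial →
      ∀ (x₀ n₀ x₁ n₁ : ℝ → Plane), IsFramedCurve I x₀ n₀ → IsFramedCurve I x₁ n₁ →
      -- the curves do not touch a common oriented circle at corresponding points
      (∀ u ∈ I, Disjoint (legendreLift x₀ n₀ u) (legendreLift x₁ n₁ u)) →
      -- the sum of the Legendre lifts is a bundle of (2,2)-planes
      (∀ u ∈ I, IsTwoTwoPlane (legendreLift x₀ n₀ u ⊔ legendreLift x₁ n₁ u)) ∧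
      -- a 1-parameter family of null 2-plane subbundles, and of curves of their points
      ∃ (L : Projectivization ℝ (Fin 2 → ℝ) → ℝ → Submodule ℝ LieSpace)
        (y : Projectivization ℝ (Fin 2 → ℝ) → ℝ → Plane),
        -- which depends smoothly on the parameter
        (∃ s t : Fin 2 → ℝ → LieSpace,
          (∀ j, ContDiffOn ℝ ∞ (s j) I ∧ ContDiffOn ℝ ∞ (t j) I) ∧
          (∀ u ∈ I, Submodule.span ℝ {s 0 u, s 1 u} = legendreLift x₀ n₀ u ∧
            Submodule.span ℝ {t 0 u, t 1 u} = legendreLift x₁ n₁ u) ∧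
          ∀ (a : Fin 2 → ℝ) (ha : a ≠ 0), ∀ u ∈ I, L (Projectivization.mk ℝ a ha) u =
            Submodule.span ℝ {a 0 • s 0 u + a 1 • s 1 u, a 0 • t 0 u + a 1 • t 1 u}) ∧
        -- it consists of common Ribaucour transforms
        (∀ c, IsCommonLieTransform I (legendreLift x₀ n₀) (legendreLift x₁ n₁) (L c) ∧
          ∀ u ∈ I, L c u ≤ legendreLift x₀ n₀ u ⊔ legendreLift x₁ n₁ u) ∧
        -- it contains all of them
        (∀ Λ, IsCommonLieTransform I (legendreLift x₀ n₀) (legendreLift x₁ n₁) Λ →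
          ∃! c, Set.EqOn Λ (L c) I) ∧
        -- the members are disjoint, and given by arbitrary initial data
        (∀ c c', c ≠ c' → ∀ u ∈ I, Disjoint (L c u) (L c' u)) ∧
        (∀ u ∈ I, ∀ W, IsNullPlane W → legendreLift x₀ n₀ u ⊓ W ≠ ⊥ →
          legendreLift x₁ n₁ u ⊓ W ≠ ⊥ → ∃! c, L c u = W) ∧
        -- `y c` is the curve of points of `L c`
        (∀ c, ∀ u ∈ I, infinityVec ∉ L c u →
          ContDiffWithinAt ℝ ∞ (y c) I u ∧ pointLift (y c u) ∈ L c u) ∧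
        -- it is a common Ribaucour transform of the two given curves where it is regular
        (∀ c, ∀ u ∈ I, IsRegularPoint I x₀ x₁ (L c) (y c) u →
          IsRibaucourPairAt I x₀ (y c) u ∧ IsRibaucourPairAt I x₁ (y c) u) ∧
        -- near a given parameter value, all members but at most five are regular
        (∀ u₀ ∈ I, {c | ¬ ∀ᶠ u in 𝓝[I] u₀,
          IsRegularPoint I x₀ x₁ (L c) (y c) u}.encard ≤ 5) ∧
        -- all members but countably many are regular on a dense subset of the interval
        {c | ¬ I ⊆ closure {u ∈ I | IsRegularPoint I x₀ x₁ (L c) (y c) u}}.Countable) ∧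
    -- discrete curves
    (∀ (I : Set ℤ), I.OrdConnected → ∀ i₀ ∈ I, ∀ (x₀ x₁ : ℤ → Plane),
      -- corresponding edges have four distinct endpoints
      (∀ i, i ∈ I → i + 1 ∈ I → [x₀ i, x₀ (i + 1), x₁ i, x₁ (i + 1)].Nodup) →
      -- for a generic initial point there is a unique common Ribaucour transform
      ∃ (F : Plane → ℤ → Plane) (G : Set Plane),
        G ∈ residual Plane ∧ (I.Finite → IsOpen G) ∧
        ∀ y ∈ G, F y i₀ = y ∧ IsCommonDiscreteTransform I x₀ x₁ (F y) ∧
          (∀ z, z i₀ = y → IsCommonDiscreteTransform I x₀ x₁ z → Set.EqOn z (F y) I) ∧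
          ∀ i ∈ I, ContDiffAt ℝ ∞ (fun y' => F y' i) y) := by
  refine ⟨fun I hI hn x₀ n₀ x₁ n₁ hx₀ hx₁ hd => ?_, fun I hI i₀ hi₀ x₀ x₁ hx =>
    exists_discrete_transforms hI hi₀ hx⟩
  obtain ⟨s, t, h, h₀, h₁⟩ := exists_parallelFrame_legendreLift hI hn hx₀ hx₁ hd
  have hU := uniqueDiffOn_of_ordConnected hI hn
  refine ⟨fun u hu => ?_, ribaucourFamily s t, familyPoint s t,
    ⟨s, t, fun j => ⟨h.smooth_left j, h.smooth_right j⟩, fun u hu => ⟨h₀ u hu, h₁ u hu⟩,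
      fun a ha u _ => ribaucourFamily_mk s t ha u⟩,
    fun c => ⟨h.isCommonLieTransform hU h₀ h₁ c, fun u hu => ?_⟩,
    fun Λ hΛ => h.existsUnique_eqOn hI hn h₀ h₁ hΛ, fun c c' hc u hu => h.disjoint hc hu,
    fun u hu W hW hW₀ hW₁ => ?_, fun c u hu hq => ?_, fun c u hu hr => ?_,
    fun u hu => h.encard_not_regular_le_five hU hx₀ hx₁.smooth_curve.continuousOn h₀ hu,
    h.countable_not_dense_regular hU hx₀ hx₁.smooth_curve.continuousOn h₀⟩
  · rw [← h₀ u hu, ← h₁ u hu]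
    exact (h.hyperbolic u hu).isTwoTwoPlane
  · rw [← h₀ u hu, ← h₁ u hu]
    exact ribaucourFamily_le_sup s t c u
  · rw [← h₀ u hu] at hW₀
    rw [← h₁ u hu] at hW₁
    exact h.existsUnique_eq hu hW hW₀ hW₁
  · have h0 : (familyVec s t c u).1 ≠ 0 := fun h0 => hq ((h.infinityVec_mem_iff c hu).2 h0)
    exact ⟨h.contDiffWithinAt_familyPoint c hu h0, h.pointLift_mem c hu h0⟩
  · have h0 : (familyVec s t c u).1 ≠ 0 := fun h0 =>
      hr.finite ((h.infinityVec_mem_iff c hu).2 h0)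
    have hh := h.hyperbolic u hu
    constructor
    · refine h.isRibaucourPairAt hU c hu hx₀ (hh.comb_left_ne_zero c.rep_nonzero) ?_
        (subset_span (by simp)) h0 hr.immersed hr.ne₀
      rw [← h₀ u hu]
      exact comb_mem_span (fun j => s j u) c.rep
    · refine h.isRibaucourPairAt hU c hu hx₁ (hh.comb_right_ne_zero c.rep_nonzero) ?_
        (subset_span (by simp)) h0 hr.immersed hr.ne₁
      rw [← h₁ u hu]
      exact comb_mem_span (fun j => t j u) c.rep
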